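/- **Theorem 4.** Let $F=\mathrm{GF}(p)$ be a finite field of order $p$ and let $r\ge 1$ be an integer. Consider the problem *Robust $\ell_0$-Low Rank Approximation* over $F$ with rank $r$: given an $m\times n$ matrix $A$ over $F$ and non-negative integers $B$ and $\ell$, decide whether there are $m\times n$ matrices $L$ and $C$ over $F$ such that $\operatorname{rank}_F L\le r$, at most $\ell$ columns of $C$ are non-zero, and $\|A-L-C\|_0\le B$, where $\|\cdot\|_0$ is the number of non-zero entries. For every fixed $p$ and $r$ this problem is fixed-parameter tractable parameterized by $B$: there are an algorithm, a function $f:\mathbb N\to\mathbb N$ and a constant $c$ (all of which may depend on $p$ and $r$) such that the algorithm decides every instance $I=(A,B,\ell)$ in at most $f(B)\cdot |I|^{c}$ steps, where $|I|$ is the length of the encoding of $I$ as a word over a finite alphabet. -/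

import Mathlib

/-! ### Random access machines with a step count -/

namespace RAM

/-- Expressions of the programming language. Variables and arrays are named by natural numbers;
a program mentions only finitely many of them. -/
inductive Expr where
  | const (c : ℕ) : Expr
  | var (x : ℕ) : Expr
  | get (a : ℕ) (i : Expr) : Expr
  | add (e₁ e₂ : Expr) : Expr
  | sub (e₁ e₂ : Expr) : Expr

/-- Programs of the random access machine: assignment to a variable, assignment to an array cell,
composition, branching on whether a value is nonzero, and looping while a value is nonzero. -/
inductive Prog where
  | skip : Prog
  | assign (x : ℕ) (e : Expr) : Prog
  | store (a : ℕ) (i e : Expr) : Prog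
  | seq (P Q : Prog) : Prog
  | cond (e : Expr) (P Q : Prog) : Prog
  | loop (e : Expr) (P : Prog) : Prog

/-- A memory state: the contents of the variables and of the arrays. -/
structure State where
  var : ℕ → ℕ
  arr : ℕ → ℕ → ℕ

/-- The value of an expression. Subtraction is truncated at zero. There is deliberately no
multiplication: with addition and subtraction as the only arithmetic operations at unit cost,
running times agree with those of Turing machines up to a polynomial. -/
def Expr.eval (s : State) : Expr → ℕ
  | const c => c
  | var x => s.var x
  | get a i => s.arr a (i.eval s)
  | add e₁ e₂ => e₁.eval s + e₂.eval s
  | sub e₁ e₂ => e₁.eval s - e₂.eval s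

/-- The number of elementary operations needed to evaluate an expression. -/
def Expr.cost : Expr → ℕ
  | const _ => 1
  | var _ => 1
  | get _ i => i.cost + 1
  | add e₁ e₂ => e₁.cost + e₂.cost + 1
  | sub e₁ e₂ => e₁.cost + e₂.cost + 1

/-- The state after writing `v` into the variable `x`. -/
def State.setVar (s : State) (x v : ℕ) : State :=
  { s with var := Function.update s.var x v }

/-- The state after writing `v` into cell `i` of the array `a`. -/
def State.setArr (s : State) (a i v : ℕ) : State :=
  { s with arr := Function.update s.arr a (Function.update (s.arr a) i v) }

/-- `Exec P s t s'`: the program `P`, started in state `s`, halts after exactly `t` elementary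
steps in state `s'`. -/
inductive Exec : Prog → State → ℕ → State → Prop where
  | skip (s : State) : Exec .skip s 1 s
  | assign (s : State) (x : ℕ) (e : Expr) :
      Exec (.assign x e) s (e.cost + 1) (s.setVar x (e.eval s))
  | store (s : State) (a : ℕ) (i e : Expr) :
      Exec (.store a i e) s (i.cost + e.cost + 1) (s.setArr a (i.eval s) (e.eval s))
  | seq {P Q : Prog} {s s' s'' : State} {t t' : ℕ} :
      Exec P s t s' → Exec Q s' t' s'' → Exec (.seq P Q) s (t + t') s''
  | cond_true {e : Expr} {P Q : Prog} {s s' : State} {t : ℕ} :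
      e.eval s ≠ 0 → Exec P s t s' → Exec (.cond e P Q) s (e.cost + 1 + t) s'
  | cond_false {e : Expr} {P Q : Prog} {s s' : State} {t : ℕ} :
      e.eval s = 0 → Exec Q s t s' → Exec (.cond e P Q) s (e.cost + 1 + t) s'
  | loop_done {e : Expr} {P : Prog} {s : State} :
      e.eval s = 0 → Exec (.loop e P) s (e.cost + 1) s
  | loop_step {e : Expr} {P : Prog} {s s' s'' : State} {t t' : ℕ} :
      e.eval s ≠ 0 → Exec P s t s' → Exec (.loop e P) s' t' s'' →
        Exec (.loop e P) s (e.cost + 1 + t + t') s''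

/-- Execution is deterministic: the running time and the final state are determined by the
program and the initial state. -/
theorem Exec.deterministic {P : Prog} {s : State} {t₁ t₂ : ℕ} {s₁ s₂ : State}
    (h₁ : Exec P s t₁ s₁) (h₂ : Exec P s t₂ s₂) : t₁ = t₂ ∧ s₁ = s₂ := by
  induction h₁ generalizing t₂ s₂ with
  | skip s => cases h₂; exact ⟨rfl, rfl⟩
  | assign s x e => cases h₂; exact ⟨rfl, rfl⟩
  | store s a i e => cases h₂; exact ⟨rfl, rfl⟩
  | seq _ _ ih ih' =>
    cases h₂ with
    | seq h h' =>
      obtain ⟨rfl, rfl⟩ := ih h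
      obtain ⟨rfl, rfl⟩ := ih' h'
      exact ⟨rfl, rfl⟩
  | cond_true h0 _ ih =>
    cases h₂ with
    | cond_true _ h => obtain ⟨rfl, rfl⟩ := ih h; exact ⟨rfl, rfl⟩
    | cond_false h0' _ => exact absurd h0' h0
  | cond_false h0 _ ih =>
    cases h₂ with
    | cond_true h0' _ => exact absurd h0 h0'
    | cond_false _ h => obtain ⟨rfl, rfl⟩ := ih h; exact ⟨rfl, rfl⟩
  | loop_done h0 =>
    cases h₂ with
    | loop_done _ => exact ⟨rfl, rfl⟩
    | loop_step h0' _ _ => exact absurd h0 h0'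
  | loop_step h0 _ _ ih ih' =>
    cases h₂ with
    | loop_done h0' => exact absurd h0' h0
    | loop_step _ h h' =>
      obtain ⟨rfl, rfl⟩ := ih h
      obtain ⟨rfl, rfl⟩ := ih' h'
      exact ⟨rfl, rfl⟩

/-- The initial state on an input word `w` (a list of symbol codes) with parameter `k`:
variable `0` holds the length of `w`, variable `1` holds `k`, the first cells of array `0` hold
the symbols of `w`, and everything else is zero. -/
def initState (w : List ℕ) (k : ℕ) : State where
  var x := if x = 0 then w.length else if x = 1 then k else 0
  arr a i := if a = 0 then w.getD i 0 else 0

end RAM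

/-! ### Fixed-parameter tractability -/

/-- A parameterized problem over the alphabet `Γ`: a set of pairs of a word and a parameter. -/
abbrev ParamProblem (Γ : Type*) : Type _ := Set (List Γ × ℕ)

/-- A parameterized problem `Q` over a finite alphabet is fixed-parameter tractable if a single
program decides `(w, k) ∈ Q` (variable `0` holds `1` on acceptance and `0` on rejection) in at
most `f k * (|w| + 1) ^ c` steps, for some function `f` and some constant `c`; this is required
for each numbering `code` of the alphabet. The `+ 1` takes care of the empty word. -/
def IsFPT {Γ : Type*} [Fintype Γ] (Q : ParamProblem Γ) : Prop :=
  ∀ code : Γ ≃ Fin (Fintype.card Γ),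
    ∃ (P : RAM.Prog) (f : ℕ → ℕ) (c : ℕ), ∀ (w : List Γ) (k : ℕ),
      ∃ (t : ℕ) (s : RAM.State),
        RAM.Exec P (RAM.initState (w.map fun x => (code x : ℕ)) k) t s ∧
        t ≤ f k * (w.length + 1) ^ c ∧
        ((w, k) ∈ Q → s.var 0 = 1) ∧ ((w, k) ∉ Q → s.var 0 = 0)

/-! ### Robust low rank approximation -/

namespace RobustLRA

/-- `A` is approximated with at most `B` errors by a matrix `L` of rank at most `r`, up to a
matrix `C` of outliers with at most `ℓ` nonzero columns. -/
def IsYes {F : Type*} [Field F] {m n : ℕ} (A : Matrix (Fin m) (Fin n) F) (r B ℓ : ℕ) : Prop :=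
  ∃ L C : Matrix (Fin m) (Fin n) F,
    L.rank ≤ r ∧
    {j : Fin n | ∃ i, C i j ≠ 0}.ncard ≤ ℓ ∧
    {ij : Fin m × Fin n | (A - L - C) ij.1 ij.2 ≠ 0}.ncard ≤ B

/-- The input alphabet: field elements, the two bits, and the separator `none`. -/
abbrev Letter (F : Type*) : Type _ := Option (F ⊕ Bool)

/-- The input word for a matrix `A` and a number `ℓ`: the binary expansion of `ℓ` (least
significant bit first) and a separator, followed by the columns of `A`, each of them terminated
by a separator. -/
def encode {F : Type*} {m n : ℕ} (A : Matrix (Fin m) (Fin n) F) (ℓ : ℕ) : List (Letter F) :=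
  (Nat.bits ℓ).map (fun b => some (Sum.inr b)) ++ [none] ++
    (List.ofFn fun j : Fin n =>
      (List.ofFn fun i : Fin m => some (Sum.inl (A i j))) ++ [none]).flatten

/-- Robust `ℓ₀`-low rank approximation over the field `F` for the fixed rank `r`, as a
problem parameterized by the number `B` of errors: the pairs of an input word encoding `(A, ℓ)`
and a number `B` for which `(A, r, B, ℓ)` is a yes-instance. -/
def problem (F : Type*) [Field F] (r : ℕ) : ParamProblem (Letter F) :=
  {x | ∃ (m n : ℕ) (A : Matrix (Fin m) (Fin n) F) (ℓ : ℕ),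
    x.1 = encode A ℓ ∧ IsYes A r x.2 ℓ}

end RobustLRA

/-! ### Functions computable in polynomial time on the random access machine -/

/-! Write k for the error bound and Q for the number of vectors with r entries, a constant. In a
yes-instance the kept columns of L are combinations of r of them. The same r columns of A form a
matrix G which differs from these columns of L in at most k rows, because every such row contains an
error. So once r column indices are guessed (polynomially many choices), it remains to change at
most k rows of G. For a given changed matrix the best solution is immediate: each column of A takes
the nearest of the Q linear combinations, and the n - ℓ columns with the smallest distances are kept
(`exists_card_sum_le_iff`).

Guessing the k rows blindly would cost m ^ k. It is enough to change rows in which the change lowers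
the number of errors. Group the kept columns by their coefficient vectors. For such a row, some
class has a strict majority of columns that disagree with G there, while each kept column disagrees
with G in at most 2k rows. Give every class k slots, to be filled by columns of the class; then each
changed row lies in the disagreement sets of at least a quarter of the slots of one class
(`IsYes.exists_modification`).

The search guesses for each change the row, the new row, the class and the set of slots. The columns
in the slots are never guessed; it is only tested that every slot in use can still be filled by some
column. The size of the search is controlled by a potential: the product over all Qk slots of the
number of possible fillers to the power 4/k. It starts at no more than N ^ (4Q) for N candidate
columns, it is at least 1 while all slots can be filled, and summed over all choices of the next row
it grows by a factor of at most 2k (`sum_potential_le`). Hence the number of visited words is a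
function of k times a polynomial (`visited_blocks_le`, `visited_admissible_le`).

On the side of the machine, `Comp` is a class of polynomial time functions with enough closure
properties to express the tests, and `exists_search` is a depth-first search over words whose
prefixes pass such a test. `exists_decides_of_search` combines the two with a bound on the number of
visited words, and `mem_problem_iff` is the correctness of the search. -/

namespace RAM

open Classical in
/-- The indicator of a proposition as a natural number. -/
noncomputable def ind (p : Prop) : ℕ := if p then 1 else 0

theorem ind_of {p : Prop} (h : p) : ind p = 1 := if_pos h

theorem ind_of_not {p : Prop} (h : ¬ p) : ind p = 0 := if_neg h

/-- `C` is bounded by a polynomial in `b`. -/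
def PolyBdd {α : Type*} (b C : α → ℕ) : Prop := ∃ K d, ∀ a, C a ≤ K * (b a + 1) ^ d

namespace PolyBdd

variable {α : Type*} {b C C' : α → ℕ}

theorem const (b : α → ℕ) (c : ℕ) : PolyBdd b (fun _ => c) := ⟨c, 0, by simp⟩

theorem self (b : α → ℕ) : PolyBdd b b := ⟨1, 1, by simp⟩

theorem add (h : PolyBdd b C) (h' : PolyBdd b C') : PolyBdd b (fun a => C a + C' a) := by
  obtain ⟨K, d, h⟩ := h
  obtain ⟨K', d', h'⟩ := h'
  refine ⟨K + K', d + d', fun a => ?_⟩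
  have h1 : (b a + 1) ^ d ≤ (b a + 1) ^ (d + d') := Nat.pow_le_pow_right (by omega) (by omega)
  have h2 : (b a + 1) ^ d' ≤ (b a + 1) ^ (d + d') := Nat.pow_le_pow_right (by omega) (by omega)
  calc C a + C' a ≤ K * (b a + 1) ^ d + K' * (b a + 1) ^ d' := add_le_add (h a) (h' a)
    _ ≤ K * (b a + 1) ^ (d + d') + K' * (b a + 1) ^ (d + d') := by gcongr
    _ = _ := by ring

theorem mul (h : PolyBdd b C) (h' : PolyBdd b C') : PolyBdd b (fun a => C a * C' a) := by
  obtain ⟨K, d, h⟩ := h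
  obtain ⟨K', d', h'⟩ := h'
  refine ⟨K * K', d + d', fun a => ?_⟩
  calc C a * C' a ≤ (K * (b a + 1) ^ d) * (K' * (b a + 1) ^ d') := Nat.mul_le_mul (h a) (h' a)
    _ = _ := by ring

end PolyBdd

/-- A context: the contents of the arrays, a list of numerical quantities held in variables, and
the quantity in terms of which running times are measured, all depending on an element of `α`. -/
structure Ctx (α : Type*) where
  bound : α → ℕ
  mem : α → ℕ → ℕ → ℕ
  vars : List (α → ℕ)

variable {α : Type*}

/-- The context with one more local variable. -/
def Ctx.push (Γ : Ctx α) : Ctx (α × ℕ) where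
  bound p := Γ.bound p.1
  mem p := Γ.mem p.1
  vars := Γ.vars.map (fun f p => f p.1) ++ [fun p => p.2]

/-- The state `s` holds the quantities of the context `Γ` at `a`, the `i`-th one in the variable
`loc i`. -/
def Ctx.Matches (Γ : Ctx α) (loc : ℕ → ℕ) (a : α) (s : State) : Prop :=
  s.arr = Γ.mem a ∧ ∀ i f, Γ.vars[i]? = some f → s.var (loc i) = f a

/-- The program `P` writes `φ a` into the variable `N`, preserving the arrays and all variables
below `N`, in at most `C a` steps. -/
def Computes (Γ : Ctx α) (loc : ℕ → ℕ) (φ C : α → ℕ) (N : ℕ) (P : Prog) : Prop :=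
  ∀ a s, Γ.Matches loc a s → ∃ t s', Exec P s t s' ∧ s'.arr = s.arr ∧
    (∀ i < N, s'.var i = s.var i) ∧ s'.var N = φ a ∧ t ≤ C a

/-- The function `φ` is computable in polynomial time from the quantities of the context. -/
def Comp (Γ : Ctx α) (φ : α → ℕ) : Prop :=
  ∃ C, PolyBdd Γ.bound C ∧ ∀ (N : ℕ) (loc : ℕ → ℕ), (∀ i < Γ.vars.length, loc i < N) →
    ∃ P, Computes Γ loc φ C N P

/-- The predicate `p` is decidable in polynomial time from the quantities of the context. -/
def CompP (Γ : Ctx α) (p : α → Prop) : Prop := Comp Γ (fun a => ind (p a))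

/-- Programs that compute an expression touch only variables from `N` on, whereas the context lives
below `N`. This invariance is what allows such programs to be run one after another. -/
theorem Ctx.Matches.of_eq {Γ : Ctx α} {loc : ℕ → ℕ} {a : α} {s s' : State} {N : ℕ}
    (h : Γ.Matches loc a s) (hl : ∀ i < Γ.vars.length, loc i < N) (harr : s'.arr = s.arr)
    (hv : ∀ i < N, s'.var i = s.var i) : Γ.Matches loc a s' := by
  refine ⟨harr.trans h.1, fun i f hf => ?_⟩
  have hi : i < Γ.vars.length := (List.getElem?_eq_some_iff.1 hf).1
  rw [hv _ (hl i hi), h.2 i f hf]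

@[simp] theorem State.setVar_arr (s : State) (x v : ℕ) : (s.setVar x v).arr = s.arr := rfl

@[simp] theorem State.setVar_var (s : State) (x v y : ℕ) :
    (s.setVar x v).var y = if y = x then v else s.var y := by
  simp [State.setVar, Function.update_apply]

@[simp] theorem State.setArr_var (s : State) (a i v : ℕ) : (s.setArr a i v).var = s.var := rfl

theorem State.setArr_arr (s : State) (a i v : ℕ) :
    (s.setArr a i v).arr = Function.update s.arr a (Function.update (s.arr a) i v) := rfl

theorem Ctx.Matches.push {Γ : Ctx α} {loc : ℕ → ℕ} {a : α} {s : State} {v M : ℕ}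
    (h : Γ.Matches loc a s) (hv : s.var M = v) :
    Γ.push.Matches (fun i => if i < Γ.vars.length then loc i else M) (a, v) s := by
  refine ⟨h.1, fun i f hf => ?_⟩
  simp only [Ctx.push] at hf
  show s.var (if i < Γ.vars.length then loc i else M) = _
  split_ifs with hi
  · rw [List.getElem?_append_left (by simpa using hi), List.getElem?_map,
      Option.map_eq_some_iff] at hf
    obtain ⟨g, hg, rfl⟩ := hf
    exact h.2 i g hg
  · rw [List.getElem?_append_right (by simpa using hi), List.getElem?_singleton] at hf
    split_ifs at hf
    obtain rfl := Option.some.inj hf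
    exact hv

theorem Ctx.push_length (Γ : Ctx α) : Γ.push.vars.length = Γ.vars.length + 1 := by
  simp [Ctx.push]

/-! ### Closure properties of polynomial time functions -/

namespace Comp

variable {Γ : Ctx α} {f g h : α → ℕ}

theorem const (Γ : Ctx α) (c : ℕ) : Comp Γ (fun _ => c) := by
  refine ⟨_, .const _ 2, fun N loc hl => ⟨.assign N (.const c), fun a s hs => ?_⟩⟩
  refine ⟨_, _, .assign _ _ _, rfl, fun i hi => ?_, ?_, le_rfl⟩
  · simp [hi.ne]
  · simp [Expr.eval]

theorem var (i : ℕ) (hi : Γ.vars[i]? = some f) : Comp Γ f := by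
  refine ⟨_, .const _ 2, fun N loc hl => ⟨.assign N (.var (loc i)), fun a s hs => ?_⟩⟩
  refine ⟨_, _, .assign _ _ _, rfl, fun i hi => ?_, ?_, le_rfl⟩
  · simp [hi.ne]
  · simp [Expr.eval, hs.2 i f hi]

theorem weaken (hf : Comp Γ f) : Comp Γ.push (fun p => f p.1) := by
  obtain ⟨C, ⟨K, d, hC⟩, hP⟩ := hf
  refine ⟨fun p => C p.1, ⟨K, d, fun p => hC p.1⟩, fun N loc hl => ?_⟩
  rw [Ctx.push_length] at hl
  obtain ⟨P, hP⟩ := hP N loc (fun i hi => hl i (by omega))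
  refine ⟨P, fun p s hs => hP p.1 s ⟨hs.1, fun i k hk => ?_⟩⟩
  refine hs.2 i (fun q => k q.1) ?_
  simp only [Ctx.push]
  rw [List.getElem?_append_left (by simpa using (List.getElem?_eq_some_iff.1 hk).1)]
  simp [hk]

theorem top (Γ : Ctx α) : Comp Γ.push (fun p => p.2) :=
  var Γ.vars.length (by simp [Ctx.push])

theorem get (m : ℕ) (hf : Comp Γ f) : Comp Γ (fun a => Γ.mem a m (f a)) := by
  obtain ⟨C, hC, hP⟩ := hf
  refine ⟨_, hC.add (.const _ 3), fun N loc hl => ?_⟩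
  obtain ⟨P, hP⟩ := hP N loc hl
  refine ⟨.seq P (.assign N (.get m (.var N))), fun a s hs => ?_⟩
  obtain ⟨t, s', he, harr, hv, hN, ht⟩ := hP a s hs
  refine ⟨_, _, .seq he (.assign _ _ _), by simp [harr], fun i hi => ?_, ?_, by
    simp only [Expr.cost]; omega⟩
  · simp [hi.ne, hv i hi]
  · simp [Expr.eval, hN, harr, hs.1]

/-- The second operand is computed with `N + 1` in place of `N`, so that the first one survives in
the variable `N`. -/
theorem binary (e : ℕ → Expr) (op : ℕ → ℕ → ℕ) (c : ℕ) (hc : ∀ N, (e N).cost ≤ c)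
    (he : ∀ N s, (e N).eval s = op (s.var N) (s.var (N + 1)))
    (hf : Comp Γ f) (hg : Comp Γ g) : Comp Γ (fun a => op (f a) (g a)) := by
  obtain ⟨C, hC, hP⟩ := hf
  obtain ⟨C', hC', hQ⟩ := hg
  refine ⟨_, (hC.add hC').add (.const _ (c + 1)), fun N loc hl => ?_⟩
  obtain ⟨P, hP⟩ := hP N loc hl
  obtain ⟨Q, hQ⟩ := hQ (N + 1) loc (fun i hi => (hl i hi).trans (Nat.lt_succ_self N))
  refine ⟨.seq P (.seq Q (.assign N (e N))), fun a s hs => ?_⟩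
  obtain ⟨t, s', h1, harr, hv, hN, ht⟩ := hP a s hs
  obtain ⟨t', s'', h1', harr', hv', hN', ht'⟩ := hQ a s' (hs.of_eq hl harr hv)
  refine ⟨_, _, .seq h1 (.seq h1' (.assign _ _ _)), by simp [harr, harr'], fun i hi => ?_, ?_, ?_⟩
  · simp [hi.ne, hv i hi, hv' i (by omega)]
  · simp [he, hN', hv', hN]
  · have := hc N
    show _ ≤ C a + C' a + (c + 1)
    omega

theorem add (hf : Comp Γ f) (hg : Comp Γ g) : Comp Γ (fun a => f a + g a) :=
  binary (fun N => .add (.var N) (.var (N + 1))) (· + ·) 3 (fun _ => by simp [Expr.cost])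
    (fun _ _ => by simp [Expr.eval]) hf hg

theorem sub (hf : Comp Γ f) (hg : Comp Γ g) : Comp Γ (fun a => f a - g a) :=
  binary (fun N => .sub (.var N) (.var (N + 1))) (· - ·) 3 (fun _ => by simp [Expr.cost])
    (fun _ _ => by simp [Expr.eval]) hf hg

theorem ite {p : α → Prop} [DecidablePred p] (hp : CompP Γ p) (hf : Comp Γ f) (hg : Comp Γ g) :
    Comp Γ (fun a => if p a then f a else g a) := by
  obtain ⟨C₀, hC₀, hR⟩ := hp
  obtain ⟨C, hC, hP⟩ := hf
  obtain ⟨C', hC', hQ⟩ := hg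
  refine ⟨_, (hC₀.add (.const _ 2)).add (hC.add hC'), fun N loc hl => ?_⟩
  obtain ⟨R, hR⟩ := hR N loc hl
  obtain ⟨P, hP⟩ := hP N loc hl
  obtain ⟨Q, hQ⟩ := hQ N loc hl
  refine ⟨.seq R (.cond (.var N) P Q), fun a s hs => ?_⟩
  obtain ⟨t, s', h1, harr, hv, hN, ht⟩ := hR a s hs
  by_cases ha : p a
  · obtain ⟨t', s'', h1', harr', hv', hN', ht'⟩ := hP a s' (hs.of_eq hl harr hv)
    refine ⟨_, _, .seq h1 (.cond_true ?_ h1'), harr'.trans harr,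
      fun i hi => (hv' i hi).trans (hv i hi), by simp [hN', ha], ?_⟩
    · simp [Expr.eval, hN, ind, ha]
    · simp only [Expr.cost]; omega
  · obtain ⟨t', s'', h1', harr', hv', hN', ht'⟩ := hQ a s' (hs.of_eq hl harr hv)
    refine ⟨_, _, .seq h1 (.cond_false ?_ h1'), harr'.trans harr,
      fun i hi => (hv' i hi).trans (hv i hi), by simp [hN', ha], ?_⟩
    · simp [Expr.eval, hN, ind, ha]
    · simp only [Expr.cost]; omega

/-- Primitive recursion with a polynomially bounded number of iterations. -/
theorem fold {body : α → ℕ → ℕ → ℕ} (hf : Comp Γ f) (hle : ∀ a, f a ≤ Γ.bound a)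
    (hg : Comp Γ g) (hb : Comp Γ.push.push fun p => body p.1.1 p.1.2 p.2) :
    Comp Γ (fun a => Nat.rec (motive := fun _ => ℕ) (g a) (fun i v => body a i v) (f a)) := by
  obtain ⟨C, hC, hP⟩ := hf
  obtain ⟨C', hC', hQ⟩ := hg
  obtain ⟨C'', ⟨K, d, hK⟩, hR⟩ := hb
  -- The bound of a pushed context ignores the pushed values. So a single bound serves all
  -- iterations, however large the accumulated value becomes.
  let W : α → ℕ := fun a => K * (Γ.bound a + 1) ^ d
  have hW : PolyBdd Γ.bound W := ⟨K, d, fun a => le_rfl⟩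
  refine ⟨fun a => C a + C' a + 8 + Γ.bound a * (W a + 10),
    ((hC.add hC').add (.const _ 8)).add ((PolyBdd.self _).mul (hW.add (.const _ 10))),
    fun N loc hl => ?_⟩
  -- Layout: the counter is in `N`, the accumulated value in `N + 1`, the number of iterations in `N
  -- + 2`, and the body writes its result to `N + 3`.
  obtain ⟨Q, hQ⟩ := hQ (N + 1) loc (fun i hi => (hl i hi).trans (by omega))
  obtain ⟨P, hP⟩ := hP (N + 2) loc (fun i hi => (hl i hi).trans (by omega))
  let loc₁ : ℕ → ℕ := fun i => if i < Γ.vars.length then loc i else N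
  let loc₂ : ℕ → ℕ := fun i => if i < Γ.push.vars.length then loc₁ i else N + 1
  obtain ⟨R, hR⟩ := hR (N + 3) loc₂ (fun i _ => by
    simp only [loc₂, loc₁]
    split_ifs with h1 h2
    · exact (hl i h2).trans (by omega)
    · omega
    · omega)
  let L : Prog := .seq R (.seq (.assign (N + 1) (.var (N + 3)))
    (.assign N (.add (.var N) (.const 1))))
  have loop : ∀ (a : α) (j i : ℕ) (s : State), i + j = f a → Γ.Matches loc a s → s.var N = i →
      s.var (N + 1) = Nat.rec (motive := fun _ => ℕ) (g a) (fun i v => body a i v) i →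
      s.var (N + 2) = f a →
      ∃ t s', Exec (.loop (.sub (.var (N + 2)) (.var N)) L) s t s' ∧ s'.arr = s.arr ∧
        (∀ i < N, s'.var i = s.var i) ∧
        s'.var (N + 1) = Nat.rec (motive := fun _ => ℕ) (g a) (fun i v => body a i v) (f a) ∧
        t ≤ 4 + j * (W a + 10) := by
    intro a j
    induction j with
    | zero =>
      intro i s hij hs h0 h1 h2
      obtain rfl : i = f a := by omega
      exact ⟨_, s, .loop_done (by simp [Expr.eval, h0, h2]), rfl, fun _ _ => rfl, h1, by
        simp [Expr.cost]⟩
    | succ j ih =>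
      intro i s hij hs h0 h1 h2
      obtain ⟨t, s', he, harr, hv, hN, ht⟩ := hR ((a, i), s.var (N + 1)) s
        ((hs.push h0).push rfl)
      let s₁ := s'.setVar (N + 1) (s'.var (N + 3))
      let s₂ := s₁.setVar N (s₁.var N + 1)
      have hs₂ : ∀ i < N, s₂.var i = s.var i := fun i hi => by
        simp only [s₂, s₁, State.setVar_var]
        rw [if_neg (by omega), if_neg (by omega), hv i (by omega)]
      obtain ⟨t', s'', he', harr', hv', hN', ht'⟩ := ih (i + 1) s₂ (by omega)
        (hs.of_eq hl harr hs₂) (by simp [s₂, s₁, hv, h0]) (by simp [s₂, s₁, hN, h1])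
        (by simp [s₂, s₁, hv, h2])
      refine ⟨_, s'', .loop_step (by simp only [Expr.eval, h0, h2]; omega)
        (.seq he (.seq (.assign _ _ _) (.assign _ _ _))) he', harr'.trans harr,
        fun i hi => (hv' i hi).trans (hs₂ i hi), hN', ?_⟩
      have : t ≤ W a := ht.trans (hK _)
      simp only [Expr.cost, Nat.add_mul]
      omega
  refine ⟨.seq Q (.seq P (.seq (.assign N (.const 0))
    (.seq (.loop (.sub (.var (N + 2)) (.var N)) L) (.assign N (.var (N + 1)))))),
    fun a s hs => ?_⟩
  obtain ⟨t, s', h1, harr, hv, hN, ht⟩ := hQ a s hs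
  have hs' := hs.of_eq (s' := s') hl harr (fun i hi => hv i (by omega))
  obtain ⟨t', s'', h1', harr', hv', hN', ht'⟩ := hP a s' hs'
  have hs'' := hs'.of_eq (s' := s''.setVar N 0) hl harr' (fun i hi => by
    simp [hi.ne, hv' i (by omega)])
  obtain ⟨t₃, s₃, h₃, harr₃, hv₃, hN₃, ht₃⟩ := loop a (f a) 0 _ (by omega) hs'' (by simp)
    (by simp [hv', hN]) (by simp [hN'])
  refine ⟨_, _, .seq h1 (.seq h1' (.seq (.assign _ _ _) (.seq h₃ (.assign _ _ _)))), ?_,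
    fun i hi => ?_, ?_, ?_⟩
  · simp only [State.setVar_arr, harr₃, harr', harr]
  · simp [hi.ne, hv₃ i hi, hv' i (by omega), hv i (by omega)]
  · simp [Expr.eval, hN₃]
  · have : f a * (W a + 10) ≤ Γ.bound a * (W a + 10) := Nat.mul_le_mul_right _ (hle a)
    simp only [Expr.cost]
    omega

theorem congr (hf : Comp Γ f) (he : ∀ a, f a = g a) : Comp Γ g := by
  rwa [← funext he]

theorem sum {body : α → ℕ → ℕ} (hf : Comp Γ f) (hle : ∀ a, f a ≤ Γ.bound a)
    (hb : Comp Γ.push fun p => body p.1 p.2) :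
    Comp Γ (fun a => ∑ i ∈ Finset.range (f a), body a i) := by
  refine (fold (body := fun a i v => v + body a i) hf hle (const Γ 0)
    ((top Γ.push).add hb.weaken)).congr fun a => ?_
  induction f a with
  | zero => simp
  | succ n ih => simp only [ih, Finset.sum_range_succ]

/-- Multiplication is not an instruction of the machine. It is repeated addition, and this is why
one factor has to be below the bound. -/
theorem mul (hf : Comp Γ f) (hle : ∀ a, f a ≤ Γ.bound a) (hg : Comp Γ g) :
    Comp Γ (fun a => f a * g a) :=
  (sum (body := fun a _ => g a) hf hle hg.weaken).congr fun a => by simp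

/-- Repeated doubling: only the exponent, which is the number of iterations, has to be small. The
value itself may exceed every polynomial. -/
theorem two_pow (hf : Comp Γ f) (hle : ∀ a, f a ≤ Γ.bound a) : Comp Γ (fun a => 2 ^ f a) := by
  refine (fold (body := fun _ _ v => v + v) hf hle (const Γ 1)
    ((top Γ.push).add (top Γ.push))).congr fun a => ?_
  induction f a with
  | zero => simp
  | succ n ih => simp only [ih, pow_succ, mul_two]

end Comp

/-! ### Polynomial time predicates and bounded quantifiers -/

namespace CompP

variable {Γ : Ctx α} {f g : α → ℕ} {p q : α → Prop}

theorem congr (hp : CompP Γ p) (h : ∀ a, p a ↔ q a) : CompP Γ q := by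
  rwa [← funext fun a => propext (h a)]

theorem ne_zero (hf : Comp Γ f) : CompP Γ (fun a => f a ≠ 0) :=
  ((Comp.const Γ 1).sub ((Comp.const Γ 1).sub hf)).congr fun a => by
    by_cases h : f a = 0
    · simp [ind, h]
    · simp only [ind, if_pos h]; omega

theorem not (hp : CompP Γ p) : CompP Γ (fun a => ¬ p a) :=
  ((Comp.const Γ 1).sub hp).congr fun a => by by_cases h : p a <;> simp [ind, h]

theorem or (hp : CompP Γ p) (hq : CompP Γ q) : CompP Γ (fun a => p a ∨ q a) :=
  (ne_zero (hp.add hq)).congr fun a => by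
    by_cases h : p a <;> by_cases h' : q a <;> simp [ind, h, h']

theorem and (hp : CompP Γ p) (hq : CompP Γ q) : CompP Γ (fun a => p a ∧ q a) :=
  (hp.not.or hq.not).not.congr fun a => by tauto

theorem imp (hp : CompP Γ p) (hq : CompP Γ q) : CompP Γ (fun a => p a → q a) :=
  (hp.not.or hq).congr fun a => by tauto

theorem lt (hf : Comp Γ f) (hg : Comp Γ g) : CompP Γ (fun a => f a < g a) :=
  (ne_zero (hg.sub hf)).congr fun a => by omega

theorem le (hf : Comp Γ f) (hg : Comp Γ g) : CompP Γ (fun a => f a ≤ g a) :=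
  (lt hg hf).not.congr fun a => by omega

theorem eq (hf : Comp Γ f) (hg : Comp Γ g) : CompP Γ (fun a => f a = g a) :=
  ((le hf hg).and (le hg hf)).congr fun a => by omega

theorem exists_lt {p : α → ℕ → Prop} (hf : Comp Γ f) (hle : ∀ a, f a ≤ Γ.bound a)
    (hp : CompP Γ.push fun x => p x.1 x.2) : CompP Γ (fun a => ∃ i < f a, p a i) :=
  (ne_zero (Comp.sum (body := fun a i => ind (p a i)) hf hle hp)).congr fun a => by
    simp [ind]

theorem forall_lt {p : α → ℕ → Prop} (hf : Comp Γ f) (hle : ∀ a, f a ≤ Γ.bound a)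
    (hp : CompP Γ.push fun x => p x.1 x.2) : CompP Γ (fun a => ∀ i < f a, p a i) :=
  (exists_lt (p := fun a i => ¬ p a i) hf hle hp.not).not.congr fun a => by simp

theorem card {p : α → ℕ → Prop} [∀ a, DecidablePred (p a)] (hf : Comp Γ f)
    (hle : ∀ a, f a ≤ Γ.bound a) (hp : CompP Γ.push fun x => p x.1 x.2) :
    Comp Γ (fun a => ((Finset.range (f a)).filter fun i => p a i).card) :=
  (Comp.sum (body := fun a i => ind (p a i)) hf hle hp).congr fun a => by
    rw [Finset.card_filter]
    refine Finset.sum_congr rfl fun i _ => ?_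
    by_cases h : p a i
    · rw [ind_of h, if_pos h]
    · rw [ind_of_not h, if_neg h]

end CompP

/-- Division is replaced by counting the `i` below the bound with `2 * (i + 1) ≤ f a`. The
truncation at the bound makes this correct without a hypothesis on `f`. -/
theorem Comp.half {Γ : Ctx α} {f : α → ℕ} (hX : Comp Γ Γ.bound) (hf : Comp Γ f) :
    Comp Γ (fun a => min (f a / 2) (Γ.bound a)) := by
  classical
  have hi := (Comp.top Γ).add (.const _ 1)
  refine (CompP.card (p := fun a i => i + 1 + (i + 1) ≤ f a) hX (fun _ => le_rfl) (CompP.le (hi.add hi) hf.weaken)).congr fun a => ?_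
  rw [← Finset.card_range (min (f a / 2) (Γ.bound a))]
  congr 1
  ext i
  simp only [Finset.mem_filter, Finset.mem_range]
  omega

theorem Comp.shiftRight {Γ : Ctx α} {f g : α → ℕ} (hX : Comp Γ Γ.bound) (hf : Comp Γ f)
    (hfX : ∀ a, f a ≤ Γ.bound a) (hg : Comp Γ g) (hgX : ∀ a, g a ≤ Γ.bound a) :
    Comp Γ (fun a => f a >>> g a) := by
  refine (Comp.fold (body := fun a _ v => min (v / 2) (Γ.bound a)) hg hgX hf (Comp.half (Γ := Γ.push.push) hX.weaken.weaken
    (Comp.top Γ.push))).congr fun a => ?_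
  induction g a with
  | zero => rfl
  | succ n ih =>
    have h : f a >>> n ≤ Γ.bound a := by
      rw [Nat.shiftRight_eq_div_pow]
      exact (Nat.div_le_self _ _).trans (hfX a)
    rw [Nat.shiftRight_succ]
    exact (congrArg (fun v => min (v / 2) (Γ.bound a)) ih).trans
      (min_eq_left ((Nat.div_le_self _ _).trans h))

/-- A bit is the parity of the shifted number, that is, this number minus twice its half. -/
theorem CompP.testBit {Γ : Ctx α} {f g : α → ℕ} (hX : Comp Γ Γ.bound) (hf : Comp Γ f)
    (hfX : ∀ a, f a ≤ Γ.bound a) (hg : Comp Γ g) (hgX : ∀ a, g a ≤ Γ.bound a) :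
    CompP Γ (fun a => (f a).testBit (g a) = true) := by
  have hs := Comp.shiftRight hX hf hfX hg hgX
  refine (CompP.ne_zero ((hs.sub (.half hX hs)).sub (.half hX hs))).congr fun a => ?_
  have h : f a >>> g a ≤ Γ.bound a := by
    rw [Nat.shiftRight_eq_div_pow]
    exact (Nat.div_le_self _ _).trans (hfX a)
  simp only [Nat.testBit, Nat.one_and_eq_mod_two, bne_iff_ne]
  omega

/-- Functions of one small argument are given by a table. -/
theorem Comp.table {Γ : Ctx α} {f : α → ℕ} (hf : Comp Γ f) (T : ℕ → ℕ) (n : ℕ)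
    (hT : ∀ i ≥ n, T i = 0) : Comp Γ (fun a => T (f a)) := by
  classical
  induction n generalizing T with
  | zero => exact (Comp.const Γ 0).congr fun a => (hT _ (Nat.zero_le _)).symm
  | succ n ih =>
    refine (Comp.ite (CompP.eq hf (Comp.const Γ n)) (Comp.const Γ (T n))
      (ih (Function.update T n 0) fun i hi => ?_)).congr fun a => ?_
    · rcases hi.lt_or_eq with h | rfl
      · rw [Function.update_of_ne (by omega), hT i (by omega)]
      · simp
    · by_cases h : f a = n
      · simp [h]
      · simp [h]

/-- Functions of two small arguments are given by a table. -/
theorem Comp.table₂ {Γ : Ctx α} {f g : α → ℕ} (hf : Comp Γ f) (hg : Comp Γ g) (T : ℕ → ℕ → ℕ)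
    (n : ℕ) (hT : ∀ i j, n ≤ i ∨ n ≤ j → T i j = 0) : Comp Γ (fun a => T (f a) (g a)) := by
  classical
  have key : ∀ m ≤ n, Comp Γ (fun a => if f a < m then T (f a) (g a) else 0) := by
    intro m
    induction m with
    | zero => intro _; simpa using Comp.const Γ 0
    | succ m ih =>
      intro hm
      refine (Comp.ite (CompP.eq hf (Comp.const Γ m))
        (Comp.table hg (T m) n fun j hj => hT m j (Or.inr hj)) (ih (by omega))).congr fun a => ?_
      by_cases h : f a = m
      · simp [h]
      · simp only [h, if_false]
        by_cases h' : f a < m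
        · rw [if_pos h', if_pos (by omega)]
        · rw [if_neg h', if_neg (by omega)]
  refine (key n le_rfl).congr fun a => ?_
  by_cases h : f a < n
  · simp [h]
  · simp [h, hT _ _ (Or.inl (not_lt.1 h))]

end RAM

/-! ### Exhaustive search over the words all of whose prefixes pass a test -/

namespace RAM

section Search

variable (M : ℕ) (ok acc : List ℕ → Prop)

open Classical in
/-- The number of words that are visited by a search below the word `l`, to depth `d`. -/
noncomputable def visited : ℕ → List ℕ → ℕ
  | 0, _ => 1
  | d + 1, l => 1 + ∑ a ∈ Finset.range M, if ok (a :: l) then visited d (a :: l) else 0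

open Classical in
/-- The number of accepted words that a search finds strictly below the word `l`, to depth `d`. -/
noncomputable def accepted : ℕ → List ℕ → ℕ
  | 0, _ => 0
  | d + 1, l => ∑ a ∈ Finset.range M,
      if ok (a :: l) then ind (acc (a :: l)) + accepted d (a :: l) else 0

/-- The words (written backwards) that a search visits. -/
inductive Valid : List ℕ → Prop
  | nil : Valid []
  | cons {a : ℕ} {l : List ℕ} : a < M → ok (a :: l) → Valid l → Valid (a :: l)

variable {M ok acc}

theorem exists_of_accepted_ne_zero {d : ℕ} {l : List ℕ} (hl : Valid M ok l)
    (h : accepted M ok acc d l ≠ 0) : ∃ l', Valid M ok l' ∧ acc l' := by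
  induction d generalizing l with
  | zero => exact absurd rfl h
  | succ d ih =>
    obtain ⟨a, ha, h⟩ := Finset.exists_ne_zero_of_sum_ne_zero h
    split_ifs at h with hok
    · have hv := Valid.cons (Finset.mem_range.1 ha) hok hl
      by_cases hacc : acc (a :: l)
      · exact ⟨_, hv, hacc⟩
      · exact ih hv (by simpa [ind, hacc] using h)
    · exact absurd rfl h

/-- The root of a search is not itself tested for acceptance, hence `u ≠ []`. As words are written
backwards, the first symbol that the search appends to `l` on its way to `u ++ l` is the last entry
of `u`; the induction therefore removes entries of `u` from the end. -/
theorem accepted_ne_zero {d : ℕ} {l u : List ℕ} (hl : Valid M ok (u ++ l)) (hu : u ≠ [])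
    (hd : u.length ≤ d) (h : acc (u ++ l)) : accepted M ok acc d l ≠ 0 := by
  induction u using List.reverseRecOn generalizing d l with
  | nil => exact absurd rfl hu
  | append_singleton u a ih =>
    rw [List.append_assoc, List.singleton_append] at hl h
    rw [List.length_append, List.length_singleton] at hd
    obtain ⟨d, rfl⟩ : ∃ d', d = d' + 1 := ⟨d - 1, by omega⟩
    have hv : Valid M ok (a :: l) := by
      clear h ih hd hu
      induction u with
      | nil => exact hl
      | cons b u ih => cases hl with | cons _ _ h => exact ih h
    cases hv with
    | cons ha hok _ =>
    intro h0
    have := Finset.sum_eq_zero_iff.1 h0 a (Finset.mem_range.2 ha)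
    rw [if_pos hok] at this
    by_cases hu' : u = []
    · subst hu'
      rw [ind_of (by simpa using h)] at this
      omega
    · exact ih hl hu' (d := d) (by omega) h (Nat.eq_zero_of_add_eq_zero_left this)

end Search

/-- The contents of the array that holds the word `l`, written backwards. -/
def wordMem (l : List ℕ) (i : ℕ) : ℕ := l.reverse.getD i 0

theorem wordMem_cons (a : ℕ) (l : List ℕ) :
    wordMem (a :: l) = Function.update (wordMem l) l.length a := by
  funext i
  simp only [wordMem, List.reverse_cons, Function.update_apply]
  rcases lt_trichotomy i l.length with h | rfl | h
  · rw [if_neg h.ne, List.getD_append _ _ _ _ (by simpa using h)]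
  · rw [List.getD_append_right _ _ _ _ (by simp)]
    simp
  · rw [if_neg h.ne', List.getD_eq_default _ _ (by simpa using h),
      List.getD_eq_default _ _ (by simpa using h.le)]

theorem wordMem_of_le {l : List ℕ} {i : ℕ} (h : l.length ≤ i) : wordMem l i = 0 :=
  List.getD_eq_default _ _ (by simpa using h)

theorem wordMem_append (u l : List ℕ) {i : ℕ} (h : i < l.length) :
    wordMem (u ++ l) i = wordMem l i := by
  induction u with
  | nil => rfl
  | cons a u ih =>
    rw [List.cons_append, wordMem_cons, Function.update_of_ne (by simp; omega), ih]

/-- An instance: an input word and a parameter. -/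
abbrev Inst : Type := List ℕ × ℕ

/-- The context in which the tests of a search are computed: the input word and the
visited word are held in arrays, their lengths and the parameter in variables. -/
def searchCtx (X : Inst → ℕ) : Ctx (Inst × List ℕ) where
  bound p := X p.1
  mem p a i := if a = 0 then p.1.1.getD i 0 else if a = 1 then wordMem p.2 i else 0
  vars := [fun p => p.1.1.length, fun p => p.1.2, fun p => X p.1, fun p => p.2.length]

/-! ### The search loop and its running time -/

section Engine

variable {X : Inst → ℕ} {x : Inst}

/-- The state in the course of a search in which the word `l` is inspected and `f` accepted words
have been found. -/
def SearchState (X : Inst → ℕ) (x : Inst) (l : List ℕ) (f : ℕ) (s : State) : Prop :=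
  (searchCtx X).Matches id (x, l) s ∧ s.var 4 = f

theorem searchState_iff {l : List ℕ} {f : ℕ} {s : State} : SearchState X x l f s ↔
    s.arr = (searchCtx X).mem (x, l) ∧ s.var 0 = x.1.length ∧ s.var 1 = x.2 ∧ s.var 2 = X x ∧
      s.var 3 = l.length ∧ s.var 4 = f := by
  constructor
  · intro h
    exact ⟨h.1.1, h.1.2 0 _ rfl, h.1.2 1 _ rfl, h.1.2 2 _ rfl, h.1.2 3 _ rfl, h.2⟩
  · rintro ⟨h, h0, h1, h2, h3, h4⟩
    refine ⟨⟨h, fun i g hg => ?_⟩, h4⟩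
    match i with
    | 0 => exact h0.trans (congrFun (Option.some.inj hg) (x, l))
    | 1 => exact h1.trans (congrFun (Option.some.inj hg) (x, l))
    | 2 => exact h2.trans (congrFun (Option.some.inj hg) (x, l))
    | 3 => exact h3.trans (congrFun (Option.some.inj hg) (x, l))
    | i + 4 => simp [searchCtx] at hg

theorem searchCtx_mem_one (l : List ℕ) : (searchCtx X).mem (x, l) 1 = wordMem l := by
  funext i; simp [searchCtx]

theorem update_mem (l l' : List ℕ) (i v : ℕ) (h : Function.update (wordMem l) i v = wordMem l') :
    Function.update ((searchCtx X).mem (x, l)) 1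
      (Function.update ((searchCtx X).mem (x, l) 1) i v) = (searchCtx X).mem (x, l') := by
  rw [searchCtx_mem_one, h]
  funext a
  by_cases ha : a = 1
  · subst ha; rw [Function.update_self, searchCtx_mem_one]
  · rw [Function.update_of_ne ha]; funext i; simp [searchCtx, ha]

theorem setArr_arr_mem {s : State} {l l' : List ℕ} {i v : ℕ}
    (hs : s.arr = (searchCtx X).mem (x, l))
    (h : Function.update (wordMem l) i v = wordMem l') :
    (s.setArr 1 i v).arr = (searchCtx X).mem (x, l') := by
  rw [State.setArr_arr, hs, update_mem l l' i v h]

/-- The last symbol of the visited word. -/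
def lastSymbol : Expr := .get 1 (.sub (.var 3) (.const 1))

/-- Replace the last symbol by its successor. -/
def nextProg : Prog := .store 1 (.sub (.var 3) (.const 1)) (.add lastSymbol (.const 1))

/-- Remove the last symbol. -/
def popProg : Prog := .seq (.store 1 (.sub (.var 3) (.const 1)) (.const 0))
  (.seq (.assign 3 (.sub (.var 3) (.const 1))) nextProg)

/-- Count the visited word if it is accepted, and append a symbol. -/
def pushProg (A : Prog) : Prog := .seq A (.seq (.assign 4 (.add (.var 4) (.var 5)))
  (.assign 3 (.add (.var 3) (.const 1))))

/-- One step of the search, with the programs `P` and `A` for the two tests. -/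
def searchBody (P A : Prog) : Prog :=
  .cond (.sub (.add lastSymbol (.const 1)) (.var 2)) popProg
    (.seq P (.cond (.var 5) (pushProg A) nextProg))

theorem lastSymbol_eval {a : ℕ} {l : List ℕ} {s : State}
    (harr : s.arr = (searchCtx X).mem (x, a :: l)) (h3 : s.var 3 = l.length + 1) :
    lastSymbol.eval s = a := by
  simp [lastSymbol, Expr.eval, harr, h3, searchCtx_mem_one, wordMem_cons]

theorem next_exec {a f : ℕ} {l : List ℕ} {s : State} (h : SearchState X x (a :: l) f s) :
    ∃ s', Exec nextProg s 10 s' ∧ SearchState X x ((a + 1) :: l) f s' := by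
  obtain ⟨harr, h0, h1, h2, h3, h4⟩ := searchState_iff.1 h
  refine ⟨_, .store _ _ _ _, searchState_iff.2 ⟨?_, h0, h1, h2, by simpa using h3, h4⟩⟩
  refine setArr_arr_mem harr ?_
  have : (Expr.add lastSymbol (.const 1)).eval s = a + 1 := by
    simp only [Expr.eval, lastSymbol_eval harr h3]
  rw [this]
  simp [Expr.eval, h3, wordMem_cons]

/-- The state reached when the search below `l` is completed. -/
def SearchedState (X : Inst → ℕ) (x : Inst) (l : List ℕ) (f : ℕ) (s : State) : Prop :=
  match l with
  | [] => s.var 3 = 0 ∧ s.var 4 = f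
  | b :: l => SearchState X x ((b + 1) :: l) f s

theorem pop_exec {a f : ℕ} {l : List ℕ} {s : State} (h : SearchState X x (a :: l) f s) :
    ∃ s', Exec popProg s 19 s' ∧ SearchedState X x l f s' := by
  obtain ⟨harr, h0, h1, h2, h3, h4⟩ := searchState_iff.1 h
  let s₁ := s.setArr 1 ((Expr.sub (.var 3) (.const 1)).eval s) 0
  let s₂ := s₁.setVar 3 ((Expr.sub (.var 3) (.const 1)).eval s₁)
  have hs₁ : s₁.arr = (searchCtx X).mem (x, l) := by
    refine setArr_arr_mem harr ?_
    simp only [Expr.eval, h3, List.length_cons, Nat.add_sub_cancel, wordMem_cons,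
      Function.update_idem]
    rw [← wordMem_of_le le_rfl, Function.update_eq_self]
  have hs₂ : s₂.var 3 = l.length := by simp [s₂, s₁, Expr.eval, h3]
  have key : ∀ s₃ t, Exec nextProg s₂ t s₃ → Exec popProg s (5 + (4 + t)) s₃ := fun s₃ t h =>
    .seq (.store s 1 (.sub (.var 3) (.const 1)) (.const 0))
      (.seq (.assign s₁ 3 (.sub (.var 3) (.const 1))) h)
  cases l with
  | nil =>
    -- When the last word has been popped, `nextProg` still runs and, as `0 - 1 = 0`, spoils the
    -- cell `0`. This is harmless: the loop ends, and only the variables `3` and `4` are read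
    -- afterwards.
    refine ⟨_, key _ 10 (.store _ _ _ _), ?_, ?_⟩
    · simpa using hs₂
    · simp [s₂, s₁, h4]
  | cons b l =>
    obtain ⟨s₃, he, hs₃⟩ := next_exec (X := X) (x := x) (a := b) (l := l) (f := f) (s := s₂)
      (searchState_iff.2 ⟨hs₁, h0, h1, h2, hs₂, h4⟩)
    exact ⟨s₃, key _ 10 he, hs₃⟩

/-- Iterating the body of the loop leads from `s` to `s'` in `t` steps. -/
def Leads (e : Expr) (P : Prog) (s : State) (t : ℕ) (s' : State) : Prop :=
  ∀ t' s'', Exec (.loop e P) s' t' s'' → Exec (.loop e P) s (t + t') s''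

theorem Leads.trans {e : Expr} {P : Prog} {s₁ s₂ s₃ : State} {t t' : ℕ} (h : Leads e P s₁ t s₂)
    (h' : Leads e P s₂ t' s₃) : Leads e P s₁ (t + t') s₃ := fun u s hu => by
  rw [add_assoc]; exact h _ _ (h' _ _ hu)

theorem Leads.of_exec {e : Expr} {P : Prog} {s s' : State} {t : ℕ} (he : e.eval s ≠ 0)
    (h : Exec P s t s') : Leads e P s (e.cost + 1 + t) s' := fun _ _ hu => .loop_step he h hu

variable {ok acc : Inst × List ℕ → Prop} {Cok Cacc : Inst × List ℕ → ℕ} {P A : Prog} {c : ℕ}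

section Run

variable (hP : Computes (searchCtx X) id (fun p => ind (ok p)) Cok 5 P)
  (hA : Computes (searchCtx X) id (fun p => ind (acc p)) Cacc 5 A)

include hP hA in
-- The search is an odometer. A last symbol outside the alphabet is removed and its predecessor
-- advanced; a word that passes the test is counted if accepted and extended by `0`; a word that
-- fails has its last symbol advanced.
theorem search_step (hc : ∀ l, Cok (x, l) + Cacc (x, l) + 40 ≤ c) {a f : ℕ} {l : List ℕ}
    {s : State} (h : SearchState X x (a :: l) f s) :
    ∃ t s', Leads (.var 3) (searchBody P A) s t s' ∧ t ≤ c ∧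
      (X x ≤ a → SearchedState X x l f s') ∧
      (a < X x → ok (x, a :: l) →
        SearchState X x (0 :: a :: l) (f + ind (acc (x, a :: l))) s') ∧
      (a < X x → ¬ ok (x, a :: l) → SearchState X x ((a + 1) :: l) f s') := by
  obtain ⟨harr, h0, h1, h2, h3, h4⟩ := searchState_iff.1 h
  have hguard : (Expr.var 3).eval s ≠ 0 := by simp [Expr.eval, h3]
  have htop : (Expr.sub (.add lastSymbol (.const 1)) (.var 2)).eval s = a + 1 - X x := by
    simp only [Expr.eval, lastSymbol_eval harr h3, h2]
  have hcost : (Expr.sub (.add lastSymbol (.const 1)) (.var 2)).cost = 8 := rfl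
  have hcl := hc (a :: l)
  by_cases hlt : a < X x
  · obtain ⟨t, s₁, he, harr₁, hv, hr, ht⟩ := hP (x, a :: l) s h.1
    have hs₁ : SearchState X x (a :: l) f s₁ := searchState_iff.2
      ⟨harr₁.trans harr, by rw [hv _ (by omega), h0], by rw [hv _ (by omega), h1],
        by rw [hv _ (by omega), h2], by rw [hv _ (by omega), h3], by rw [hv _ (by omega), h4]⟩
    by_cases hok : ok (x, a :: l)
    · obtain ⟨t', s₂, he', harr₂, hv', hr', ht'⟩ := hA (x, a :: l) s₁ hs₁.1
      refine ⟨_, _, .of_exec hguard (.cond_false (by rw [htop]; omega) (.seq he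
        (.cond_true (by simp [Expr.eval, hr, ind_of hok]) (.seq he' (.seq (.assign _ _ _)
          (.assign _ _ _)))))), ?_, by omega, fun _ _ => ?_, fun _ h => absurd hok h⟩
      · rw [hcost]; simp only [Expr.cost]; omega
      · refine searchState_iff.2 ⟨?_, ?_, ?_, ?_, ?_, ?_⟩
        · simp only [State.setVar_arr, harr₂, harr₁, harr]
          -- Nothing has to be stored for the new symbol `0`, because the cells beyond the word are
          -- zero already.
          funext b
          by_cases hb : b = 1
          · subst hb
            rw [searchCtx_mem_one, searchCtx_mem_one, wordMem_cons 0,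
              ← wordMem_of_le (l := a :: l) le_rfl, Function.update_eq_self]
          · funext i; simp [searchCtx, hb]
        · simp [hv', hv, h0]
        · simp [hv', hv, h1]
        · simp [hv', hv, h2]
        · simp [Expr.eval, hv', hv, h3]
        · simp [Expr.eval, hv', hv, h4, hr']
    · obtain ⟨s₂, he', hs₂⟩ := next_exec hs₁
      refine ⟨_, _, .of_exec hguard (.cond_false (by rw [htop]; omega) (.seq he
        (.cond_false (by simp [Expr.eval, hr, ind_of_not hok]) he'))), ?_, by omega,
        fun _ h => absurd h hok, fun _ _ => hs₂⟩
      rw [hcost]; simp only [Expr.cost]; omega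
  · obtain ⟨s', he, hs'⟩ := pop_exec h
    refine ⟨_, s', .of_exec hguard (.cond_true (by rw [htop]; omega) he), ?_, fun _ => hs',
      fun h => absurd h hlt, fun h => absurd h hlt⟩
    rw [hcost]; simp only [Expr.cost]; omega

include hP hA in
-- Induction on the number of siblings still to come. The functions `G` and `H` stand for the yield
-- and the running time of the subtrees, which `search_below` supplies by its own induction on the
-- depth.
theorem search_row (hc : ∀ l, Cok (x, l) + Cacc (x, l) + 40 ≤ c) {l : List ℕ} {G H : ℕ → ℕ}
    (hno : ∀ a, ¬ ok (x, a :: l) → G a = 0)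
    (hyes : ∀ a < X x, ok (x, a :: l) → ∀ f s,
      SearchState X x (0 :: a :: l) (f + ind (acc (x, a :: l))) s → ∃ t s',
        Leads (.var 3) (searchBody P A) s t s' ∧ SearchState X x ((a + 1) :: l) (f + G a) s' ∧
        t ≤ c * H a)
    (j : ℕ) : ∀ (a f : ℕ) (s : State), a + j = X x → SearchState X x (a :: l) f s → ∃ t s',
      Leads (.var 3) (searchBody P A) s t s' ∧
      SearchedState X x l (f + ∑ i ∈ Finset.Ico a (X x), G i) s' ∧
      t ≤ c * (j + 1 + ∑ i ∈ Finset.Ico a (X x), H i) := by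
  induction j with
  | zero =>
    intro a f s ha hs
    obtain ⟨t, s', hl, ht, h, -⟩ := search_step hP hA hc hs
    obtain rfl : a = X x := by omega
    exact ⟨t, s', hl, by simpa using h le_rfl, by simpa using ht⟩
  | succ j ih =>
    intro a f s ha hs
    have hlt : a < X x := by omega
    obtain ⟨t, s₁, hl, ht, -, h1, h2⟩ := search_step hP hA hc hs
    rw [Finset.sum_eq_sum_Ico_succ_bot hlt, Finset.sum_eq_sum_Ico_succ_bot hlt]
    by_cases hok : ok (x, a :: l)
    · obtain ⟨t', s₂, hl', hs₂, ht'⟩ := hyes a hlt hok f s₁ (h1 hlt hok)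
      obtain ⟨t₃, s₃, hl₃, hs₃, ht₃⟩ := ih (a + 1) _ s₂ (by omega) hs₂
      refine ⟨_, s₃, (hl.trans hl').trans hl₃, by rwa [← add_assoc], ?_⟩
      calc t + t' + t₃ ≤ c + c * H a + c * (j + 1 + ∑ i ∈ Finset.Ico (a + 1) (X x), H i) := by
            gcongr
        _ = _ := by ring
    · obtain ⟨t₃, s₃, hl₃, hs₃, ht₃⟩ := ih (a + 1) f s₁ (by omega) (h2 hlt hok)
      refine ⟨_, s₃, hl.trans hl₃, by rwa [hno a hok, zero_add], ?_⟩
      calc t + t₃ ≤ c + c * (j + 1 + ∑ i ∈ Finset.Ico (a + 1) (X x), H i) := by gcongr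
        _ ≤ c + c * (j + 1 + ∑ i ∈ Finset.Ico (a + 1) (X x), H i) + c * H a :=
            Nat.le_add_right _ _
        _ = _ := by ring

include hP hA in
-- Induction on the remaining depth `d`; for `d = 0` the length bound on tested words makes every
-- child fail. Each visited word is charged `X x + 1` iterations, one for each child and one for the
-- final removal.
theorem search_below (hc : ∀ l, Cok (x, l) + Cacc (x, l) + 40 ≤ c) {T : ℕ}
    (hT : ∀ l, ok (x, l) → l.length ≤ T) (d : ℕ) :
    ∀ (l : List ℕ) (f : ℕ) (s : State), T ≤ d + l.length → SearchState X x (0 :: l) f s →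
    ∃ t s', Leads (.var 3) (searchBody P A) s t s' ∧
      SearchedState X x l
        (f + accepted (X x) (fun l => ok (x, l)) (fun l => acc (x, l)) d l) s' ∧
      t ≤ c * ((X x + 1) * visited (X x) (fun l => ok (x, l)) d l) := by
  classical
  induction d with
  | zero =>
    intro l f s hl hs
    have hno : ∀ a, ¬ ok (x, a :: l) := fun a h => by
      have := hT _ h
      simp only [List.length_cons] at this
      omega
    obtain ⟨t, s', h1, h2, h3⟩ := search_row hP hA hc (l := l) (G := fun _ => 0) (H := fun _ => 0)
      (fun _ _ => rfl) (fun a _ h => absurd h (hno a)) (X x) 0 f s (by omega) hs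
    exact ⟨t, s', h1, by simpa [accepted] using h2, by simpa [visited] using h3⟩
  | succ d ih =>
    intro l f s hl hs
    obtain ⟨t, s', h1, h2, h3⟩ := search_row hP hA hc (l := l)
      (G := fun a => if ok (x, a :: l) then ind (acc (x, a :: l)) +
        accepted (X x) (fun l => ok (x, l)) (fun l => acc (x, l)) d (a :: l) else 0)
      (H := fun a => if ok (x, a :: l) then
        (X x + 1) * visited (X x) (fun l => ok (x, l)) d (a :: l) else 0)
      (fun a h => if_neg h)
      (fun a _ h f s hs => by
        obtain ⟨t, s', h1, h2, h3⟩ := ih (a :: l) _ s (by simp only [List.length_cons]; omega) hs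
        refine ⟨t, s', h1, ?_, ?_⟩
        · rw [if_pos h, ← add_assoc]; exact h2
        · rw [if_pos h]; exact h3)
      (X x) 0 f s (by omega) hs
    refine ⟨t, s', h1, ?_, h3.trans (le_of_eq ?_)⟩
    · rw [accepted]
      convert h2 using 3
      simp
    · rw [visited, mul_add (X x + 1), Finset.mul_sum, mul_one]
      simp [mul_ite]

end Run

/-- The exhaustive search as a program: it counts the accepted words. -/
theorem exists_search (hok : CompP (searchCtx X) ok) (hacc : CompP (searchCtx X) acc) :
    ∃ (L : Prog) (K d : ℕ), ∀ (x : Inst) (T : ℕ) (s : State),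
      (∀ l, ok (x, l) → l.length ≤ T) → SearchState X x [0] 0 s →
      ∃ t s', Exec L s t s' ∧
        t ≤ K * (X x + 1) ^ d * visited (X x) (fun l => ok (x, l)) T [] ∧
        s'.var 4 = accepted (X x) (fun l => ok (x, l)) (fun l => acc (x, l)) T [] := by
  obtain ⟨C, hC, hP⟩ := hok
  obtain ⟨C', hC', hA⟩ := hacc
  obtain ⟨P, hP⟩ := hP 5 id (fun i hi => hi.trans (show 4 < 5 by decide))
  obtain ⟨A, hA⟩ := hA 5 id (fun i hi => hi.trans (show 4 < 5 by decide))
  obtain ⟨K, d, hK⟩ := (hC.add hC').add (.const _ 40)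
  -- The additional `2` in the constant pays for the last evaluation of the loop guard.
  refine ⟨.loop (.var 3) (searchBody P A), K + 2, d + 1, fun x T s hT hs => ?_⟩
  obtain ⟨t, s', hl, ⟨h3, h4⟩, ht⟩ := search_below hP hA (c := K * (X x + 1) ^ d)
    (fun l => hK (x, l)) hT T [] 0 s (by simp) hs
  refine ⟨_, s', hl _ _ (.loop_done (by simpa [Expr.eval] using h3)), ?_, by simpa using h4⟩
  have h1 : 1 ≤ visited (X x) (fun l => ok (x, l)) T [] := by
    cases T with
    | zero => exact le_rfl
    | succ T => rw [visited]; exact Nat.le_add_right _ _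
  have h2 : 1 ≤ (X x + 1) ^ (d + 1) := Nat.one_le_pow _ _ (by omega)
  simp only [Expr.cost]
  calc _ ≤ K * (X x + 1) ^ d * ((X x + 1) * visited (X x) (fun l => ok (x, l)) T []) + 2 * 1 * 1 := by
        omega
    _ ≤ K * (X x + 1) ^ d * ((X x + 1) * visited (X x) (fun l => ok (x, l)) T []) +
        2 * (X x + 1) ^ (d + 1) * visited (X x) (fun l => ok (x, l)) T [] := by gcongr
    _ = _ := by ring

end Engine

end RAM

/-! ### From a search to a fixed-parameter algorithm -/

namespace RAM

/-- `C` is bounded by a function of the parameter times a polynomial in the length of the word. -/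
def FPTBdd (C : Inst → ℕ) : Prop := ∃ (g : ℕ → ℕ) (e : ℕ), ∀ x, C x ≤ g x.2 * (x.1.length + 1) ^ e

namespace FPTBdd

variable {C C' : Inst → ℕ}

theorem of_param (g : ℕ → ℕ) : FPTBdd (fun x => g x.2) := ⟨g, 0, by simp⟩

theorem length : FPTBdd (fun x => x.1.length) := ⟨fun _ => 1, 1, by simp⟩

theorem mono (h : FPTBdd C) (h' : ∀ a, C' a ≤ C a) : FPTBdd C' := by
  obtain ⟨g, e, h⟩ := h
  exact ⟨g, e, fun a => (h' a).trans (h a)⟩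

theorem add (h : FPTBdd C) (h' : FPTBdd C') : FPTBdd (fun x => C x + C' x) := by
  obtain ⟨g, d, h⟩ := h
  obtain ⟨g', d', h'⟩ := h'
  refine ⟨fun k => g k + g' k, d + d', fun x => ?_⟩
  have h1 : (x.1.length + 1) ^ d ≤ (x.1.length + 1) ^ (d + d') :=
    Nat.pow_le_pow_right (by omega) (by omega)
  have h2 : (x.1.length + 1) ^ d' ≤ (x.1.length + 1) ^ (d + d') :=
    Nat.pow_le_pow_right (by omega) (by omega)
  calc C x + C' x ≤ g x.2 * (x.1.length + 1) ^ d + g' x.2 * (x.1.length + 1) ^ d' :=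
        add_le_add (h x) (h' x)
    _ ≤ g x.2 * (x.1.length + 1) ^ (d + d') + g' x.2 * (x.1.length + 1) ^ (d + d') := by gcongr
    _ = _ := by ring

theorem mul (h : FPTBdd C) (h' : FPTBdd C') : FPTBdd (fun x => C x * C' x) := by
  obtain ⟨g, d, h⟩ := h
  obtain ⟨g', d', h'⟩ := h'
  refine ⟨fun k => g k * g' k, d + d', fun x => ?_⟩
  calc C x * C' x ≤ (g x.2 * (x.1.length + 1) ^ d) * (g' x.2 * (x.1.length + 1) ^ d') :=
        Nat.mul_le_mul (h x) (h' x)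
    _ = _ := by ring

theorem pow (h : FPTBdd C) (n : ℕ) : FPTBdd (fun x => C x ^ n) := by
  induction n with
  | zero => simpa using of_param fun _ => 1
  | succ n ih => simpa only [pow_succ] using ih.mul h

end FPTBdd

/-- The context of the input. -/
def inputCtx (c : ℕ) : Ctx Inst where
  bound x := x.1.length + x.2 + c
  mem x a i := if a = 0 then x.1.getD i 0 else 0
  vars := [fun x => x.1.length, fun x => x.2]

theorem initState_matches (c : ℕ) (x : Inst) :
    (inputCtx c).Matches id x (initState x.1 x.2) := by
  refine ⟨rfl, fun i g hg => ?_⟩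
  match i with
  | 0 => exact congrFun (Option.some.inj hg) x
  | 1 => exact congrFun (Option.some.inj hg) x
  | i + 2 => simp [inputCtx] at hg

/-- A search with polynomial time tests that visits few words gives rise to a fixed-parameter
algorithm. -/
theorem exists_decides_of_search {X T : Inst → ℕ} {ok acc : Inst × List ℕ → Prop} {c : ℕ}
    (hX : Comp (inputCtx c) X) (hok : CompP (searchCtx X) ok) (hacc : CompP (searchCtx X) acc)
    (hnil : ∀ x, ¬ acc (x, [])) (hT : ∀ x l, ok (x, l) → l.length ≤ T x)
    (hXb : FPTBdd X) (hV : FPTBdd (fun x => visited (X x) (fun l => ok (x, l)) (T x) [])) :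
    ∃ (P : Prog) (f : ℕ → ℕ) (e : ℕ), ∀ (w : List ℕ) (k : ℕ), ∃ (t : ℕ) (s : State),
      Exec P (initState w k) t s ∧ t ≤ f k * (w.length + 1) ^ e ∧
      ((∃ l, Valid (X (w, k)) (fun l => ok ((w, k), l)) l ∧ acc ((w, k), l)) → s.var 0 = 1) ∧
      ((¬ ∃ l, Valid (X (w, k)) (fun l => ok ((w, k), l)) l ∧ acc ((w, k), l)) →
        s.var 0 = 0) := by
  obtain ⟨C, ⟨K₀, d₀, hC⟩, hP⟩ := hX
  -- The choice `N = 2` puts `X x` where `searchCtx` expects it and leaves the length and the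
  -- parameter in the variables `0` and `1`.
  obtain ⟨P, hP⟩ := hP 2 id (fun i hi => hi)
  obtain ⟨L, K, d, hL⟩ := exists_search hok hacc
  have hbound : FPTBdd fun x => (K₀ * (x.1.length + x.2 + c + 1) ^ d₀ + 10) +
      K * (X x + 1) ^ d * visited (X x) (fun l => ok (x, l)) (T x) [] :=
    (((FPTBdd.of_param fun _ => K₀).mul ((((FPTBdd.length.add (.of_param fun k => k)).add
      (.of_param fun _ => c)).add (.of_param fun _ => 1)).pow d₀)).add (.of_param fun _ => 10)).add
      (((FPTBdd.of_param fun _ => K).mul ((hXb.add (.of_param fun _ => 1)).pow d)).mul hV)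
  obtain ⟨g, e, hg⟩ := hbound
  let Fin : Prog := .cond (.var 4) (.assign 0 (.const 1)) (.assign 0 (.const 0))
  refine ⟨.seq P (.seq (.assign 3 (.const 1)) (.seq (.assign 4 (.const 0)) (.seq L Fin))), g, e,
    fun w k => ?_⟩
  obtain ⟨t, s, he, harr, hv, hr, ht⟩ := hP (w, k) _ (initState_matches c (w, k))
  let s₁ := (s.setVar 3 1).setVar 4 0
  have hs₁ : SearchState X (w, k) [0] 0 s₁ := by
    refine searchState_iff.2 ⟨?_, ?_, ?_, ?_, ?_, ?_⟩
    · simp only [s₁, State.setVar_arr, harr]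
      funext a i
      rcases i with _ | i <;> simp [initState, wordMem, searchCtx]
    · simp [s₁, hv, initState]
    · simp [s₁, hv, initState]
    · simp [s₁, hr]
    · simp [s₁]
    · simp [s₁]
  obtain ⟨t', s', he', ht', h4⟩ := hL (w, k) (T (w, k)) s₁ (hT _) hs₁
  have hfin : ∃ s'', Exec Fin s' 4 s'' ∧ (s'.var 4 ≠ 0 → s''.var 0 = 1) ∧
      (s'.var 4 = 0 → s''.var 0 = 0) := by
    by_cases h : s'.var 4 = 0
    · exact ⟨_, .cond_false (e := .var 4) h (.assign _ _ _), fun h' => absurd h h', fun _ => by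
        simp [Expr.eval]⟩
    · exact ⟨_, .cond_true (e := .var 4) h (.assign _ _ _), fun _ => by simp [Expr.eval], fun h' => absurd h' h⟩
  obtain ⟨s'', he'', h1, h0⟩ := hfin
  refine ⟨_, s'', .seq he (.seq (.assign _ _ _) (.seq (.assign _ _ _) (.seq he' he''))), ?_,
    fun h => h1 ?_, fun h => h0 ?_⟩
  · refine le_trans ?_ (hg (w, k))
    have := ht.trans (hC (w, k))
    simp only [inputCtx] at this
    simp only [Expr.cost]
    omega
  · obtain ⟨l, hl, ha⟩ := h
    rw [h4]
    have hne : l ≠ [] := by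
      rintro rfl
      exact hnil _ ha
    have hlen : l.length ≤ T (w, k) := by
      cases hl with
      | nil => exact Nat.zero_le _
      | cons _ h _ => exact hT _ _ h
    exact accepted_ne_zero (by rwa [List.append_nil]) hne hlen (by rwa [List.append_nil])
  · rw [h4]
    by_contra h'
    exact h (exists_of_accepted_ne_zero .nil h')

end RAM

/-! ### Counting row sets that are covered by few small sets -/

namespace RobustLRA

/-- If each of the numbers `n i x` is at most `N i`, and `x ↦ n i x` sums up to at most `b * N i`,
then the same holds for products of powers over a set of indices of total weight at least one. -/
theorem sum_prod_rpow_le {ι κ : Type*} (S : Finset ι) (Y : Finset κ) {e b : ℝ} (he : 0 < e)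
    (hS : 1 ≤ e * S.card) (N : ι → ℝ) (n : ι → κ → ℝ) (hN : ∀ i, 0 ≤ N i)
    (hn : ∀ i x, 0 ≤ n i x) (hnN : ∀ i x, n i x ≤ N i)
    (hsum : ∀ i, ∑ x ∈ Y, n i x ≤ b * N i) :
    ∑ x ∈ Y, ∏ i ∈ S, n i x ^ e ≤ b * ∏ i ∈ S, N i ^ e := by
  have hSpos : (0 : ℝ) < S.card := by
    by_contra h
    nlinarith
  -- If some `N i` vanishes, division by it is impossible, but then both sides are zero.
  by_cases hz : ∃ i ∈ S, N i = 0
  · obtain ⟨i, hi, h0⟩ := hz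
    have h1 : ∀ x, n i x = 0 := fun x => le_antisymm (h0 ▸ hnN i x) (hn i x)
    rw [Finset.prod_eq_zero hi (by rw [h0, Real.zero_rpow he.ne']), mul_zero]
    exact (Finset.sum_eq_zero fun x _ =>
      Finset.prod_eq_zero hi (by rw [h1, Real.zero_rpow he.ne'])).le
  push Not at hz
  have hpos : ∀ i ∈ S, 0 < N i := fun i hi => lt_of_le_of_ne (hN i) (hz i hi).symm
  -- The ratios `n i x / N i` are at most one, so the exponent `e` may be lowered to `1 / |S|`. The
  -- geometric mean that results is at most the arithmetic mean, which is linear in `n i x` and can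
  -- be summed over `x`.
  have key : ∀ x, ∏ i ∈ S, n i x ^ e ≤
      (∏ i ∈ S, N i ^ e) * ∑ i ∈ S, (S.card : ℝ)⁻¹ * (n i x / N i) := by
    intro x
    have h1 : ∏ i ∈ S, n i x ^ e = (∏ i ∈ S, N i ^ e) * ∏ i ∈ S, (n i x / N i) ^ e := by
      rw [← Finset.prod_mul_distrib]
      refine Finset.prod_congr rfl fun i hi => ?_
      rw [← Real.mul_rpow (hN i) (div_nonneg (hn i x) (hN i)), mul_div_cancel₀ _ (hpos i hi).ne']
    rw [h1]
    refine mul_le_mul_of_nonneg_left ?_ (Finset.prod_nonneg fun i _ => Real.rpow_nonneg (hN i) _)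
    refine le_trans (Finset.prod_le_prod (fun i hi => Real.rpow_nonneg (div_nonneg (hn i x) (hN i)) _)
      fun i hi => ?_) (Real.geom_mean_le_arith_mean_weighted S (fun _ => (S.card : ℝ)⁻¹)
        (fun i => n i x / N i) (fun _ _ => by positivity) ?_
        fun i _ => div_nonneg (hn i x) (hN i))
    · refine Real.rpow_le_rpow_of_exponent_ge' (div_nonneg (hn i x) (hN i))
        (div_le_one_of_le₀ (hnN i x) (hN i)) (by positivity) ?_
      rw [inv_le_iff_one_le_mul₀ hSpos]
      exact hS
    · rw [Finset.sum_const, nsmul_eq_mul, mul_inv_cancel₀ hSpos.ne']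
  calc ∑ x ∈ Y, ∏ i ∈ S, n i x ^ e
      ≤ ∑ x ∈ Y, (∏ i ∈ S, N i ^ e) * ∑ i ∈ S, (S.card : ℝ)⁻¹ * (n i x / N i) :=
        Finset.sum_le_sum fun x _ => key x
    _ = (∏ i ∈ S, N i ^ e) * ∑ i ∈ S, (S.card : ℝ)⁻¹ * ((∑ x ∈ Y, n i x) / N i) := by
        rw [← Finset.mul_sum, Finset.sum_comm]
        simp only [Finset.sum_div, Finset.mul_sum]
    _ ≤ (∏ i ∈ S, N i ^ e) * ∑ i ∈ S, (S.card : ℝ)⁻¹ * b := by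
        refine mul_le_mul_of_nonneg_left (Finset.sum_le_sum fun i hi => ?_)
          (Finset.prod_nonneg fun i _ => Real.rpow_nonneg (hN i) _)
        refine mul_le_mul_of_nonneg_left ?_ (by positivity)
        rw [div_le_iff₀ (hpos i hi)]
        exact hsum i
    _ = b * ∏ i ∈ S, N i ^ e := by
        rw [Finset.sum_const, nsmul_eq_mul, mul_inv_cancel_left₀ hSpos.ne', mul_comm]

/-- The modification of a row: the row, the class of columns on account of which it is modified,
and the set of slots (as a bit mask) whose columns require the modification. -/
structure Step where
  row : ℕ
  cls : ℕ
  mask : ℕ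

/-- The number of slots in a mask. -/
def slotCount (k σ : ℕ) : ℕ := ((Finset.range k).filter fun l => σ.testBit l = true).card

/-! ### The potential of a partial list of modifications -/

section Potential

variable {J : Type*} [Fintype J] (D : ℕ → J → Finset ℕ) (Q k : ℕ)

open Classical in
/-- The columns that may fill the slot `l` of the class `c`. -/
noncomputable def fillers (α : List Step) (i : ℕ × ℕ) : Finset J :=
  Finset.univ.filter fun j => ∀ s ∈ α, s.cls = i.1 → s.mask.testBit i.2 = true → s.row ∈ D i.1 j

/-- The weighted product of the numbers of columns that may fill the slots. -/
noncomputable def potential (α : List Step) : ℝ :=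
  ∏ i ∈ Finset.range Q ×ˢ Finset.range k, ((fillers D α i).card : ℝ) ^ (4 / k : ℝ)

theorem potential_nonneg (α : List Step) : 0 ≤ potential D Q k α :=
  Finset.prod_nonneg fun _ _ => Real.rpow_nonneg (Nat.cast_nonneg _) _

variable {D Q k}

theorem one_le_potential {α : List Step} (h : ∀ c < Q, ∀ l < k, (fillers D α (c, l)).Nonempty) :
    1 ≤ potential D Q k α := by
  rw [potential, ← Finset.prod_const_one (s := Finset.range Q ×ˢ Finset.range k)]
  refine Finset.prod_le_prod (fun _ _ => zero_le_one) fun i hi => ?_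
  rw [Finset.mem_product, Finset.mem_range, Finset.mem_range] at hi
  refine Real.one_le_rpow ?_ (by positivity)
  exact_mod_cast Finset.card_pos.2 (h i.1 hi.1 i.2 hi.2)

/-- Without modifications every column fills every slot, and the exponents `4 / k` of the `Q * k`
slots add up to `4 * Q`. For `k = 0` the product is empty. -/
theorem potential_nil_le (hJ : 0 < Fintype.card J) :
    potential D Q k [] ≤ (Fintype.card J : ℝ) ^ (4 * Q) := by
  have h1 : (1 : ℝ) ≤ Fintype.card J := by exact_mod_cast hJ
  by_cases hk : k = 0
  · subst hk
    simpa [potential] using one_le_pow₀ h1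
  · have hk' : (k : ℝ) ≠ 0 := by exact_mod_cast hk
    rw [potential, Finset.prod_congr rfl (g := fun _ => (Fintype.card J : ℝ) ^ (4 / k : ℝ))
      (fun i _ => by simp [fillers]), Finset.prod_const, Finset.card_product, Finset.card_range,
      Finset.card_range, ← Real.rpow_mul_natCast (by positivity), ← Real.rpow_natCast]
    refine le_of_eq (congrArg _ ?_)
    push_cast
    field_simp

/-- Only the slots of `σ` in the class `c` are affected. There are at least `k / 4` of them, so
their exponents sum to at least one and `sum_prod_rpow_le` applies. For one slot its hypothesis is a
double count: each filler `j` survives for at most `b` rows `x`, those in `D c j`. -/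
theorem sum_potential_le {b : ℕ} (hD : ∀ c j, (D c j).card ≤ b) (Y : Finset ℕ) (α : List Step)
    {c σ : ℕ} (hc : c < Q) (hk : 0 < k) (hσ : k ≤ 4 * slotCount k σ) :
    ∑ x ∈ Y, potential D Q k (⟨x, c, σ⟩ :: α) ≤ b * potential D Q k α := by
  classical
  set I := Finset.range Q ×ˢ Finset.range k
  let p : ℕ × ℕ → Prop := fun i => i.1 = c ∧ σ.testBit i.2 = true
  have hkpos : (0 : ℝ) < k := by exact_mod_cast hk
  have hcard : (I.filter p).card = slotCount k σ := by
    have : I.filter p = ((Finset.range k).filter fun l => σ.testBit l = true).image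
        fun l => (c, l) := by
      ext ⟨c', l⟩
      simp only [I, p, Finset.mem_filter, Finset.mem_product, Finset.mem_range, Finset.mem_image,
        Prod.mk.injEq]
      constructor
      · rintro ⟨⟨-, h⟩, rfl, h'⟩
        exact ⟨l, ⟨h, h'⟩, rfl, rfl⟩
      · rintro ⟨l, ⟨h, h'⟩, rfl, rfl⟩
        exact ⟨⟨hc, h⟩, rfl, h'⟩
    rw [this, Finset.card_image_of_injective _ fun _ _ h => (Prod.mk.inj h).2, slotCount]
  have hsub : ∀ x i, fillers D (⟨x, c, σ⟩ :: α) i ⊆ fillers D α i := fun x i j hj => by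
    simp only [fillers, Finset.mem_filter, Finset.mem_univ, true_and] at hj ⊢
    exact fun s hs => hj s (List.mem_cons_of_mem _ hs)
  have hoff : ∀ x, ∀ i, ¬ p i → fillers D (⟨x, c, σ⟩ :: α) i = fillers D α i := fun x i hi => by
    refine (hsub x i).antisymm fun j hj => ?_
    simp only [fillers, Finset.mem_filter, Finset.mem_univ, true_and, List.forall_mem_cons] at hj ⊢
    exact ⟨fun h1 h2 => absurd ⟨h1.symm, h2⟩ hi, hj⟩
  have hon : ∀ i, ∑ x ∈ Y, (if p i then ((fillers D (⟨x, c, σ⟩ :: α) i).card : ℝ) else 0) ≤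
      b * (fillers D α i).card := by
    intro i
    by_cases hi : p i
    · simp only [if_pos hi]
      have h1 : ∀ x, (fillers D (⟨x, c, σ⟩ :: α) i).card ≤
          ∑ j ∈ fillers D α i, if x ∈ D i.1 j then 1 else 0 := fun x => by
        rw [← Finset.card_filter]
        refine Finset.card_le_card fun j hj => Finset.mem_filter.2 ⟨hsub x i hj, ?_⟩
        simp only [fillers, Finset.mem_filter, Finset.mem_univ, true_and,
          List.forall_mem_cons] at hj
        exact hj.1 hi.1.symm hi.2
      have h2 : ∑ x ∈ Y, (fillers D (⟨x, c, σ⟩ :: α) i).card ≤ b * (fillers D α i).card := by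
        calc _ ≤ ∑ x ∈ Y, ∑ j ∈ fillers D α i, (if x ∈ D i.1 j then 1 else 0) :=
              Finset.sum_le_sum fun x _ => h1 x
          _ = ∑ j ∈ fillers D α i, ∑ x ∈ Y, (if x ∈ D i.1 j then 1 else 0) := Finset.sum_comm
          _ ≤ ∑ j ∈ fillers D α i, b := by
              refine Finset.sum_le_sum fun j _ => ?_
              rw [← Finset.card_filter]
              refine le_trans (Finset.card_le_card fun x hx => ?_) (hD i.1 j)
              exact (Finset.mem_filter.1 hx).2
          _ = _ := by rw [Finset.sum_const, smul_eq_mul, mul_comm]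
      exact_mod_cast h2
    · simp only [if_neg hi, Finset.sum_const_zero]
      positivity
  -- Outside the mask the count is replaced by `0`, so that the required bounds hold for all
  -- indices; only those in the mask enter the product.
  have hmain := sum_prod_rpow_le (I.filter p) Y (e := 4 / k) (b := b) (by positivity) (by
      rw [hcard, div_mul_eq_mul_div, one_le_div hkpos]
      exact_mod_cast hσ)
    (fun i => ((fillers D α i).card : ℝ))
    (fun i x => if p i then ((fillers D (⟨x, c, σ⟩ :: α) i).card : ℝ) else 0)
    (fun i => by positivity) (fun i x => by positivity) (fun i x => by
      split_ifs
      · exact_mod_cast Finset.card_le_card (hsub x i)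
      · positivity) hon
  have hsplit : ∀ β : List Step, potential D Q k β =
      (∏ i ∈ I.filter p, ((fillers D β i).card : ℝ) ^ (4 / k : ℝ)) *
        ∏ i ∈ I.filter fun i => ¬ p i, ((fillers D β i).card : ℝ) ^ (4 / k : ℝ) := fun β =>
    (Finset.prod_filter_mul_prod_filter_not _ _ _).symm
  have hR : ∀ x, ∏ i ∈ I.filter (fun i => ¬ p i),
      ((fillers D (⟨x, c, σ⟩ :: α) i).card : ℝ) ^ (4 / k : ℝ) =
      ∏ i ∈ I.filter fun i => ¬ p i, ((fillers D α i).card : ℝ) ^ (4 / k : ℝ) := fun x =>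
    Finset.prod_congr rfl fun i hi => by rw [hoff x i (Finset.mem_filter.1 hi).2]
  simp only [hsplit, hR]
  rw [← Finset.sum_mul, ← mul_assoc]
  refine mul_le_mul_of_nonneg_right ?_
    (Finset.prod_nonneg fun _ _ => Real.rpow_nonneg (Nat.cast_nonneg _) _)
  refine le_trans (le_of_eq (Finset.sum_congr rfl fun x _ => Finset.prod_congr rfl fun i hi => ?_))
    hmain
  rw [if_pos (Finset.mem_filter.1 hi).2]

end Potential

end RobustLRA

/-! ### Bounds for the number of visited words -/

namespace RAM

open Classical in
theorem visited_succ_le (M : ℕ) (ok : List ℕ → Prop) (d : ℕ) (l : List ℕ) (g : ℕ → ℕ)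
    (h : ∀ a < M, ok (a :: l) → visited M ok d (a :: l) ≤ g a) :
    visited M ok (d + 1) l ≤ 1 + ∑ a ∈ Finset.range M, g a := by
  rw [visited]
  refine Nat.add_le_add_left (Finset.sum_le_sum fun a ha => ?_) 1
  split_ifs with hok
  · exact h a (Finset.mem_range.1 ha) hok
  · exact Nat.zero_le _

open Classical in
/-- Four levels of a search at a time. -/
theorem visited_add_four_le (M : ℕ) (ok : List ℕ → Prop) (d : ℕ) (l : List ℕ) :
    visited M ok (d + 4) l ≤ 1 + M + M ^ 2 + M ^ 3 + ∑ y ∈ Finset.range M, ∑ z ∈ Finset.range M,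
      ∑ w ∈ Finset.range M, ∑ x ∈ Finset.range M,
        if ok (w :: z :: y :: x :: l) then visited M ok d (w :: z :: y :: x :: l) else 0 := by
  have h : visited M ok (d + 4) l ≤ 1 + ∑ x ∈ Finset.range M, (1 + ∑ y ∈ Finset.range M,
      (1 + ∑ z ∈ Finset.range M, (1 + ∑ w ∈ Finset.range M,
        if ok (w :: z :: y :: x :: l) then visited M ok d (w :: z :: y :: x :: l) else 0))) :=
    visited_succ_le _ _ _ _ _ fun x _ _ => visited_succ_le _ _ _ _ _ fun y _ _ =>
      visited_succ_le _ _ _ _ _ fun z _ _ => le_of_eq (by rw [visited])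
  refine h.trans (le_of_eq ?_)
  simp only [Finset.sum_add_distrib, Finset.sum_const, Finset.card_range, smul_eq_mul]
  -- The row `x` is guessed first but has to be summed innermost: the potential is controlled by
  -- summing over rows with class and mask fixed.
  have : ∀ F : ℕ → ℕ → ℕ → ℕ → ℕ, ∑ x ∈ Finset.range M, ∑ y ∈ Finset.range M,
      ∑ z ∈ Finset.range M, ∑ w ∈ Finset.range M, F x y z w =
      ∑ y ∈ Finset.range M, ∑ z ∈ Finset.range M, ∑ w ∈ Finset.range M, ∑ x ∈ Finset.range M,
        F x y z w := fun F => by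
    rw [Finset.sum_comm]
    refine Finset.sum_congr rfl fun y _ => ?_
    rw [Finset.sum_comm]
    refine Finset.sum_congr rfl fun z _ => Finset.sum_comm
  rw [this]
  ring

/-- A search is short if it is short below all words of some length. -/
theorem visited_add_le (M : ℕ) (ok : List ℕ → Prop) (d G n : ℕ) (l : List ℕ)
    (h : ∀ v : List ℕ, v.length = n → visited M ok d (v ++ l) ≤ G) :
    visited M ok (d + n) l ≤ (M + 1) ^ n * (G + 1) := by
  induction n generalizing l with
  | zero => simpa using (h [] rfl).trans (Nat.le_succ G)
  | succ n ih =>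
    refine (visited_succ_le M ok (d + n) l (fun _ => (M + 1) ^ n * (G + 1))
      fun a _ _ => ih (a :: l) fun v hv => ?_).trans ?_
    · simpa using h (v ++ [a]) (by simp [hv])
    · rw [Finset.sum_const, Finset.card_range, smul_eq_mul, pow_succ]
      have : 1 ≤ (M + 1) ^ n * (G + 1) := Nat.mul_pos (Nat.pow_pos (Nat.succ_pos M)) (by omega)
      nlinarith

end RAM

/-! ### The size of a search for row modifications -/

namespace RobustLRA

open RAM

/-- The modification described by the `i`-th block of a word. -/
def stepAt (b₀ : ℕ) (u : ℕ → ℕ) (i : ℕ) : Step :=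
  ⟨u (b₀ + 4 * i), u (b₀ + 4 * i + 2), u (b₀ + 4 * i + 3)⟩

/-- The first `i` modifications described by a word, the last one first. -/
def stepsOf (b₀ : ℕ) (u : ℕ → ℕ) (i : ℕ) : List Step :=
  ((List.range i).map (stepAt b₀ u)).reverse

theorem mem_stepsOf {b₀ : ℕ} {u : ℕ → ℕ} {i : ℕ} {s : Step} :
    s ∈ stepsOf b₀ u i ↔ ∃ i' < i, stepAt b₀ u i' = s := by
  simp [stepsOf]

theorem stepsOf_cons (b₀ : ℕ) (l : List ℕ) (i x ρ c σ : ℕ) (hl : l.length = b₀ + 4 * i) :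
    stepsOf b₀ (wordMem (σ :: c :: ρ :: x :: l)) (i + 1) =
      ⟨x, c, σ⟩ :: stepsOf b₀ (wordMem l) i := by
  rw [stepsOf, List.range_succ, List.map_append, List.reverse_append, List.map_singleton,
    List.reverse_singleton, List.singleton_append, stepsOf]
  congr 1
  · rw [stepAt, ← hl]
    simp [wordMem_cons, add_assoc]
  · congr 1
    refine List.map_congr_left fun j hj => ?_
    rw [List.mem_range] at hj
    have : ∀ p < l.length, wordMem (σ :: c :: ρ :: x :: l) p = wordMem l p :=
      fun p hp => wordMem_append [σ, c, ρ, x] l hp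
    rw [stepAt, stepAt, this _ (by omega), this _ (by omega), this _ (by omega)]

/-- A search for modifications each of which is covered by many slots visits few words. -/
theorem visited_blocks_le {J : Type*} [Fintype J] {D : ℕ → J → Finset ℕ} {b₀ b k Q M : ℕ}
    {ok : List ℕ → Prop} (hD : ∀ c j, (D c j).card ≤ b) (hJ : 0 < Fintype.card J) (l₀ : List ℕ)
    (hl₀ : l₀.length = b₀)
    (hok : ∀ (v : List ℕ) (i x ρ c σ : ℕ), v.length = 4 * i → i < k →
      ok (σ :: c :: ρ :: x :: (v ++ l₀)) → ρ < Q ∧ c < Q ∧ σ < 2 ^ k ∧ k ≤ 4 * slotCount k σ ∧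
        ∀ c' < Q, ∀ l < k,
          (fillers D (⟨x, c, σ⟩ :: stepsOf b₀ (wordMem (v ++ l₀)) i) (c', l)).Nonempty) :
    visited M ok (4 * k) l₀ ≤ (2 + M + M ^ 2 + M ^ 3) * (Q * Q * 2 ^ k * b + 1) ^ k *
      Fintype.card J ^ (4 * Q) := by
  classical
  -- `A` accounts for the words that end before the next block is complete. The factor `h` consists
  -- of the choices of new row, class and mask, times the growth `b` of the potential.
  set A : ℕ := 1 + M + M ^ 2 + M ^ 3
  set h : ℕ := Q * Q * 2 ^ k * b
  -- Here `j` blocks are still to come and `k - j` are present. The assumption that the potential is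
  -- at least one lets the additive `A` be absorbed into the product; it is passed on because
  -- admissible words keep every slot fillable.
  have key : ∀ j ≤ k, ∀ v : List ℕ, v.length = 4 * (k - j) →
      1 ≤ potential D Q k (stepsOf b₀ (wordMem (v ++ l₀)) (k - j)) →
      (visited M ok (4 * j) (v ++ l₀) : ℝ) ≤ (A + 1) * (h + 1) ^ j *
        potential D Q k (stepsOf b₀ (wordMem (v ++ l₀)) (k - j)) := by
    intro j
    induction j with
    | zero =>
      intro _ v _ hp
      simp only [visited, Nat.cast_one, pow_zero, mul_one]
      nlinarith [(Nat.cast_nonneg A : (0 : ℝ) ≤ A)]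
    | succ j ih =>
      intro hj v hv hp
      set i := k - (j + 1) with hi
      have hkj : k - j = i + 1 := by omega
      set α := stepsOf b₀ (wordMem (v ++ l₀)) i with hα
      let G : ℝ := (A + 1) * (h + 1) ^ j
      have hG : 0 ≤ G := by positivity
      have hrec : ∀ x ρ c σ : ℕ, ((if ok (σ :: c :: ρ :: x :: (v ++ l₀)) then
          visited M ok (4 * j) (σ :: c :: ρ :: x :: (v ++ l₀)) else 0 : ℕ) : ℝ) ≤
          if ρ < Q ∧ c < Q ∧ σ < 2 ^ k ∧ k ≤ 4 * slotCount k σ then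
            G * potential D Q k (⟨x, c, σ⟩ :: α) else 0 := by
        intro x ρ c σ
        split_ifs with h1 h2 h2
        · have := ih (by omega) (σ :: c :: ρ :: x :: v) (by simp only [List.length_cons]; omega)
          rw [hkj, List.cons_append, List.cons_append, List.cons_append, List.cons_append,
            stepsOf_cons _ _ _ _ _ _ _ (by rw [List.length_append]; omega)] at this
          exact this (one_le_potential (hok v i x ρ c σ hv (by omega) h1).2.2.2.2)
        · obtain ⟨a1, a2, a3, a4, -⟩ := hok v i x ρ c σ hv (by omega) h1
          exact absurd ⟨a1, a2, a3, a4⟩ h2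
        · rw [Nat.cast_zero]
          exact mul_nonneg hG (potential_nonneg _ _ _ _)
        · simp
      have hx : ∀ ρ c σ : ℕ, ∑ x ∈ Finset.range M,
          (if ρ < Q ∧ c < Q ∧ σ < 2 ^ k ∧ k ≤ 4 * slotCount k σ then
            G * potential D Q k (⟨x, c, σ⟩ :: α) else 0) ≤
          if σ < 2 ^ k then if c < Q then if ρ < Q then G * (b * potential D Q k α) else 0 else 0
            else 0 := by
        intro ρ c σ
        by_cases h2 : ρ < Q ∧ c < Q ∧ σ < 2 ^ k ∧ k ≤ 4 * slotCount k σ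
        · simp only [if_pos h2, if_pos h2.1, if_pos h2.2.1, if_pos h2.2.2.1]
          rw [← Finset.mul_sum]
          exact mul_le_mul_of_nonneg_left
            (sum_potential_le hD _ α h2.2.1 (by omega) h2.2.2.2) hG
        · simp only [if_neg h2, Finset.sum_const_zero]
          have := potential_nonneg D Q k α
          positivity
      have hcount : ∀ (q : ℕ) (z : ℝ), 0 ≤ z →
          ∑ y ∈ Finset.range M, (if y < q then z else 0) ≤ q * z := by
        intro q z hz
        rw [← Finset.sum_filter, Finset.sum_const, nsmul_eq_mul]
        refine mul_le_mul_of_nonneg_right ?_ hz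
        have : ((Finset.range M).filter (· < q)).card ≤ (Finset.range q).card :=
          Finset.card_le_card fun y hy => Finset.mem_range.2 (Finset.mem_filter.1 hy).2
        rw [Finset.card_range] at this
        exact_mod_cast this
      have hp0 := potential_nonneg D Q k α
      have hz : 0 ≤ G * (b * potential D Q k α) := by positivity
      have hsum : ∑ ρ ∈ Finset.range M, ∑ c ∈ Finset.range M, ∑ σ ∈ Finset.range M,
          (if σ < 2 ^ k then if c < Q then if ρ < Q then G * (b * potential D Q k α) else 0 else 0
            else 0) ≤ h * (G * potential D Q k α) := by
        calc _ ≤ ∑ ρ ∈ Finset.range M, ∑ c ∈ Finset.range M, ((2 ^ k : ℕ) : ℝ) *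
              (if c < Q then if ρ < Q then G * (b * potential D Q k α) else 0 else 0) :=
              Finset.sum_le_sum fun ρ _ => Finset.sum_le_sum fun c _ =>
                hcount _ _ (by split_ifs <;> first | exact hz | exact le_rfl)
          _ ≤ ∑ ρ ∈ Finset.range M, ((2 ^ k : ℕ) : ℝ) *
              (Q * (if ρ < Q then G * (b * potential D Q k α) else 0)) := by
              refine Finset.sum_le_sum fun ρ _ => ?_
              rw [← Finset.mul_sum]
              exact mul_le_mul_of_nonneg_left
                (hcount _ _ (by split_ifs <;> first | exact hz | exact le_rfl)) (by positivity)
          _ ≤ ((2 ^ k : ℕ) : ℝ) * (Q * (Q * (G * (b * potential D Q k α)))) := by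
              rw [← Finset.mul_sum, ← Finset.mul_sum]
              exact mul_le_mul_of_nonneg_left (mul_le_mul_of_nonneg_left (hcount _ _ hz)
                (by positivity)) (by positivity)
          _ = _ := by simp only [h]; push_cast; ring
      have hvis : (visited M ok (4 * (j + 1)) (v ++ l₀) : ℝ) ≤
          A + h * (G * potential D Q k α) := by
        have h4 := visited_add_four_le M ok (4 * j) (v ++ l₀)
        calc (visited M ok (4 * (j + 1)) (v ++ l₀) : ℝ)
            ≤ ((A + ∑ y ∈ Finset.range M, ∑ z ∈ Finset.range M,
              ∑ w ∈ Finset.range M, ∑ x ∈ Finset.range M,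
              if ok (w :: z :: y :: x :: (v ++ l₀)) then
                visited M ok (4 * j) (w :: z :: y :: x :: (v ++ l₀)) else 0 : ℕ) : ℝ) := by
              exact_mod_cast h4
          _ ≤ A + ∑ ρ ∈ Finset.range M, ∑ c ∈ Finset.range M, ∑ σ ∈ Finset.range M,
              (if σ < 2 ^ k then if c < Q then if ρ < Q then G * (b * potential D Q k α) else 0
                else 0 else 0) := by
              rw [Nat.cast_add]
              simp only [Nat.cast_sum]
              exact add_le_add le_rfl (Finset.sum_le_sum fun ρ _ => Finset.sum_le_sum fun c _ =>
                Finset.sum_le_sum fun σ _ =>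
                  (Finset.sum_le_sum fun x _ => hrec x ρ c σ).trans (hx ρ c σ))
          _ ≤ _ := add_le_add le_rfl hsum
      refine hvis.trans ?_
      have h1 : (A : ℝ) ≤ G * potential D Q k α := by
        have : (A : ℝ) ≤ G := by
          have h1 : (1 : ℝ) ≤ (h + 1) ^ j := one_le_pow₀ (by linarith [(Nat.cast_nonneg h : (0 : ℝ) ≤ h)])
          nlinarith [(Nat.cast_nonneg A : (0 : ℝ) ≤ A)]
        nlinarith
      calc (A : ℝ) + h * (G * potential D Q k α)
          ≤ G * potential D Q k α + h * (G * potential D Q k α) := by gcongr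
        _ = _ := by simp only [G]; ring
  have hnil : stepsOf b₀ (wordMem ([] ++ l₀)) (k - k) = [] := by simp [stepsOf]
  have h1 := key k le_rfl [] (by simp) (by
    rw [hnil]
    refine one_le_potential fun c _ l _ => ?_
    have : Nonempty J := Fintype.card_pos_iff.1 hJ
    simp [fillers])
  rw [hnil, List.nil_append] at h1
  have h2 := h1.trans (mul_le_mul_of_nonneg_left (potential_nil_le hJ) (by positivity))
  have h3 : (2 + M + M ^ 2 + M ^ 3) = A + 1 := by simp only [A]; ring
  rw [h3]
  exact_mod_cast h2

end RobustLRA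

/-! ### Low rank approximation and modifications of rows -/

namespace RobustLRA

/-- The sum of the `N` smallest of some numbers, as a sum over levels. -/
theorem exists_card_sum_le_iff {ι : Type*} [Fintype ι] (dist : ι → ℕ) {N m B : ℕ}
    (hN : N ≤ Fintype.card ι) (hm : ∀ j, dist j ≤ m) :
    (∃ K : Finset ι, N ≤ K.card ∧ ∑ j ∈ K, dist j ≤ B) ↔
      ∑ d ∈ Finset.range m, (N - (Finset.univ.filter fun j => dist j ≤ d).card) ≤ B := by
  classical
  -- Each `dist j` is the number of levels `d` below it; this counts the sum by levels.
  have hlayer : ∀ K : Finset ι, ∑ j ∈ K, dist j =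
      ∑ d ∈ Finset.range m, (K.filter fun j => d < dist j).card := by
    intro K
    simp only [Finset.card_filter]
    rw [Finset.sum_comm]
    refine Finset.sum_congr rfl fun j _ => ?_
    rw [← Finset.card_filter]
    conv_lhs => rw [← Finset.card_range (dist j)]
    congr 1
    ext d
    have := hm j
    simp only [Finset.mem_range, Finset.mem_filter]
    omega
  have hsplit : ∀ (K : Finset ι) (d : ℕ), (K.filter fun j => dist j ≤ d).card +
      (K.filter fun j => d < dist j).card = K.card := by
    intro K d
    simpa only [not_le] using Finset.card_filter_add_card_filter_not (s := K) (fun j => dist j ≤ d)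
  constructor
  · rintro ⟨K, hK, hsum⟩
    refine le_trans (Finset.sum_le_sum fun d _ => ?_) ((hlayer K).symm.trans_le hsum)
    have h1 := hsplit K d
    have h2 : (K.filter fun j => dist j ≤ d).card ≤
        (Finset.univ.filter fun j => dist j ≤ d).card :=
      Finset.card_le_card (Finset.filter_subset_filter _ (Finset.subset_univ K))
    omega
  · intro hsum
    -- Take `N` elements with least sum. By exchange none of them exceeds an element outside.
    obtain ⟨K, hK, hmin⟩ := Finset.exists_min_image (Finset.univ.powersetCard N)
      (fun K : Finset ι => ∑ j ∈ K, dist j) (by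
        rw [Finset.powersetCard_nonempty]
        exact hN)
    rw [Finset.mem_powersetCard] at hK
    have hlow : ∀ j ∈ K, ∀ j' ∉ K, dist j ≤ dist j' := by
      intro j hj j' hj'
      have hj'' : j' ∉ K.erase j := fun h => hj' (Finset.mem_of_mem_erase h)
      have h1 := hmin (insert j' (K.erase j)) (by
        rw [Finset.mem_powersetCard]
        refine ⟨Finset.subset_univ _, ?_⟩
        rw [Finset.card_insert_of_notMem hj'', Finset.card_erase_add_one hj, hK.2])
      rw [Finset.sum_insert hj'', ← Finset.add_sum_erase K dist hj] at h1
      omega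
    refine ⟨K, hK.2.ge, (hlayer K).trans_le (le_trans (Finset.sum_le_sum fun d _ => ?_) hsum)⟩
    have h1 := hsplit K d
    -- If an element outside `K` is at most `d`, all of `K` is and the level contributes nothing.
    -- Otherwise `K` contains all elements that are at most `d`, and the level contributes exactly
    -- the term of the right-hand sum.
    by_cases h : ∃ j' ∉ K, dist j' ≤ d
    · obtain ⟨j', hj', hd⟩ := h
      rw [Finset.card_eq_zero.2]
      · exact Nat.zero_le _
      · refine Finset.filter_eq_empty_iff.2 fun j hj => ?_
        have := hlow j hj j' hj'
        omega
    · push Not at h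
      have : (Finset.univ.filter fun j => dist j ≤ d) = K.filter fun j => dist j ≤ d := by
        ext j
        simp only [Finset.mem_filter, Finset.mem_univ, true_and]
        refine ⟨fun hj => ⟨?_, hj⟩, fun hj => hj.2⟩
        by_contra hjK
        have := h j hjK
        omega
      rw [this]
      omega

variable {F : Type*} [Field F] {m n : ℕ} {A : Matrix (Fin m) (Fin n) F} {r B ℓ : ℕ}

open Classical in
-- The matrix `L` factors through `r` dimensions, which bounds its rank. Outside `K` the matrix `C`
-- absorbs the whole difference, so only errors in `K` count.
theorem isYes_of_rows (G : Fin m → Fin r → F) (c : Fin n → Fin r → F) (K : Finset (Fin n))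
    (hK : n - ℓ ≤ K.card)
    (hsum : ∑ j ∈ K, (Finset.univ.filter fun x => G x ⬝ᵥ c j ≠ A x j).card ≤ B) :
    IsYes A r B ℓ := by
  let V : Matrix (Fin r) (Fin n) F := Matrix.of fun i j => if j ∈ K then c j i else 0
  let L : Matrix (Fin m) (Fin n) F := Matrix.of G * V
  have hL : ∀ x, ∀ j ∈ K, L x j = G x ⬝ᵥ c j := fun x j hj => by
    simp [L, V, Matrix.mul_apply, dotProduct, hj]
  refine ⟨L, Matrix.of fun x j => if j ∈ K then 0 else A x j - L x j, ?_, ?_, ?_⟩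
  · exact (Matrix.rank_mul_le_left _ _).trans
      ((Matrix.rank_le_card_width _).trans_eq (Fintype.card_fin r))
  · calc _ ≤ (↑(Kᶜ : Finset (Fin n)) : Set (Fin n)).ncard := by
          refine Set.ncard_le_ncard (fun j hj => ?_) (Finset.finite_toSet _)
          obtain ⟨i, hi⟩ := hj
          by_contra h
          exact hi (if_pos (by simpa using h))
      _ ≤ ℓ := by
          rw [Set.ncard_coe_finset, Finset.card_compl, Fintype.card_fin]
          omega
  · have : {ij : Fin m × Fin n | (A - L - Matrix.of fun x j => if j ∈ K then 0 else A x j - L x j)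
        ij.1 ij.2 ≠ 0} ⊆ ↑(K.biUnion fun j =>
          (Finset.univ.filter fun x => G x ⬝ᵥ c j ≠ A x j).image fun x => (x, j)) := by
      rintro ⟨x, j⟩ hxj
      simp only [Set.mem_ofPred_eq, Matrix.sub_apply, Matrix.of_apply] at hxj
      by_cases hj : j ∈ K
      · rw [if_pos hj, sub_zero, sub_ne_zero, hL x j hj] at hxj
        simp only [Finset.coe_biUnion, Set.mem_iUnion]
        exact ⟨j, hj, Finset.mem_coe.2 (Finset.mem_image.2
          ⟨x, Finset.mem_filter.2 ⟨Finset.mem_univ _, hxj.symm⟩, rfl⟩)⟩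
      · rw [if_neg hj, sub_self] at hxj
        exact absurd rfl hxj
    refine (Set.ncard_le_ncard this (Finset.finite_toSet _)).trans ?_
    rw [Set.ncard_coe_finset]
    exact Finset.card_biUnion_le.trans ((Finset.sum_le_sum fun j _ => Finset.card_image_le).trans
      hsum)

open Classical in
theorem IsYes.exists_kept (h : IsYes A r B ℓ) : ∃ (L : Matrix (Fin m) (Fin n) F)
    (K : Finset (Fin n)), L.rank ≤ r ∧ n - ℓ ≤ K.card ∧
      ∑ j ∈ K, (Finset.univ.filter fun x => L x j ≠ A x j).card ≤ B := by
  obtain ⟨L, C, hr, hC, hB⟩ := h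
  refine ⟨L, Finset.univ.filter fun j => ¬ ∃ i, C i j ≠ 0, hr, ?_, ?_⟩
  · rw [Set.ncard_eq_toFinset_card', Set.toFinset_ofPred] at hC
    have := Finset.card_filter_add_card_filter_not (s := (Finset.univ : Finset (Fin n)))
      (fun j => ∃ i, C i j ≠ 0)
    rw [Finset.card_univ, Fintype.card_fin] at this
    omega
  · rw [Set.ncard_eq_toFinset_card', Set.toFinset_ofPred] at hB
    rw [← Finset.card_sigma]
    refine le_trans (Finset.card_le_card_of_injOn (fun p => (p.2, p.1)) ?_ ?_) hB
    · rintro ⟨j, x⟩ hp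
      simp only [Finset.coe_sigma, Set.mem_sigma_iff, Finset.mem_coe, Finset.mem_filter,
        Finset.mem_univ, true_and, not_exists, not_not] at hp
      simp only [Finset.coe_filter, Finset.mem_univ, true_and, Set.mem_ofPred_eq, Matrix.sub_apply,
        hp.1 x, sub_ne_zero]
      exact hp.2.symm
    · rintro ⟨j, x⟩ _ ⟨j', x'⟩ _ h
      simp only [Prod.mk.injEq] at h
      rw [h.1, h.2]

/-- The columns of a matrix of rank at most `r` that belong to a nonempty set are linear
combinations of `r` columns of this set. -/
theorem exists_spanning_columns (L : Matrix (Fin m) (Fin n) F) (hL : L.rank ≤ r)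
    {K : Finset (Fin n)} (hK : K.Nonempty) : ∃ (J : Fin r → Fin n) (c : Fin n → Fin r → F),
      (∀ i, J i ∈ K) ∧ ∀ j ∈ K, ∀ x, (fun i => L x (J i)) ⬝ᵥ c j = L x j := by
  obtain ⟨j₀, hj₀⟩ := hK
  obtain ⟨κ, a, ha, hspan, hli⟩ := exists_linearIndependent' F (fun j : K => L.col j)
  have : Finite κ := Finite.of_injective a ha
  have : Fintype κ := Fintype.ofFinite κ
  have hcard : Fintype.card κ ≤ r := by
    rw [← finrank_span_eq_card hli, hspan]
    refine le_trans (Submodule.finrank_mono (Submodule.span_mono ?_))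
      ((L.rank_eq_finrank_span_cols).symm.trans_le hL)
    rintro _ ⟨j, rfl⟩
    exact ⟨j, rfl⟩
  let E := Fintype.equivFin κ
  -- A basis may have fewer than `r` columns; the remaining places are filled with `j₀`.
  let J : Fin r → Fin n := fun i => if h : i.1 < Fintype.card κ then a (E.symm ⟨i, h⟩) else j₀
  have hJ : ∀ i, J i ∈ K := fun i => by
    simp only [J]
    split_ifs with h
    · exact (a (E.symm ⟨i, h⟩)).2
    · exact hj₀
  have hc : ∀ j : Fin n, ∃ c : Fin r → F, j ∈ K → ∑ i, c i • L.col (J i) = L.col j := by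
    intro j
    by_cases hj : j ∈ K
    · have h1 : L.col j ∈ Submodule.span F (Set.range fun i => L.col (J i)) := by
        have h2 : L.col j ∈ Submodule.span F (Set.range ((fun j : K => L.col j) ∘ a)) := by
          rw [hspan]
          exact Submodule.subset_span ⟨⟨j, hj⟩, rfl⟩
        refine Submodule.span_mono ?_ h2
        rintro _ ⟨k, rfl⟩
        refine ⟨⟨E k, (E k).2.trans_le hcard⟩, ?_⟩
        simp [J]
      obtain ⟨c, hc⟩ := (Submodule.mem_span_range_iff_exists_fun F).1 h1
      exact ⟨c, fun _ => hc⟩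
    · exact ⟨0, fun h => absurd h hj⟩
  choose c hc using hc
  refine ⟨J, c, hJ, fun j hj x => ?_⟩
  have := congrFun (hc j hj) x
  simp only [Finset.sum_apply, Pi.smul_apply, smul_eq_mul, Matrix.col_apply] at this
  rw [← this, dotProduct]
  exact Finset.sum_congr rfl fun i _ => mul_comm _ _

open Classical in
/-- A nonempty set of at most `B` elements can be distributed to `B` slots so that each
strict majority of the elements receives a quarter of the slots. -/
theorem exists_slots {ι : Type*} {K : Finset ι} (hK : K.Nonempty) (hB : K.card ≤ B) :
    ∃ g : ℕ → ι, (∀ l, g l ∈ K) ∧ ∀ Y ⊆ K, K.card < 2 * Y.card →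
      B ≤ 4 * ((Finset.range B).filter fun l => g l ∈ Y).card := by
  set s := K.card with hs
  have hspos : 0 < s := Finset.card_pos.2 hK
  let E : K ≃ Fin s := K.equivFin
  -- The elements are dealt out cyclically, so each one gets at least `B / s` (rounded down) slots.
  let g : ℕ → ι := fun l => E.symm ⟨l % s, Nat.mod_lt _ hspos⟩
  refine ⟨g, fun l => (E.symm _).2, fun Y hY hmaj => ?_⟩
  have hcount : Y.card * (B / s) ≤ ((Finset.range B).filter fun l => g l ∈ Y).card := by
    let idx : ι → ℕ := fun j => if h : j ∈ K then E ⟨j, h⟩ else 0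
    have hidx : ∀ j ∈ K, ∀ q, g (q * s + idx j) = j := fun j hj q => by
      have h1 : idx j = E ⟨j, hj⟩ := dif_pos hj
      have h2 : (⟨(q * s + idx j) % s, Nat.mod_lt _ hspos⟩ : Fin s) = E ⟨j, hj⟩ := by
        refine Fin.ext (Eq.trans ?_ (Nat.mod_eq_of_lt (E ⟨j, hj⟩).2))
        show (q * s + idx j) % s = _
        rw [← h1, mul_comm, Nat.mul_add_mod]
      simp only [g, h2, Equiv.symm_apply_apply]
    rw [← Finset.card_range (B / s), ← Finset.card_product]
    refine Finset.card_le_card_of_injOn (fun p => p.2 * s + idx p.1) ?_ ?_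
    · rintro ⟨j, q⟩ hp
      rw [Finset.mem_coe, Finset.mem_product, Finset.mem_range] at hp
      rw [Finset.mem_coe, Finset.mem_filter, Finset.mem_range, hidx j (hY hp.1) q]
      refine ⟨?_, hp.1⟩
      have h1 : idx j < s := by
        simp only [idx, dif_pos (hY hp.1)]
        exact (E _).2
      have h2 : (q + 1) * s ≤ B := (Nat.mul_le_mul_right s hp.2).trans (Nat.div_mul_le_self B s)
      rw [Nat.succ_mul] at h2
      show q * s + idx j < B
      omega
    · rintro ⟨j, q⟩ hp ⟨j', q'⟩ hp' h
      rw [Finset.mem_coe, Finset.mem_product] at hp hp'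
      simp only at h
      have h1 : j = j' := by rw [← hidx j (hY hp.1) q, h, hidx j' (hY hp'.1) q']
      subst h1
      rw [Nat.add_right_cancel_iff, Nat.mul_left_inj hspos.ne'] at h
      rw [h]
  -- With `q = B / s ≥ 1` and `s < 2 * |Y|` one gets `B < s * q + s ≤ 2 * s * q < 4 * |Y| * q`.
  have h1 : B < s * (B / s) + s := by
    have := Nat.div_add_mod B s
    have := Nat.mod_lt B hspos
    omega
  have h2 : 1 ≤ B / s := (Nat.one_le_div_iff hspos).2 hB
  nlinarith

open Classical in
/-- If `A` has a good approximation, then it has one that arises from an `m × r` matrix of columns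
of `A` by the modification of few rows, each of which is demanded by many slots. -/
theorem IsYes.exists_modification (h : IsYes A r B ℓ) : ∃ K : Finset (Fin n), n - ℓ ≤ K.card ∧
    (K.Nonempty → ∃ (J : Fin r → Fin n) (c : Fin n → Fin r → F) (S : Finset (Fin m))
      (R : Fin m → Fin r → F) (cls : Fin m → Fin r → F) (slot : (Fin r → F) → ℕ → Fin n),
      S.card ≤ B ∧
      ∑ j ∈ K, (Finset.univ.filter fun x =>
        (if x ∈ S then R x else fun i => A x (J i)) ⬝ᵥ c j ≠ A x j).card ≤ B ∧
      ∀ x ∈ S, B ≤ 4 * ((Finset.range B).filter fun l =>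
          (fun i => A x (J i)) ⬝ᵥ cls x ≠ A x (slot (cls x) l)).card ∧
        ∀ l, (Finset.univ.filter fun y =>
          (fun i => A y (J i)) ⬝ᵥ cls x ≠ A y (slot (cls x) l)).card ≤ 2 * B) := by
  obtain ⟨L, K, hL, hK, hsum⟩ := h.exists_kept
  refine ⟨K, hK, fun hne => ?_⟩
  obtain ⟨J, c, hJ, hc⟩ := exists_spanning_columns L hL hne
  -- `G` has the chosen columns of `A`, `G'` those of `L`. With the same coefficients, `e` marks the
  -- errors of `L` and `d` those of the unmodified matrix.
  let G : Fin m → Fin r → F := fun x i => A x (J i)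
  let G' : Fin m → Fin r → F := fun x i => L x (J i)
  let e : Fin m → Fin n → Prop := fun x j => G' x ⬝ᵥ c j ≠ A x j
  let d : Fin m → Fin n → Prop := fun x j => G x ⬝ᵥ c j ≠ A x j
  have hsum_e : ∑ x, (K.filter (e x)).card ≤ B := by
    refine le_trans (le_of_eq ?_) hsum
    simp only [Finset.card_filter]
    rw [Finset.sum_comm]
    refine Finset.sum_congr rfl fun j hj => Finset.sum_congr rfl fun x _ => ?_
    simp only [e, G', hc j hj x]
  -- A row where `G` and `G'` differ has an error of `L` in one of the chosen columns, which are
  -- kept.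
  have hbad : (Finset.univ.filter fun x => G x ≠ G' x).card ≤ B := by
    refine le_trans ?_ hsum_e
    rw [Finset.card_filter]
    refine Finset.sum_le_sum fun x _ => ?_
    split_ifs with hx
    · obtain ⟨i, hi⟩ := Function.ne_iff.1 hx
      refine Finset.card_pos.2 ⟨J i, Finset.mem_filter.2 ⟨hJ i, ?_⟩⟩
      simp only [e, G', hc _ (hJ i) x]
      exact hi.symm
    · exact Nat.zero_le _
  -- A disagreement with `G` is an error of `L` or occurs in a row where `G` and `G'` differ; there
  -- are at most `B` rows of either kind.
  have hlight : ∀ j ∈ K, (Finset.univ.filter fun x => d x j).card ≤ 2 * B := by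
    intro j hj
    have h1 : (Finset.univ.filter fun x => e x j).card ≤ B := by
      refine le_trans ?_ hsum_e
      rw [Finset.card_filter]
      refine Finset.sum_le_sum fun x _ => ?_
      split_ifs with hx
      · exact Finset.card_pos.2 ⟨j, Finset.mem_filter.2 ⟨hj, hx⟩⟩
      · exact Nat.zero_le _
    have h2 : (Finset.univ.filter fun x => d x j) ⊆
        (Finset.univ.filter fun x => e x j) ∪ Finset.univ.filter fun x => G x ≠ G' x := by
      intro x hx
      simp only [Finset.mem_union, Finset.mem_filter, Finset.mem_univ, true_and] at hx ⊢
      by_contra h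
      push Not at h
      simp only [e, d, ← h.2] at h hx
      exact hx (not_not.1 h.1)
    have := (Finset.card_le_card h2).trans (Finset.card_union_le _ _)
    omega
  -- Only rows where the change strictly lowers the number of errors are modified; this is what
  -- produces a majority below.
  let S : Finset (Fin m) :=
    Finset.univ.filter fun x => (K.filter (e x)).card < (K.filter (d x)).card
  have hSsub : ∀ x ∈ S, G x ≠ G' x := by
    intro x hx heq
    have := (Finset.mem_filter.1 hx).2
    simp only [e, d, heq, lt_irrefl] at this
  let cl : (Fin r → F) → Finset (Fin n) := fun γ => K.filter fun j => c j = γ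
  have hcls : ∀ x, ∃ γ, x ∈ S → (cl γ).card < 2 * ((cl γ).filter (d x)).card ∧
      ∀ j ∈ cl γ, d x j ∨ e x j := by
    intro x
    by_cases hx : x ∈ S
    · have hlt := (Finset.mem_filter.1 hx).2
      have hfib : ∀ (p : Fin n → Prop) [DecidablePred p], (K.filter p).card =
          ∑ γ ∈ K.image c, ((cl γ).filter p).card := by
        intro p _
        rw [Finset.card_eq_sum_card_fiberwise (f := c) (t := K.image c)
          (fun j hj => Finset.mem_coe.2 (Finset.mem_image_of_mem c (Finset.mem_filter.1 hj).1))]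
        refine Finset.sum_congr rfl fun γ _ => ?_
        simp only [cl, Finset.filter_filter]
        congr 1
        ext j
        simp only [Finset.mem_filter]
        tauto
      rw [hfib, hfib] at hlt
      obtain ⟨γ, -, hγ⟩ := Finset.exists_lt_of_sum_lt hlt
      -- In a class where `d` wins, the old and the new row have different products with `γ`. No
      -- entry equals both, so every column of the class has an error of one kind, and the errors
      -- `d` form a strict majority.
      have hdiff : G x ⬝ᵥ γ ≠ G' x ⬝ᵥ γ := by
        intro heq
        refine hγ.ne (congrArg Finset.card (Finset.filter_congr fun j hj => ?_))
        simp only [cl, Finset.mem_filter] at hj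
        simp only [e, d, hj.2, heq]
      have hor : ∀ j ∈ cl γ, d x j ∨ e x j := by
        intro j hj
        simp only [cl, Finset.mem_filter] at hj
        by_contra h
        push Not at h
        simp only [e, d, hj.2, not_not] at h
        exact hdiff (h.1.trans h.2.symm)
      refine ⟨γ, fun _ => ⟨?_, hor⟩⟩
      have h1 : (cl γ).card ≤ ((cl γ).filter (d x)).card + ((cl γ).filter (e x)).card := by
        refine le_trans (Finset.card_le_card fun j hj => ?_) (Finset.card_union_le _ _)
        exact Finset.mem_union.2 ((hor j hj).imp (fun h => Finset.mem_filter.2 ⟨hj, h⟩)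
          fun h => Finset.mem_filter.2 ⟨hj, h⟩)
      omega
    · exact ⟨0, fun h => absurd h hx⟩
  choose cls hcls using hcls
  have hslot : ∀ γ, ∃ g : ℕ → Fin n, ∀ x ∈ S, cls x = γ → (∀ l, g l ∈ cl γ) ∧
      B ≤ 4 * ((Finset.range B).filter fun l => d x (g l)).card := by
    intro γ
    by_cases hγ : ∃ x ∈ S, cls x = γ
    · have hclne : (cl γ).Nonempty := by
        obtain ⟨x, hx, rfl⟩ := hγ
        have := (hcls x hx).1
        by_contra h
        rw [Finset.not_nonempty_iff_eq_empty] at h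
        simp [h] at this
      by_cases hcard : (cl γ).card ≤ B
      · obtain ⟨g, hg, hmaj⟩ := exists_slots hclne hcard
        refine ⟨g, fun x hx hxγ => ⟨hg, ?_⟩⟩
        have h1 := hmaj ((cl γ).filter (d x)) (Finset.filter_subset _ _) (hxγ ▸ (hcls x hx).1)
        have h2 : ((Finset.range B).filter fun l => d x (g l)) =
            (Finset.range B).filter fun l => g l ∈ (cl γ).filter (d x) := by
          ext l
          simp [hg l]
        rw [h2]
        convert h1
      -- A class with more than `B` columns has one without errors of `L`. It disagrees with `G` in
      -- every modified row of this class and can fill all the slots alone.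
      · have hex : ∃ j ∈ cl γ, ∀ x, ¬ e x j := by
          by_contra h
          push Not at h
          refine hcard (le_trans ?_ hsum)
          rw [Finset.card_eq_sum_ones]
          refine (Finset.sum_le_sum fun j hj => ?_).trans
            (Finset.sum_le_sum_of_subset (Finset.filter_subset _ K))
          obtain ⟨x, hx⟩ := h j hj
          refine Finset.card_pos.2 ⟨x, Finset.mem_filter.2 ⟨Finset.mem_univ _, ?_⟩⟩
          rw [← hc j (Finset.mem_filter.1 hj).1 x]
          exact hx
        obtain ⟨j, hj, hexact⟩ := hex
        refine ⟨fun _ => j, fun x hx hxγ => ⟨fun _ => hj, ?_⟩⟩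
        have hd : d x j := ((hcls x hx).2 j (hxγ ▸ hj)).resolve_right (hexact x)
        simp only [hd, Finset.filter_true, Finset.card_range]
        omega
    · have ⟨j, _⟩ := hne
      exact ⟨fun _ => j, fun x hx h => absurd ⟨x, hx, h⟩ hγ⟩
  choose slot hslot using hslot
  refine ⟨J, c, S, G', cls, slot, ?_, ?_, fun x hx => ?_⟩
  · exact (Finset.card_le_card fun x hx =>
      Finset.mem_filter.2 ⟨Finset.mem_univ _, hSsub x hx⟩).trans hbad
  · calc _ = ∑ x, (K.filter fun j =>
          (if x ∈ S then G' x else fun i => A x (J i)) ⬝ᵥ c j ≠ A x j).card := by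
          simp only [Finset.card_filter]
          rw [Finset.sum_comm]
      _ ≤ ∑ x, (K.filter (e x)).card := Finset.sum_le_sum fun x _ => by
          by_cases hx : x ∈ S
          · simp only [if_pos hx]
            exact le_rfl
          · simp only [if_neg hx]
            simpa only [S, Finset.mem_filter, Finset.mem_univ, true_and, not_lt] using hx
      _ ≤ B := hsum_e
  · obtain ⟨h1, h2⟩ := hslot (cls x) x hx rfl
    have hcl : ∀ l, slot (cls x) l ∈ K ∧ c (slot (cls x) l) = cls x := fun l =>
      Finset.mem_filter.1 (h1 l)
    refine ⟨h2.trans (le_of_eq ?_), fun l => ?_⟩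
    · congr 2
      refine Finset.filter_congr fun l _ => ?_
      simp only [d, (hcl l).2]
      rfl
    · have := hlight _ (hcl l).1
      simp only [d, (hcl l).2] at this
      exact this

end RobustLRA

/-! ### The search for modifications of rows -/

namespace RAM

/-- The context `Γ` contains the quantities of the context of a search at the point `π a`. -/
structure Extends {α : Type*} (X : Inst → ℕ) (Γ : Ctx α) (π : α → Inst × List ℕ) : Prop where
  mem : ∀ a, Γ.mem a = (searchCtx X).mem (π a)
  bound : ∀ a, Γ.bound a = X (π a).1
  len : Comp Γ (fun a => (π a).1.1.length)
  par : Comp Γ (fun a => (π a).1.2)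
  bnd : Comp Γ (fun a => X (π a).1)
  wlen : Comp Γ (fun a => (π a).2.length)

theorem Extends.push {α : Type*} {X : Inst → ℕ} {Γ : Ctx α} {π : α → Inst × List ℕ}
    (h : Extends X Γ π) : Extends X Γ.push (fun a => π a.1) where
  mem a := h.mem a.1
  bound a := h.bound a.1
  len := h.len.weaken
  par := h.par.weaken
  bnd := h.bnd.weaken
  wlen := h.wlen.weaken

theorem extends_searchCtx (X : Inst → ℕ) : Extends X (searchCtx X) (fun p => p) where
  mem _ := rfl
  bound _ := rfl
  len := .var 0 rfl
  par := .var 1 rfl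
  bnd := .var 2 rfl
  wlen := .var 3 rfl

/-- The input symbol at a position. -/
def letter (p : Inst × List ℕ) (i : ℕ) : ℕ := p.1.1.getD i 0

theorem Extends.letter {α : Type*} {X : Inst → ℕ} {Γ : Ctx α} {π : α → Inst × List ℕ}
    (h : Extends X Γ π) {f : α → ℕ} (hf : Comp Γ f) :
    Comp Γ (fun a => RAM.letter (π a) (f a)) :=
  (hf.get 0).congr fun a => by simp [h.mem, searchCtx, RAM.letter]

theorem Extends.word {α : Type*} {X : Inst → ℕ} {Γ : Ctx α} {π : α → Inst × List ℕ}
    (h : Extends X Γ π) {f : α → ℕ} (hf : Comp Γ f) :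
    Comp Γ (fun a => wordMem (π a).2 (f a)) :=
  (hf.get 1).congr fun a => by simp [h.mem, searchCtx]

theorem Comp.min {α : Type*} {Γ : Ctx α} {f g : α → ℕ} (hf : Comp Γ f) (hg : Comp Γ g) :
    Comp Γ (fun a => min (f a) (g a)) :=
  (hf.sub (hf.sub hg)).congr fun a => by omega

end RAM

namespace RobustLRA

open RAM

variable {F : Type*} [Field F] [Fintype F] {r : ℕ}

variable (F r) in
/-- The number of vectors with `r` entries. -/
noncomputable def vecCount : ℕ := Nat.card (Fin r → F)

/-- A numbering of the vectors. -/
noncomputable def vecEquiv : (Fin r → F) ≃ Fin (vecCount F r) := Finite.equivFin _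

open Classical in
/-- The vector with a given number. -/
noncomputable def vec (ρ : ℕ) : Fin r → F :=
  if h : ρ < vecCount F r then vecEquiv.symm ⟨ρ, h⟩ else 0

/-- The number of a vector. -/
noncomputable def vecNum (v : Fin r → F) : ℕ := (vecEquiv v).1

omit [Field F] in
theorem vecNum_lt (v : Fin r → F) : vecNum v < vecCount F r := (vecEquiv v).2

@[simp] theorem vec_vecNum (v : Fin r → F) : vec (vecNum v) = v := by
  simp [vec, vecNum]

theorem vecNum_vec {ρ : ℕ} (h : ρ < vecCount F r) : vecNum (vec ρ : Fin r → F) = ρ := by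
  simp [vec, vecNum, h]

theorem vecCount_pos : 0 < vecCount F r := (Nat.zero_le _).trans_lt (vecNum_lt (0 : Fin r → F))

variable (F r) in
/-- A constant that bounds the number of vectors and the length of the initial part of a word. -/
noncomputable def sizeConst : ℕ := vecCount F r + r + 4

variable (F r) in
/-- The bound for the symbols of a word. -/
noncomputable def symBound (x : Inst) : ℕ := x.1.length + x.2 + sizeConst F r + 2 ^ x.2

/-! ### Field arithmetic by finite tables -/

section Tables

variable (code : Letter F → ℕ)

/-- The code of an entry of a matrix. -/
def entryCode (a : F) : ℕ := code (some (Sum.inl a))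

variable (r)

open Classical in
/-- The code of an entry of a vector. -/
noncomputable def coordTable (ρ i : ℕ) : ℕ :=
  if h : ρ < vecCount F r ∧ i < r then entryCode code ((vec ρ : Fin r → F) ⟨i, h.2⟩) else 0

open Classical in
/-- The code of a scalar product of two vectors. -/
noncomputable def dotTable (c ρ : ℕ) : ℕ :=
  if ρ < vecCount F r ∧ c < vecCount F r then
    entryCode code ((vec ρ : Fin r → F) ⬝ᵥ vec c) else 0

variable {r} {α : Type*} {Γ : Ctx α} {f g : α → ℕ}

theorem comp_coordTable (hf : Comp Γ f) (hg : Comp Γ g) :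
    Comp Γ (fun a => coordTable r code (f a) (g a)) :=
  Comp.table₂ hf hg _ (vecCount F r + r) fun i j h => dif_neg (by omega)

theorem comp_dotTable (hf : Comp Γ f) (hg : Comp Γ g) :
    Comp Γ (fun a => dotTable r code (f a) (g a)) :=
  Comp.table₂ hf hg _ (vecCount F r) fun i j h => if_neg (by omega)

omit [Field F] in
theorem compP_isEntry (hf : Comp Γ f) : CompP Γ (fun a => ∃ b, f a = entryCode code b) := by
  classical
  obtain ⟨n, hn⟩ : ∃ n, ∀ b, entryCode code b < n :=
    ⟨(Finset.univ.sup fun b => entryCode code b) + 1, fun b =>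
      Nat.lt_succ_of_le (Finset.le_sup (f := fun b => entryCode code b) (Finset.mem_univ b))⟩
  exact Comp.table hf (fun i => ind (∃ b, i = entryCode code b)) n fun i hi =>
    ind_of_not fun ⟨b, hb⟩ => by have := hn b; omega

end Tables

/-! ### The layout of the guessed words and the tests -/

section Tests

variable (X : Inst → ℕ) (r) (code : Letter F → ℕ) (p : Inst × List ℕ)

/-- The number of bits in front of the matrix, as claimed by a word. -/
def bitCount : ℕ := min (wordMem p.2 0) (X p.1)

/-- The number of rows, as claimed by a word. -/
def rowCount : ℕ := min (wordMem p.2 1) (X p.1)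

/-- The number of columns, as claimed by a word. -/
def colCount : ℕ := min (wordMem p.2 2) (X p.1)

/-- The code of the symbol that stands for the entry in row `x` and column `j`. -/
def entry (x j : ℕ) : ℕ := letter p (bitCount X p + 1 + (rowCount X p * j + j + x))

/-- The row `x` of the matrix of the chosen columns is the vector number `ρ`. -/
def BaseRow (x ρ : ℕ) : Prop :=
  ∀ i < r, coordTable r code ρ i = entry X p x (wordMem p.2 (3 + i))

/-- The entry in row `x` and column `j` is not the product of the chosen columns with the
coefficient vector number `c`. -/
def BaseMismatch (c j x : ℕ) : Prop :=
  ¬ ∃ ρ < vecCount F r, BaseRow r X code p x ρ ∧ dotTable r code c ρ = entry X p x j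

open Classical in
/-- The column `j` is close to the product of the chosen columns with the coefficient vector
number `c`. -/
def Light (c j : ℕ) : Prop :=
  ((Finset.range (rowCount X p)).filter fun x => BaseMismatch r X code p c j x).card ≤
    p.1.2 + p.1.2

/-- The `i`-th block of the word is complete. -/
def Complete (i : ℕ) : Prop := 3 + r + 4 * i + 4 ≤ p.2.length

/-- The row that is modified in the `i`-th block. -/
def blockRow (i : ℕ) : ℕ := wordMem p.2 (3 + r + 4 * i)

/-- The number of the new row in the `i`-th block. -/
def blockVec (i : ℕ) : ℕ := wordMem p.2 (3 + r + 4 * i + 1)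

/-- The class in the `i`-th block. -/
def blockCls (i : ℕ) : ℕ := wordMem p.2 (3 + r + 4 * i + 2)

/-- The mask of slots in the `i`-th block. -/
def blockMask (i : ℕ) : ℕ := wordMem p.2 (3 + r + 4 * i + 3)

/-- The `i`-th block uses the slot `l`. -/
def UsesSlot (i l : ℕ) : Prop := blockMask r p i < 2 ^ p.1.2 ∧ (blockMask r p i).testBit l = true

/-- The column `j` can fill the slot `l` of the class of the `i`-th block. -/
def Fills (i l j : ℕ) : Prop :=
  Light r X code p (blockCls r p i) j ∧ ∀ i' < p.1.2, Complete r p i' →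
    blockCls r p i' = blockCls r p i → UsesSlot r p i' l →
      blockRow r p i' < rowCount X p ∧ BaseMismatch r X code p (blockCls r p i) j (blockRow r p i')

open Classical in
/-- The `i`-th block of the word is admissible. -/
def BlockOk (i : ℕ) : Prop :=
  (blockVec r p i < vecCount F r ∧ blockCls r p i < vecCount F r ∧ blockMask r p i < 2 ^ p.1.2) ∧
  p.1.2 ≤ 4 * ((Finset.range p.1.2).filter fun l => UsesSlot r p i l).card ∧
  ∀ l < p.1.2, UsesSlot r p i l → ∃ j < colCount X p, Fills r X code p i l j

/-- The test that prunes the search. -/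
def Admissible : Prop :=
  p.2.length ≤ 4 * p.1.2 + (3 + r) ∧ ∀ i < p.1.2, Complete r p i → BlockOk r X code p i

/-- The row `x` of the modified matrix is the vector number `ρ`. -/
def ModifiedRow (x ρ : ℕ) : Prop :=
  (∃ i < p.1.2, Complete r p i ∧ blockRow r p i = x ∧ blockVec r p i = ρ ∧
    ∀ i' < i, blockRow r p i' ≠ x) ∨
  ((∀ i < p.1.2, Complete r p i → blockRow r p i ≠ x) ∧ BaseRow r X code p x ρ)

open Classical in
/-- The distance of the column `j` from the product of the modified matrix with the vector
number `c`. -/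
noncomputable def mismatches (c j : ℕ) : ℕ :=
  ((Finset.range (rowCount X p)).filter fun x =>
    ¬ ∃ ρ < vecCount F r, ModifiedRow r X code p x ρ ∧ dotTable r code c ρ = entry X p x j).card

open Classical in
/-- The number of columns at distance at most `d` from the column space. -/
noncomputable def closeCount (d : ℕ) : ℕ :=
  ((Finset.range (colCount X p)).filter fun j =>
    ∃ c < vecCount F r, mismatches r X code p c j ≤ d).card

/-- The number whose binary expansion stands in front of the matrix. -/
noncomputable def outlierCount : ℕ :=
  Nat.rec (motive := fun _ => ℕ) 0 (fun i v => v + v +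
    ind (letter p (bitCount X p - 1 - i) = code (some (Sum.inr true)))) (bitCount X p)

/-- The input has the claimed format. -/
def Format : Prop :=
  p.1.1.length = bitCount X p + 1 + (rowCount X p * colCount X p + colCount X p) ∧
  (∀ i < bitCount X p, letter p i = code (some (Sum.inr true)) ∨
    letter p i = code (some (Sum.inr false))) ∧
  (bitCount X p = 0 ∨ letter p (bitCount X p - 1) = code (some (Sum.inr true))) ∧
  letter p (bitCount X p) = code none ∧
  ∀ j < colCount X p, entry X p (rowCount X p) j = code none ∧
    ∀ x < rowCount X p, ∃ a, entry X p x j = entryCode code a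

/-- The test that accepts a word. -/
def Accepts : Prop :=
  3 + r ≤ p.2.length ∧ Format X code p ∧
  ∑ d ∈ Finset.range (rowCount X p),
    (colCount X p - outlierCount X code p - closeCount r X code p d) ≤ p.1.2

end Tests

/-! ### The tests take polynomial time -/

section Computability

variable {X : Inst → ℕ} {code : Letter F → ℕ} {α : Type*} {Γ : Ctx α} {π : α → Inst × List ℕ}
  {f g h : α → ℕ}

section

variable (E : Extends X Γ π)
include E

theorem comp_bitCount : Comp Γ fun a => bitCount X (π a) := (E.word (.const _ 0)).min E.bnd

theorem comp_rowCount : Comp Γ fun a => rowCount X (π a) := (E.word (.const _ 1)).min E.bnd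

theorem comp_colCount : Comp Γ fun a => colCount X (π a) := (E.word (.const _ 2)).min E.bnd

theorem bitCount_le (a : α) : bitCount X (π a) ≤ Γ.bound a :=
  (min_le_right _ _).trans (E.bound a).ge

theorem rowCount_le (a : α) : rowCount X (π a) ≤ Γ.bound a :=
  (min_le_right _ _).trans (E.bound a).ge

theorem colCount_le (a : α) : colCount X (π a) ≤ Γ.bound a :=
  (min_le_right _ _).trans (E.bound a).ge

theorem comp_entry (hf : Comp Γ f) (hg : Comp Γ g) : Comp Γ fun a => entry X (π a) (f a) (g a) :=
  E.letter (((comp_bitCount E).add (.const _ 1)).add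
    ((((comp_rowCount E).mul (rowCount_le E) hg).add hg).add hf))

theorem comp_block (c : ℕ) (hf : Comp Γ f) :
    Comp Γ fun a => wordMem (π a).2 (3 + r + 4 * f a + c) :=
  E.word (((Comp.const _ (3 + r)).add (((hf.add hf).add (hf.add hf)).congr fun a => by omega)).add
    (.const _ c))

theorem comp_blockRow (hf : Comp Γ f) : Comp Γ fun a => blockRow r (π a) (f a) :=
  comp_block E 0 hf

theorem comp_blockVec (hf : Comp Γ f) : Comp Γ fun a => blockVec r (π a) (f a) :=
  comp_block E 1 hf

theorem comp_blockCls (hf : Comp Γ f) : Comp Γ fun a => blockCls r (π a) (f a) :=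
  comp_block E 2 hf

theorem comp_blockMask (hf : Comp Γ f) : Comp Γ fun a => blockMask r (π a) (f a) :=
  comp_block E 3 hf

theorem compP_complete (hf : Comp Γ f) : CompP Γ fun a => Complete r (π a) (f a) :=
  .le (((Comp.const _ (3 + r)).add (((hf.add hf).add (hf.add hf)).congr fun a => by omega)).add
    (.const _ 4)) E.wlen

omit [Field F] [Fintype F] in
theorem comp_outlierCount : Comp Γ fun a => outlierCount X code (π a) :=
  Comp.fold (body := fun a i v => v + v +
      ind (letter (π a) (bitCount X (π a) - 1 - i) = code (some (Sum.inr true))))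
    (comp_bitCount E) (bitCount_le E) (.const _ 0)
    (((Comp.top _).add (.top _)).add (CompP.eq (E.push.push.letter
      (((comp_bitCount E.push.push).sub (.const _ 1)).sub (Comp.top _).weaken)) (.const _ _)))

omit [Field F] in
theorem compP_format : CompP Γ fun a => Format X code (π a) :=
  (CompP.eq E.len (((comp_bitCount E).add (.const _ 1)).add
    (((comp_rowCount E).mul (rowCount_le E) (comp_colCount E)).add (comp_colCount E)))).and
  ((CompP.forall_lt (comp_bitCount E) (bitCount_le E)
    ((CompP.eq (E.push.letter (.top _)) (.const _ _)).or
      (CompP.eq (E.push.letter (.top _)) (.const _ _)))).and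
  (((CompP.eq (comp_bitCount E) (.const _ 0)).or
    (CompP.eq (E.letter ((comp_bitCount E).sub (.const _ 1))) (.const _ _))).and
  ((CompP.eq (E.letter (comp_bitCount E)) (.const _ _)).and
  (CompP.forall_lt (comp_colCount E) (colCount_le E)
    ((CompP.eq (comp_entry E.push (comp_rowCount E.push) (.top _)) (.const _ _)).and
    (CompP.forall_lt (comp_rowCount E.push) (rowCount_le E.push)
      (compP_isEntry code (comp_entry E.push.push (.top _) (Comp.top _).weaken))))))))

end

section

variable (hX : ∀ x, symBound F r x ≤ X x) (E : Extends X Γ π)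
include hX E

omit [Field F] [Fintype F] in
theorem vecCount_le (a : α) : vecCount F r ≤ Γ.bound a := by
  have := hX (π a).1
  have h0 : 0 < 2 ^ (π a).1.2 := by positivity
  rw [E.bound]
  simp only [symBound, sizeConst] at this
  omega

omit [Field F] [Fintype F] in
theorem const_le (a : α) : r ≤ Γ.bound a := by
  have := hX (π a).1
  have h0 : 0 < 2 ^ (π a).1.2 := by positivity
  rw [E.bound]
  simp only [symBound, sizeConst] at this
  omega

omit [Field F] [Fintype F] in
theorem param_le (a : α) : (π a).1.2 ≤ Γ.bound a := by
  have := hX (π a).1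
  have h0 : 0 < 2 ^ (π a).1.2 := by positivity
  rw [E.bound]
  simp only [symBound] at this
  omega

theorem compP_baseRow (hf : Comp Γ f) (hg : Comp Γ g) :
    CompP Γ fun a => BaseRow r X code (π a) (f a) (g a) :=
  CompP.forall_lt (.const _ r) (const_le hX E)
    (CompP.eq (comp_coordTable code hg.weaken (.top _))
      (comp_entry E.push hf.weaken (E.push.word ((Comp.const _ 3).add (.top _)))))

theorem compP_baseMismatch (hf : Comp Γ f) (hg : Comp Γ g) (hh : Comp Γ h) :
    CompP Γ fun a => BaseMismatch r X code (π a) (f a) (g a) (h a) :=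
  (CompP.exists_lt (.const _ _) (vecCount_le hX E)
    ((compP_baseRow hX E.push hh.weaken (.top _)).and
      (CompP.eq (comp_dotTable code hf.weaken (.top _))
        (comp_entry E.push hh.weaken hg.weaken)))).not

open Classical in
theorem compP_light (hf : Comp Γ f) (hg : Comp Γ g) :
    CompP Γ fun a => Light r X code (π a) (f a) (g a) :=
  CompP.le (CompP.card (comp_rowCount E) (rowCount_le E)
    (compP_baseMismatch hX E.push hf.weaken hg.weaken (.top _))) (E.par.add E.par)

omit [Field F] [Fintype F] in
-- Bits are read from the mask truncated at the bound. This changes nothing once the mask is below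
-- `2 ^ k`, as `symBound` contains `2 ^ k` as a summand.
theorem compP_usesSlot (hf : Comp Γ f) (hg : Comp Γ g) (hle : ∀ a, g a ≤ Γ.bound a) :
    CompP Γ fun a => UsesSlot r (π a) (f a) (g a) := by
  have hb : Comp Γ Γ.bound := E.bnd.congr fun a => (E.bound a).symm
  refine ((CompP.lt (comp_blockMask E hf) (E.par.two_pow (param_le hX E))).and
    (CompP.testBit hb ((comp_blockMask (r := r) E hf).min hb) (fun a => min_le_right _ _) hg
      hle)).congr fun a => and_congr_right fun hlt => ?_
  rw [min_eq_left]
  have := hX (π a).1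
  have h0 : 0 < 2 ^ (π a).1.2 := by positivity
  rw [E.bound]
  simp only [symBound] at this
  omega

theorem compP_fills {g : α → ℕ} (hf : Comp Γ f) (hg : Comp Γ g) (hle : ∀ a, g a ≤ Γ.bound a)
    (hh : Comp Γ h) : CompP Γ fun a => Fills r X code (π a) (f a) (g a) (h a) :=
  (compP_light hX E (comp_blockCls E hf) hh).and
  (CompP.forall_lt E.par (param_le hX E)
    ((compP_complete E.push (.top _)).imp
    ((CompP.eq (comp_blockCls E.push (.top _)) (comp_blockCls E.push hf.weaken)).imp
    ((compP_usesSlot hX E.push (.top _) hg.weaken fun a => hle a.1).imp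
    ((CompP.lt (comp_blockRow E.push (.top _)) (comp_rowCount E.push)).and
    (compP_baseMismatch hX E.push (comp_blockCls E.push hf.weaken) hh.weaken
      (comp_blockRow E.push (.top _))))))))

open Classical in
theorem compP_blockOk (hf : Comp Γ f) : CompP Γ fun a => BlockOk r X code (π a) (f a) := by
  have hb : Comp Γ Γ.bound := E.bnd.congr fun a => (E.bound a).symm
  refine ((CompP.lt (comp_blockVec E hf) (.const _ _)).and
    ((CompP.lt (comp_blockCls E hf) (.const _ _)).and
    (CompP.lt (comp_blockMask E hf) (E.par.two_pow (param_le hX E))))).and (.and ?_ ?_)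
  -- A test for slots needs an index that is bounded everywhere, not only in the range of the
  -- quantifier; the minimum provides this and has no effect within the range.
  · have hc := CompP.card (p := fun a l => UsesSlot r (π a) (f a) (min l (Γ.bound a)))
      E.par (param_le hX E)
      (compP_usesSlot hX E.push hf.weaken ((Comp.top _).min hb.weaken) fun a => min_le_right _ _)
    refine (CompP.le E.par ((hc.add hc).add (hc.add hc))).congr fun a => ?_
    rw [← two_mul, ← two_mul, ← mul_assoc]
    refine iff_of_eq (congrArg (fun s : Finset ℕ => (π a).1.2 ≤ 4 * s.card)
      (Finset.filter_congr fun l hl => ?_))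
    rw [min_eq_left ((Finset.mem_range.1 hl).le.trans (param_le hX E a))]
  · refine (CompP.forall_lt (p := fun a l => UsesSlot r (π a) (f a) (min l (Γ.bound a)) →
      ∃ j < colCount X (π a), Fills r X code (π a) (f a) (min l (Γ.bound a)) j) E.par
      (param_le hX E) ((compP_usesSlot hX E.push hf.weaken ((Comp.top _).min hb.weaken)
        fun a => min_le_right _ _).imp
      (CompP.exists_lt (comp_colCount E.push) (colCount_le E.push)
        (compP_fills hX E.push.push hf.weaken.weaken ((Comp.top _).min hb.weaken).weaken
          (fun a => min_le_right _ _) (.top _))))).congr fun a => ?_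
    refine forall₂_congr fun l hl => ?_
    rw [min_eq_left (hl.le.trans (param_le hX E a))]

theorem compP_admissible : CompP Γ fun a => Admissible r X code (π a) :=
  (CompP.le E.wlen ((((E.par.add E.par).add (E.par.add E.par)).congr
    (g := fun a => 4 * (π a).1.2) fun a => by omega).add (.const _ (3 + r)))).and
  (CompP.forall_lt E.par (param_le hX E)
    ((compP_complete E.push (.top _)).imp (compP_blockOk hX E.push (.top _))))

theorem compP_modifiedRow (hf : Comp Γ f) (hg : Comp Γ g) :
    CompP Γ fun a => ModifiedRow r X code (π a) (f a) (g a) := by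
  have hb : Comp Γ Γ.bound := E.bnd.congr fun a => (E.bound a).symm
  refine .or ?_ ((CompP.forall_lt E.par (param_le hX E) ((compP_complete E.push (.top _)).imp
    (CompP.eq (comp_blockRow E.push (.top _)) hf.weaken).not)).and (compP_baseRow hX E hf hg))
  refine (CompP.exists_lt (p := fun a i => Complete r (π a) i ∧ blockRow r (π a) i = f a ∧
    blockVec r (π a) i = g a ∧ ∀ i' < min i (Γ.bound a), blockRow r (π a) i' ≠ f a) E.par
    (param_le hX E) ((compP_complete E.push (.top _)).and
    ((CompP.eq (comp_blockRow E.push (.top _)) hf.weaken).and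
    ((CompP.eq (comp_blockVec E.push (.top _)) hg.weaken).and
    (CompP.forall_lt ((Comp.top _).min hb.weaken) (fun a => min_le_right _ _)
      (CompP.eq (comp_blockRow E.push.push (.top _)) hf.weaken.weaken).not))))).congr fun a => ?_
  refine exists_congr fun i => and_congr_right fun hi => ?_
  rw [min_eq_left (hi.le.trans (param_le hX E a))]

open Classical in
theorem comp_mismatches (hf : Comp Γ f) (hg : Comp Γ g) :
    Comp Γ fun a => mismatches r X code (π a) (f a) (g a) :=
  CompP.card (p := fun a x => ¬ ∃ ρ < vecCount F r, ModifiedRow r X code (π a) x ρ ∧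
      dotTable r code (f a) ρ = entry X (π a) x (g a)) (comp_rowCount E) (rowCount_le E)
    (CompP.exists_lt (.const _ _) (vecCount_le hX E.push)
      ((compP_modifiedRow hX E.push.push (Comp.top _).weaken (.top _)).and
      (CompP.eq (comp_dotTable code hf.weaken.weaken (.top _))
        (comp_entry E.push.push (Comp.top _).weaken hg.weaken.weaken)))).not

open Classical in
theorem comp_closeCount (hf : Comp Γ f) : Comp Γ fun a => closeCount r X code (π a) (f a) :=
  CompP.card (p := fun a j => ∃ c < vecCount F r, mismatches r X code (π a) c j ≤ f a)
    (comp_colCount E) (colCount_le E) (CompP.exists_lt (.const _ _) (vecCount_le hX E.push)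
      (CompP.le (comp_mismatches hX E.push.push (.top _) (Comp.top _).weaken) hf.weaken.weaken))

theorem compP_accepts : CompP Γ fun a => Accepts r X code (π a) :=
  (CompP.le (.const _ _) E.wlen).and ((compP_format E).and
    (CompP.le (Comp.sum (comp_rowCount E) (rowCount_le E)
      (((comp_colCount E.push).sub (comp_outlierCount E.push)).sub
        (comp_closeCount hX E.push (.top _)))) E.par))

end

end Computability

end RobustLRA

/-! ### The number of admissible words -/

namespace RobustLRA

open RAM

variable {F : Type*} [Field F] [Fintype F] {r : ℕ} {X : Inst → ℕ} {code : Letter F → ℕ}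

/-! ### Independence of the disagreement sets from the blocks -/

section Congr

variable {x : Inst} {l l' : List ℕ} (h : ∀ i < 3 + r, wordMem l i = wordMem l' i)
include h

theorem rowCount_congr : rowCount X (x, l) = rowCount X (x, l') := by
  simp only [rowCount, h 1 (by omega)]

theorem entry_congr (y j : ℕ) : entry X (x, l) y j = entry X (x, l') y j := by
  simp only [entry, rowCount, bitCount, h 0 (by omega), h 1 (by omega)]
  rfl

/-- The unmodified matrix is read off from the first `3 + r` cells. Hence the disagreement sets are
fixed before the blocks are guessed, as the potential argument requires. -/
theorem baseMismatch_congr (c j y : ℕ) :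
    BaseMismatch r X code (x, l) c j y ↔ BaseMismatch r X code (x, l') c j y := by
  refine not_congr (exists_congr fun ρ => and_congr_right fun _ => and_congr ?_ ?_)
  · refine forall₂_congr fun i hi => ?_
    rw [entry_congr h]
    simp only [h (3 + i) (by omega)]
  · rw [entry_congr h]

theorem light_congr (c j : ℕ) : Light r X code (x, l) c j ↔ Light r X code (x, l') c j := by
  classical
  simp only [Light, rowCount_congr h, baseMismatch_congr (code := code) (X := X) h]

end Congr

/-- Few words are admissible. -/
theorem visited_admissible_le (x : Inst) :
    visited (X x) (fun l => Admissible r X code (x, l)) (4 * x.2 + (3 + r)) [] ≤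
      (X x + 1) ^ (3 + r) * ((2 + X x + X x ^ 2 + X x ^ 3) *
        (vecCount F r * vecCount F r * 2 ^ x.2 * (x.2 + x.2) + 1) ^ x.2 *
          (X x + 1) ^ (4 * vecCount F r) + 1) := by
  classical
  refine visited_add_le _ _ _ _ _ _ fun l₀ hl₀ => ?_
  rw [List.append_nil]
  -- Columns that are not light get the empty set, so all sets have at most `2k` elements. The
  -- additional candidate `none`, also with the empty set, fills the slots that no block uses;
  -- `visited_blocks_le` requires a filler for these as well.
  let D : ℕ → Option (Fin (X x)) → Finset ℕ := fun c o => o.elim ∅ fun j =>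
    if Light r X code (x, l₀) c j then
      (Finset.range (rowCount X (x, l₀))).filter (BaseMismatch r X code (x, l₀) c j) else ∅
  have hD : ∀ c o, (D c o).card ≤ x.2 + x.2 := by
    intro c o
    cases o with
    | none => exact Nat.zero_le _
    | some j =>
      simp only [D, Option.elim_some]
      split_ifs with h
      · exact h
      · exact Nat.zero_le _
  have hcard : Fintype.card (Option (Fin (X x))) = X x + 1 := by simp
  rw [← hcard]
  refine visited_blocks_le hD (by rw [hcard]; omega) l₀ hl₀ fun v i y ρ c σ hv hi hok => ?_
  set l := σ :: c :: ρ :: y :: (v ++ l₀) with hl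
  have hlen : l.length = 3 + r + 4 * i + 4 := by
    simp only [hl, List.length_cons, List.length_append]
    omega
  have hlen' : (v ++ l₀).length = 3 + r + 4 * i := by rw [List.length_append]; omega
  have hcomp : ∀ i', Complete r (x, l) i' ↔ i' ≤ i := fun i' => by
    simp only [Complete, hlen]
    omega
  have hbase : ∀ i < 3 + r, wordMem l i = wordMem l₀ i := fun i hi => by
    have := wordMem_append (σ :: c :: ρ :: y :: v) l₀ (i := i) (by omega)
    simpa only [hl, List.cons_append] using this
  have hblk : ∀ i' ≤ i, BlockOk r X code (x, l) i' := fun i' hi' =>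
    hok.2 i' (hi'.trans_lt hi) ((hcomp i').2 hi')
  obtain ⟨⟨h1, h2, h3⟩, h4, -⟩ := hblk i le_rfl
  have e1 : blockVec r (x, l) i = ρ := by
    simp [blockVec, hl, wordMem_cons, hl₀, hv, add_comm (4 * i)]
  have e2 : blockCls r (x, l) i = c := by
    simp [blockCls, hl, wordMem_cons, hl₀, hv, add_comm (4 * i)]
  have e3 : blockMask r (x, l) i = σ := by
    simp [blockMask, hl, wordMem_cons, hl₀, hv, add_comm (4 * i)]
  rw [e1] at h1
  rw [e2] at h2
  rw [e3] at h3
  refine ⟨h1, h2, h3, ?_, fun c' hc' s hs => ?_⟩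
  · refine h4.trans (Nat.mul_le_mul_left 4 (Finset.card_le_card fun s hs => ?_))
    rw [Finset.mem_filter] at hs ⊢
    exact ⟨hs.1, e3 ▸ hs.2.2⟩
  · rw [← stepsOf_cons (3 + r) (v ++ l₀) i y ρ c σ hlen', ← hl]
    by_cases hex : ∃ i' ≤ i, blockCls r (x, l) i' = c' ∧ UsesSlot r (x, l) i' s
    · obtain ⟨i', hi', rfl, hu⟩ := hex
      obtain ⟨j, hj, hlight, hfill⟩ :=
        (hblk i' hi').2.2 s hs hu
      have hjX : j < X x := hj.trans_le (min_le_right _ _)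
      refine ⟨some ⟨j, hjX⟩, ?_⟩
      simp only [fillers, Finset.mem_filter, Finset.mem_univ, true_and]
      intro st hst hcls hbit
      obtain ⟨i'', hi'', rfl⟩ := mem_stepsOf.1 hst
      have hok'' := hblk i'' (Nat.lt_succ_iff.1 hi'')
      obtain ⟨hr, hm⟩ := hfill i'' (show i'' < x.2 from (Nat.lt_succ_iff.1 hi'').trans_lt hi) ((hcomp i'').2 (by omega)) hcls
        ⟨hok''.1.2.2, hbit⟩
      simp only [D, Option.elim_some]
      rw [if_pos ((light_congr hbase _ _).1 hlight), Finset.mem_filter, Finset.mem_range,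
        ← rowCount_congr hbase, ← baseMismatch_congr hbase]
      exact ⟨hr, hm⟩
    · refine ⟨none, ?_⟩
      simp only [fillers, Finset.mem_filter, Finset.mem_univ, true_and]
      intro st hst hcls hbit
      obtain ⟨i'', hi'', rfl⟩ := mem_stepsOf.1 hst
      have hok'' := hblk i'' (Nat.lt_succ_iff.1 hi'')
      exact absurd ⟨i'', by omega, hcls, hok''.1.2.2, hbit⟩ hex

end RobustLRA

/-! ### The format of the input -/

namespace RobustLRA

open RAM

theorem length_flatten_ofFn {β : Type*} {s n : ℕ} (g : Fin n → List β) (hg : ∀ j, (g j).length = s) :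
    (List.ofFn g).flatten.length = s * n := by
  rw [List.length_flatten, List.map_ofFn, List.sum_ofFn]
  simp [hg, mul_comm]

theorem getElem?_flatten_ofFn {β : Type*} {s n : ℕ} (g : Fin n → List β)
    (hg : ∀ j, (g j).length = s) (j : Fin n) {x : ℕ} (hx : x < s) :
    (List.ofFn g).flatten[s * j + x]? = (g j)[x]? := by
  induction n with
  | zero => exact j.elim0
  | succ n ih =>
    rw [List.ofFn_succ, List.flatten_cons]
    cases j using Fin.cases with
    | zero => rw [List.getElem?_append_left (by simpa [hg] using hx)]; simp
    | succ j =>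
      rw [List.getElem?_append_right (by rw [hg, Fin.val_succ]; nlinarith), hg]
      have h1 := ih (fun j => g j.succ) (fun j => hg _) j
      rw [← h1]
      congr 1
      rw [Fin.val_succ, mul_add, mul_one]
      omega

/-- The number with a given binary expansion. -/
def bitsValue (bs : List Bool) : ℕ := bs.foldr Nat.bit 0

theorem bitsValue_bits (n : ℕ) : bitsValue n.bits = n := by
  induction n using Nat.binaryRec' with
  | zero => rfl
  | bit b n h ih => rw [Nat.bits_append_bit n b h, bitsValue, List.foldr_cons]; exact congrArg _ ih

/-- A list of bits is the expansion of its value only if it has no leading zeros. This is why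
`Format` asks for the highest bit to be `1`. -/
theorem bits_bitsValue (bs : List Bool) (h : ∀ b ∈ bs.getLast?, b = true) :
    (bitsValue bs).bits = bs := by
  induction bs with
  | nil => rfl
  | cons b bs ih =>
    rw [bitsValue, List.foldr_cons]
    cases bs with
    | nil =>
      obtain rfl : b = true := h b (by simp)
      rfl
    | cons b' bs =>
      have h1 := ih (by simpa using h)
      rw [Nat.bits_append_bit]
      · exact congrArg (List.cons b) h1
      · intro h0
        rw [show bitsValue (b' :: bs) = 0 from h0] at h1
        simp at h1

theorem getLast?_bits (n : ℕ) : ∀ b ∈ n.bits.getLast?, b = true := by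
  induction n using Nat.binaryRec' with
  | zero => simp
  | bit b n h ih =>
    rw [Nat.bits_append_bit n b h]
    cases hn : n.bits with
    | nil =>
      have h0 : n = 0 := by rw [← bitsValue_bits n, hn]; rfl
      simp [h h0]
    | cons b' bs =>
      rw [hn] at ih
      simpa using ih

/-- Horner's rule from the highest bit downwards: after `i` steps the last `i` bits of the list have
been read. -/
theorem rec_eq_bitsValue (bs : List Bool) {c : ℕ → Prop}
    (hc : ∀ i b, bs[i]? = some b → (c i ↔ b = true)) :
    Nat.rec (motive := fun _ => ℕ) 0 (fun i v => v + v + ind (c (bs.length - 1 - i))) bs.length =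
      bitsValue bs := by
  have key : ∀ i ≤ bs.length,
      Nat.rec (motive := fun _ => ℕ) 0 (fun i v => v + v + ind (c (bs.length - 1 - i))) i =
        bitsValue (bs.drop (bs.length - i)) := by
    intro i
    induction i with
    | zero => intro _; simp [bitsValue]
    | succ i ih =>
      intro hi
      have hlt : bs.length - 1 - i < bs.length := by omega
      have h1 : bs.drop (bs.length - (i + 1)) = bs[bs.length - 1 - i] :: bs.drop (bs.length - i) := by
        rw [show bs.length - (i + 1) = bs.length - 1 - i by omega, List.drop_eq_getElem_cons hlt]
        congr 2
        omega
      have h2 := hc (bs.length - 1 - i) _ (List.getElem?_eq_getElem hlt)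
      rw [h1, bitsValue, List.foldr_cons]
      refine (congrArg (fun v => v + v + ind (c (bs.length - 1 - i))) (ih (by omega))).trans ?_
      rw [Nat.bit_val, ← bitsValue, two_mul]
      cases hb : bs[bs.length - 1 - i]
      · rw [ind_of_not (by rw [h2, hb]; simp)]; rfl
      · rw [ind_of (h2.2 hb)]; rfl
  simpa using key bs.length le_rfl

variable {F : Type*} [Field F] {X : Inst → ℕ} {code : Letter F → ℕ}

section Encode

variable {m n : ℕ} (A : Matrix (Fin m) (Fin n) F) (ℓ : ℕ)

omit [Field F] in
theorem length_encode : (encode A ℓ).length = ℓ.bits.length + 1 + (m + 1) * n := by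
  rw [encode, List.length_append, length_flatten_ofFn (s := m + 1) _ (by simp)]
  simp

omit [Field F] in
theorem encode_bits {i : ℕ} {b : Bool} (h : ℓ.bits[i]? = some b) :
    (encode A ℓ)[i]? = some (some (Sum.inr b)) := by
  have hi := (List.getElem?_eq_some_iff.1 h).1
  rw [encode, List.getElem?_append_left (by simp; omega), List.getElem?_append_left (by simpa using hi)]
  simp [h]

omit [Field F] in
theorem encode_separator : (encode A ℓ)[ℓ.bits.length]? = some none := by
  rw [encode, List.getElem?_append_left (by simp), List.getElem?_append_right (by simp)]
  simp

omit [Field F] in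
theorem encode_column (j : Fin n) {x : ℕ} (hx : x < m + 1) :
    (encode A ℓ)[ℓ.bits.length + 1 + ((m + 1) * j + x)]? =
      (List.ofFn (fun i : Fin m => some (Sum.inl (A i j))) ++ [none] : List (Letter F))[x]? := by
  rw [encode, List.getElem?_append_right (by simp)]
  rw [← getElem?_flatten_ofFn (s := m + 1) (fun j : Fin n =>
    (List.ofFn (fun i : Fin m => some (Sum.inl (A i j))) ++ [none] : List (Letter F))) (by simp) j hx]
  congr 1
  simp

omit [Field F] in
theorem encode_entry (x : Fin m) (j : Fin n) :
    (encode A ℓ)[ℓ.bits.length + 1 + ((m + 1) * j + x)]? = some (some (Sum.inl (A x j))) := by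
  rw [encode_column A ℓ j (by omega), List.getElem?_append_left (by simp)]
  simp

omit [Field F] in
theorem encode_column_end (j : Fin n) :
    (encode A ℓ)[ℓ.bits.length + 1 + ((m + 1) * j + m)]? = some none := by
  rw [encode_column A ℓ j (by omega), List.getElem?_append_right (by simp)]
  simp

end Encode

omit [Field F] in
theorem letter_of_getElem? {w : List (Letter F)} {k i : ℕ} {l : List ℕ} {a : Letter F}
    (h : w[i]? = some a) : letter ((w.map code, k), l) i = code a := by
  simp [letter, List.getD_eq_getElem?_getD, h]

/-- The word `l` describes the instance `(A, ℓ)` in the input word. -/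
structure Describes (X : Inst → ℕ) (code : Letter F → ℕ) (p : Inst × List ℕ) {m n : ℕ}
    (A : Matrix (Fin m) (Fin n) F) (ℓ : ℕ) : Prop where
  rowCount : rowCount X p = m
  colCount : colCount X p = n
  entry : ∀ (x : Fin m) (j : Fin n), entry X p x j = entryCode code (A x j)
  outlierCount : outlierCount X code p = ℓ

omit [Field F] in
theorem describes_encode (hcode : Function.Injective code) {m n : ℕ}
    (A : Matrix (Fin m) (Fin n) F) (ℓ k : ℕ) (l : List ℕ)
    (h0 : bitCount X (((encode A ℓ).map code, k), l) = ℓ.bits.length)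
    (h1 : rowCount X (((encode A ℓ).map code, k), l) = m)
    (h2 : colCount X (((encode A ℓ).map code, k), l) = n) :
    Describes X code (((encode A ℓ).map code, k), l) A ℓ ∧
      Format X code (((encode A ℓ).map code, k), l) := by
  have hbits : ∀ i b, ℓ.bits[i]? = some b →
      letter (((encode A ℓ).map code, k), l) i = code (some (Sum.inr b)) :=
    fun i b h => letter_of_getElem? (encode_bits A ℓ h)
  have hindex : ∀ j x, m * j + j + x = (m + 1) * j + x := fun j x => by ring
  refine ⟨⟨h1, h2, fun x j => ?_, ?_⟩, ?_, fun i hi => ?_, ?_, ?_, fun j hj => ⟨?_, fun x hx => ?_⟩⟩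
  · rw [entry, h0, h1, hindex]
    exact letter_of_getElem? (encode_entry A ℓ x j)
  · rw [outlierCount, h0]
    refine (rec_eq_bitsValue ℓ.bits (c := fun i => letter (((encode A ℓ).map code, k), l) i =
      code (some (Sum.inr true))) fun i b hb => ?_).trans (bitsValue_bits ℓ)
    rw [hbits i b hb, hcode.eq_iff]
    simp
  · rw [h0, h1, h2]
    simp only [List.length_map, length_encode]
    ring
  · rw [h0] at hi
    rw [hbits i _ (List.getElem?_eq_getElem hi)]
    cases ℓ.bits[i] <;> simp
  · rw [h0]
    rcases Nat.eq_zero_or_pos ℓ.bits.length with h | h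
    · exact Or.inl h
    · right
      rw [hbits _ _ (List.getElem?_eq_getElem (by omega))]
      congr
      refine getLast?_bits ℓ _ ?_
      rw [List.getLast?_eq_getElem?, Option.mem_def]
      exact List.getElem?_eq_getElem (by omega)
  · rw [h0]
    exact letter_of_getElem? (encode_separator A ℓ)
  · rw [h2] at hj
    rw [entry, h0, h1, hindex]
    exact letter_of_getElem? (encode_column_end A ℓ ⟨j, hj⟩)
  · rw [h1] at hx
    rw [h2] at hj
    rw [entry, h0, h1, hindex]
    exact ⟨A ⟨x, hx⟩ ⟨j, hj⟩, letter_of_getElem? (encode_entry A ℓ ⟨x, hx⟩ ⟨j, hj⟩)⟩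

omit [Field F] in
-- The format fixes the role of each position, and the canonical form of the bits makes `ℓ`
-- re-encode to the given prefix. The word is then compared with the encoding position by position.
theorem exists_describes (hcode : Function.Injective code) {w : List (Letter F)} {k : ℕ}
    {l : List ℕ} (h : Format X code ((w.map code, k), l)) :
    ∃ (m n : ℕ) (A : Matrix (Fin m) (Fin n) F) (ℓ : ℕ), w = encode A ℓ ∧
      Describes X code ((w.map code, k), l) A ℓ := by
  classical
  obtain ⟨hlen, hbit, hlast, hsep, hcol⟩ := h
  set p : Inst × List ℕ := ((w.map code, k), l) with hp
  set N := bitCount X p with hN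
  set m := rowCount X p with hm
  set n := colCount X p with hn
  have hA : ∀ (x : Fin m) (j : Fin n), ∃ a, entry X p x j = entryCode code a := fun x j =>
    (hcol j j.2).2 x x.2
  obtain ⟨A, hA⟩ : ∃ A : Matrix (Fin m) (Fin n) F, ∀ (x : Fin m) (j : Fin n),
      entry X p x j = entryCode code (A x j) := by
    choose A hA using hA
    exact ⟨Matrix.of A, hA⟩
  let bs : List Bool := List.ofFn fun i : Fin N => decide (letter p i = code (some (Sum.inr true)))
  have hbs : bs.length = N := by simp [bs]
  have hbsi : ∀ i b, bs[i]? = some b → letter p i = code (some (Sum.inr b)) := by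
    intro i b h
    obtain ⟨hi, rfl⟩ := List.getElem?_eq_some_iff.1 h
    rw [hbs] at hi
    simp only [bs, List.getElem_ofFn]
    by_cases ht : letter p i = code (some (Sum.inr true))
    · simp [ht]
    · simp only [ht, decide_false]
      exact (hbit i hi).resolve_left ht
  have hbits : (bitsValue bs).bits = bs := by
    refine bits_bitsValue bs fun b hb => ?_
    rw [List.getLast?_eq_getElem?, Option.mem_def] at hb
    have h1 := hbsi _ _ hb
    rw [hbs] at h1 hb
    have hpos : 0 < N := by
      have := (List.getElem?_eq_some_iff.1 hb).1
      omega
    rw [hlast.resolve_left hpos.ne', hcode.eq_iff] at h1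
    simpa using h1.symm
  refine ⟨m, n, A, bitsValue bs, ?_, hm.symm, hn.symm, fun x j => hA x j, ?_⟩
  · refine hcode.list_map (List.ext_getElem? fun i => ?_)
    have hL : (encode A (bitsValue bs)).length = w.length := by
      rw [length_encode, hbits, hbs]
      simp only [hp, List.length_map] at hlen
      rw [hlen]
      ring
    by_cases hi : i < w.length
    · have h1 : ((w.map code)[i]?) = some (letter p i) := by
        simp [hp, letter, hi]
      rw [h1]
      have key : ∀ a, (encode A (bitsValue bs))[i]? = some a → letter p i = code a →
          some (letter p i) = ((encode A (bitsValue bs)).map code)[i]? := fun a h h' => by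
        rw [List.getElem?_map, h, h']; rfl
      rcases lt_trichotomy i N with hiN | rfl | hiN
      · have hb := List.getElem?_eq_getElem (l := bs) (i := i) (by omega)
        exact key _ (encode_bits A _ (by rw [hbits]; exact hb)) (hbsi i _ hb)
      · refine key none ?_ hsep
        have := encode_separator A (bitsValue bs)
        rwa [hbits, hbs] at this
      -- Beyond the first separator, division by `m + 1` gives the column and the row; the remainder
      -- `m` is the separator at the end of a column.
      · obtain ⟨q, rfl⟩ : ∃ q, i = N + 1 + q := ⟨i - (N + 1), by omega⟩
        have hq : q < (m + 1) * n := by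
          rw [← hL, length_encode, hbits, hbs] at hi
          omega
        have hj : q / (m + 1) < n := Nat.div_lt_of_lt_mul hq
        have hdm := Nat.div_add_mod q (m + 1)
        have hx : q % (m + 1) < m + 1 := Nat.mod_lt _ (by omega)
        have hent : letter p (N + 1 + q) = entry X p (q % (m + 1)) (q / (m + 1)) := by
          rw [entry, ← hN, ← hm]
          congr 2
          rw [← hdm, Nat.mul_add_mod, Nat.mod_mod, Nat.mul_add_div (by omega), Nat.mod_div_self]
          ring
        rcases Nat.lt_succ_iff_lt_or_eq.1 hx with hx | hx
        · refine key (some (Sum.inl (A ⟨_, hx⟩ ⟨_, hj⟩))) ?_ (hent.trans (hA ⟨_, hx⟩ ⟨_, hj⟩))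
          have := encode_entry A (bitsValue bs) ⟨_, hx⟩ ⟨_, hj⟩
          rwa [hbits, hbs, hdm] at this
        · refine key none ?_ ?_
          · have := encode_column_end A (bitsValue bs) ⟨_, hj⟩
            rw [hx] at hdm
            rwa [hbits, hbs, hdm] at this
          · rw [hent, hx]
            exact (hcol _ hj).1
    · rw [List.getElem?_eq_none (by simpa using hi), List.getElem?_eq_none]
      rw [List.length_map, hL]
      omega
  · rw [outlierCount, ← hN, ← hbs]
    refine rec_eq_bitsValue bs (c := fun i => letter p i = code (some (Sum.inr true))) fun i b hb => ?_
    rw [hbsi i b hb, hcode.eq_iff]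
    simp

end RobustLRA

/-! ### Correctness of the search -/

namespace RobustLRA

open RAM

theorem card_filter_range (n : ℕ) (P : ℕ → Prop) [DecidablePred P] :
    ((Finset.range n).filter P).card = (Finset.univ.filter fun i : Fin n => P i).card := by
  rw [Finset.card_filter, Finset.card_filter, Finset.sum_range]

variable {F : Type*} [Field F] [Fintype F] {r : ℕ} {X : Inst → ℕ} {code : Letter F → ℕ}

omit [Field F] [Fintype F] in
theorem entryCode_inj (hcode : Function.Injective code) {a b : F} :
    entryCode code a = entryCode code b ↔ a = b := by
  rw [entryCode, entryCode, hcode.eq_iff, Option.some_inj, Sum.inl.injEq]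

/-! ### The tests under a correct description, and soundness -/

section

variable {p : Inst × List ℕ} {m n ℓ : ℕ} {A : Matrix (Fin m) (Fin n) F}

open Classical in
-- For a fixed modified matrix the columns are independent, so each one may take a coefficient
-- vector of least distance. The rest is `exists_card_sum_le_iff`.
theorem level_sum_le_iff (hd : Describes X code p A ℓ) (B : ℕ) :
    ∑ d ∈ Finset.range (rowCount X p),
      (colCount X p - outlierCount X code p - closeCount r X code p d) ≤ B ↔
    ∃ (K : Finset (Fin n)) (c : Fin n → ℕ), n - ℓ ≤ K.card ∧ (∀ j, c j < vecCount F r) ∧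
      ∑ j ∈ K, mismatches r X code p (c j) j ≤ B := by
  have hmin : ∀ j : Fin n, ∃ c < vecCount F r, ∀ c' < vecCount F r,
      mismatches r X code p c j ≤ mismatches r X code p c' j := by
    intro j
    obtain ⟨c, hc, h⟩ := Finset.exists_min_image (Finset.range (vecCount F r))
      (fun c => mismatches r X code p c j) ⟨0, Finset.mem_range.2 vecCount_pos⟩
    exact ⟨c, Finset.mem_range.1 hc, fun c' hc' => h c' (Finset.mem_range.2 hc')⟩
  choose c hc hmin using hmin
  have hclose : ∀ d, closeCount r X code p d =
      (Finset.univ.filter fun j => mismatches r X code p (c j) j ≤ d).card := by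
    intro d
    rw [closeCount, hd.colCount, card_filter_range]
    congr 1
    refine Finset.filter_congr fun j _ => ⟨?_, fun h => ⟨c j, hc j, h⟩⟩
    rintro ⟨c', hc', h⟩
    exact (hmin j c' hc').trans h
  have hiff := exists_card_sum_le_iff (fun j => mismatches r X code p (c j) j) (N := n - ℓ) (m := m)
    (B := B) (by simp) (fun j => by
      rw [mismatches, hd.rowCount]
      exact (Finset.card_filter_le _ _).trans_eq (Finset.card_range m))
  rw [hd.rowCount, hd.colCount, hd.outlierCount]
  simp only [hclose]
  rw [← hiff]
  constructor
  · rintro ⟨K, hK, hsum⟩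
    exact ⟨K, c, hK, hc, hsum⟩
  · rintro ⟨K, c', hK, hc', hsum⟩
    exact ⟨K, hK, (Finset.sum_le_sum fun j _ => hmin j _ (hc' j)).trans hsum⟩

theorem coordTable_of_lt {ρ : ℕ} (hρ : ρ < vecCount F r) (i : Fin r) :
    coordTable r code ρ i = entryCode code ((vec ρ : Fin r → F) i) := by
  rw [coordTable, dif_pos ⟨hρ, i.2⟩]

theorem BaseRow.unique (hcode : Function.Injective code) {x ρ ρ' : ℕ} (hρ : ρ < vecCount F r)
    (hρ' : ρ' < vecCount F r) (h : BaseRow r X code p x ρ) (h' : BaseRow r X code p x ρ') :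
    ρ = ρ' := by
  rw [← vecNum_vec hρ, ← vecNum_vec hρ']
  congr 1
  funext i
  rw [← entryCode_inj hcode, ← coordTable_of_lt hρ i, ← coordTable_of_lt hρ' i, h i i.2, h' i i.2]

/-- The first block that names a row decides, so repeated or contradictory blocks still describe a
single matrix. -/
theorem ModifiedRow.unique (hcode : Function.Injective code) {x ρ ρ' : ℕ} (hρ : ρ < vecCount F r)
    (hρ' : ρ' < vecCount F r) (h : ModifiedRow r X code p x ρ)
    (h' : ModifiedRow r X code p x ρ') : ρ = ρ' := by
  rcases h with ⟨i, hi, hic, hix, rfl, hmin⟩ | ⟨hno, hb⟩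
  · rcases h' with ⟨i', hi', hic', hix', rfl, hmin'⟩ | ⟨hno', -⟩
    · rcases lt_trichotomy i i' with hlt | rfl | hlt
      · exact absurd hix (hmin' i hlt)
      · rfl
      · exact absurd hix' (hmin i' hlt)
    · exact absurd hix (hno' i hi hic)
  · rcases h' with ⟨i', hi', hic', hix', rfl, hmin'⟩ | ⟨-, hb'⟩
    · exact absurd hix' (hno i' hi' hic')
    · exact hb.unique hcode hρ hρ' hb'

/-- What the search accepts is a yes-instance. -/
theorem isYes_of_describes (hcode : Function.Injective code) (hd : Describes X code p A ℓ) {B : ℕ}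
    (h : ∑ d ∈ Finset.range (rowCount X p),
      (colCount X p - outlierCount X code p - closeCount r X code p d) ≤ B) :
    IsYes A r B ℓ := by
  classical
  obtain ⟨K, c, hK, hc, hsum⟩ := (level_sum_le_iff hd B).1 h
  -- A row without a valid description is counted as an error in every column by `mismatches`, so
  -- the default `0` does no harm.
  let G : Fin m → Fin r → F := fun x =>
    if h : ∃ ρ < vecCount F r, ModifiedRow r X code p x ρ then vec h.choose else 0
  refine isYes_of_rows G (fun j => vec (c j)) K hK (le_trans (Finset.sum_le_sum fun j _ => ?_) hsum)
  rw [mismatches, hd.rowCount, card_filter_range]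
  refine Finset.card_le_card fun x hx => ?_
  simp only [Finset.mem_filter, Finset.mem_univ, true_and] at hx ⊢
  rintro ⟨ρ, hρ, hmod, hdot⟩
  refine hx ?_
  have hex : ∃ ρ < vecCount F r, ModifiedRow r X code p x ρ := ⟨ρ, hρ, hmod⟩
  have hG : G x = vec ρ := by
    simp only [G, dif_pos hex]
    exact congrArg vec (hex.choose_spec.2.unique hcode hex.choose_spec.1 hρ hmod)
  rw [hd.entry, dotTable, if_pos ⟨hρ, hc j⟩, entryCode_inj hcode] at hdot
  rw [hG, hdot]

variable {J : Fin r → Fin n}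

theorem baseRow_iff (hcode : Function.Injective code) (hd : Describes X code p A ℓ)
    (hJ : ∀ i : Fin r, wordMem p.2 (3 + i) = J i) {ρ : ℕ} (hρ : ρ < vecCount F r) (x : Fin m) :
    BaseRow r X code p x ρ ↔ vec ρ = fun i => A x (J i) := by
  rw [funext_iff]
  constructor
  · intro h i
    rw [← entryCode_inj hcode, ← coordTable_of_lt hρ i, h i i.2, hJ i, hd.entry]
  · intro h i hi
    have := coordTable_of_lt (code := code) hρ ⟨i, hi⟩
    rw [hJ ⟨i, hi⟩, hd.entry, this, h ⟨i, hi⟩]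

theorem dotTable_vecNum (ρ : ℕ) (hρ : ρ < vecCount F r) (c : Fin r → F) :
    dotTable r code (vecNum c) ρ = entryCode code (vec ρ ⬝ᵥ c) := by
  rw [dotTable, if_pos ⟨hρ, vecNum_lt c⟩, vec_vecNum]

theorem baseMismatch_iff (hcode : Function.Injective code) (hd : Describes X code p A ℓ)
    (hJ : ∀ i : Fin r, wordMem p.2 (3 + i) = J i) (c : Fin r → F) (j : Fin n) (x : Fin m) :
    BaseMismatch r X code p (vecNum c) j x ↔ (fun i => A x (J i)) ⬝ᵥ c ≠ A x j := by
  refine not_congr ⟨?_, fun h => ⟨vecNum fun i => A x (J i), vecNum_lt _, ?_, ?_⟩⟩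
  · rintro ⟨ρ, hρ, hb, hdot⟩
    rw [dotTable_vecNum ρ hρ, hd.entry, entryCode_inj hcode,
      (baseRow_iff hcode hd hJ hρ x).1 hb] at hdot
    exact hdot
  · rw [baseRow_iff hcode hd hJ (vecNum_lt _), vec_vecNum]
  · rw [dotTable_vecNum _ (vecNum_lt _), vec_vecNum, hd.entry, h]

end

/-- The search tests every nonempty prefix of the word, not only the whole word. -/
theorem valid_reverse {M : ℕ} {ok : List ℕ → Prop} {u : List ℕ} (hM : ∀ a ∈ u, a < M)
    (hok : ∀ s ≤ u.length, ok (u.take s).reverse) : Valid M ok u.reverse := by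
  induction u using List.reverseRecOn with
  | nil => exact .nil
  | append_singleton u a ih =>
    have h := hok (u ++ [a]).length le_rfl
    rw [List.take_length] at h
    rw [List.reverse_append, List.reverse_singleton, List.singleton_append] at h ⊢
    refine .cons (hM a (by simp)) h (ih (fun b hb => hM b (by simp [hb])) fun s hs => ?_)
    have := hok s (by rw [List.length_append]; omega)
    rwa [List.take_append_of_le_length hs] at this

theorem wordMem_take {u : List ℕ} {s i : ℕ} (h : i < s) :
    wordMem (u.take s).reverse i = u.getD i 0 := by
  rw [wordMem, List.reverse_reverse, List.getD_eq_getElem?_getD, List.getD_eq_getElem?_getD,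
    List.getElem?_take_of_lt h]

/-- The word for some columns and modifications of rows. -/
def searchWord (b m n : ℕ) (J : Fin r → ℕ) {t : ℕ} (g : Fin t → Fin 4 → ℕ) : List ℕ :=
  [b, m, n] ++ (List.ofFn J ++ (List.ofFn fun i => List.ofFn (g i)).flatten)

/-! ### Reading the word of a solution -/

section SearchWord

variable {b m n t : ℕ} {J : Fin r → ℕ} {g : Fin t → Fin 4 → ℕ}

theorem length_searchWord : (searchWord b m n J g).length = 3 + r + 4 * t := by
  rw [searchWord, List.length_append, List.length_append,
    length_flatten_ofFn (s := 4) _ (by simp)]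
  simp
  omega

theorem searchWord_col (i : Fin r) : (searchWord b m n J g).getD (3 + i) 0 = J i := by
  rw [searchWord, List.getD_append_right _ _ _ _ (by simp)]
  rw [List.getD_append _ _ _ _ (by simp)]
  simp

theorem searchWord_block (i : Fin t) (c : Fin 4) :
    (searchWord b m n J g).getD (3 + r + 4 * i + c) 0 = g i c := by
  rw [searchWord, List.getD_append_right _ _ _ _ (by simp; omega),
    List.getD_append_right _ _ _ _ (by simp; omega), List.getD_eq_getElem?_getD]
  have h := getElem?_flatten_ofFn (s := 4) (fun i => List.ofFn (g i)) (by simp) i c.2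
  have e : 3 + r + 4 * (i : ℕ) + c - [b, m, n].length - (List.ofFn J).length = 4 * i + c := by
    simp
    omega
  rw [e, h, List.getElem?_eq_getElem (by simp), Option.getD_some, List.getElem_ofFn]

theorem lt_of_mem_searchWord {M : ℕ} (hb : b < M) (hm : m < M) (hn : n < M) (hJ : ∀ i, J i < M)
    (hg : ∀ i c, g i c < M) : ∀ a ∈ searchWord b m n J g, a < M := by
  intro a ha
  simp only [searchWord, List.mem_append, List.mem_cons, List.not_mem_nil, or_false,
    List.mem_ofFn, List.mem_flatten] at ha
  rcases ha with (rfl | rfl | rfl) | ⟨i, rfl⟩ | ⟨_, ⟨i, rfl⟩, h⟩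
  · exact hb
  · exact hm
  · exact hn
  · exact hJ i
  · obtain ⟨c, rfl⟩ := List.mem_ofFn.1 h
    exact hg i c

end SearchWord

/-! ### Yes-instances are found by the search -/

section Completeness

variable {m n ℓ k : ℕ} {A : Matrix (Fin m) (Fin n) F}

theorem getD_searchWord {b : ℕ} {J : Fin r → ℕ} {t : ℕ} {g : Fin t → Fin 4 → ℕ} :
    (searchWord b m n J g).getD 0 0 = b ∧ (searchWord b m n J g).getD 1 0 = m ∧
      (searchWord b m n J g).getD 2 0 = n := ⟨rfl, rfl, rfl⟩

omit [Field F] [Fintype F] in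
theorem describes_take (hcode : Function.Injective code)
    (hX : ∀ x, symBound F r x ≤ X x) (hm : m ≤ (encode A ℓ).length) {J : Fin r → ℕ} {t : ℕ}
    {g : Fin t → Fin 4 → ℕ} {s : ℕ} (hs : 3 ≤ s) :
    Describes X code (((encode A ℓ).map code, k),
        ((searchWord ℓ.bits.length m n J g).take s).reverse) A ℓ ∧
      Format X code (((encode A ℓ).map code, k),
        ((searchWord ℓ.bits.length m n J g).take s).reverse) := by
  have hx := hX ((encode A ℓ).map code, k)
  have hlen := length_encode A ℓ
  have hn : n ≤ (m + 1) * n := Nat.le_mul_of_pos_left n (by omega)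
  simp only [symBound, List.length_map] at hx
  have hle : (encode A ℓ).length ≤ X ((encode A ℓ).map code, k) := by
    rw [add_assoc, add_assoc] at hx
    exact (Nat.le_add_right _ _).trans hx
  obtain ⟨e0, e1, e2⟩ := getD_searchWord (b := ℓ.bits.length) (m := m) (n := n) (J := J) (g := g)
  refine describes_encode hcode A ℓ k _ ?_ ?_ ?_
  · rw [bitCount, wordMem_take (by omega), e0]
    exact min_eq_left (le_trans (by omega) hle)
  · rw [rowCount, wordMem_take (by omega), e1]
    exact min_eq_left (hm.trans hle)
  · rw [colCount, wordMem_take (by omega), e2]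
    exact min_eq_left (le_trans (by omega) hle)

theorem exists_valid_accepts (hcode : Function.Injective code)
    (hX : ∀ x, symBound F r x ≤ X x) (hm : m ≤ (encode A ℓ).length) {J : Fin r → ℕ} {t : ℕ}
    {g : Fin t → Fin 4 → ℕ} (ht : t ≤ k) (hJ : ∀ i, J i ≤ (encode A ℓ).length)
    (hg : ∀ i c, g i c < symBound F r ((encode A ℓ).map code, k))
    (hblock : ∀ (s : ℕ) (i : Fin t), 3 + r + 4 * (i : ℕ) + 4 ≤ s →
      BlockOk r X code (((encode A ℓ).map code, k),
        ((searchWord ℓ.bits.length m n J g).take s).reverse) i)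
    (hacc : ∑ d ∈ Finset.range m, (n - ℓ - closeCount r X code (((encode A ℓ).map code, k),
        (searchWord ℓ.bits.length m n J g).reverse) d) ≤ k) :
    ∃ l, Valid (X ((encode A ℓ).map code, k))
        (fun l => Admissible r X code (((encode A ℓ).map code, k), l)) l ∧
      Accepts r X code (((encode A ℓ).map code, k), l) := by
  have hx := hX ((encode A ℓ).map code, k)
  have hlen := length_encode A ℓ
  have hn : n ≤ (m + 1) * n := Nat.le_mul_of_pos_left n (by omega)
  have hlt : (encode A ℓ).length < X ((encode A ℓ).map code, k) := by
    refine lt_of_lt_of_le ?_ hx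
    simp only [symBound, sizeConst, List.length_map]
    have : 0 < 2 ^ k := by positivity
    omega
  have hword := length_searchWord (b := ℓ.bits.length) (m := m) (n := n) (J := J) (g := g)
  refine ⟨_, valid_reverse (u := searchWord ℓ.bits.length m n J g)
    (lt_of_mem_searchWord (by omega) (by omega) (by omega) (fun i => (hJ i).trans_lt hlt)
      fun i c => (hg i c).trans_le hx) fun s hs => ⟨?_, fun i hi hc => ?_⟩, ?_, ?_⟩
  · rw [List.length_reverse, List.length_take]
    dsimp only
    omega
  · rw [Complete, List.length_reverse, List.length_take] at hc
    exact hblock s ⟨i, by omega⟩ (by dsimp only; omega)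
  · rw [List.length_reverse]
    omega
  · have h := describes_take (k := k) (J := J) (g := g) hcode hX hm
      (s := (searchWord ℓ.bits.length m n J g).length) (by omega)
    rw [List.take_length] at h
    refine ⟨h.2, ?_⟩
    rw [h.1.rowCount, h.1.colCount, h.1.outlierCount]
    exact hacc

theorem wordMem_block {b t s : ℕ} {J : Fin r → ℕ} {g : Fin t → Fin 4 → ℕ} {i : Fin t}
    (h : 3 + r + 4 * (i : ℕ) + 4 ≤ s) (c : Fin 4) :
    wordMem ((searchWord b m n J g).take s).reverse (3 + r + 4 * i + c) = g i c := by
  rw [wordMem_take (by omega), searchWord_block]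

open Classical in
/-- A yes-instance is accepted. -/
theorem IsYes.exists_valid_accepts (h : IsYes A r k ℓ) (hcode : Function.Injective code)
    (hX : ∀ x, symBound F r x ≤ X x) (hm : m ≤ (encode A ℓ).length) :
    ∃ l, Valid (X ((encode A ℓ).map code, k))
        (fun l => Admissible r X code (((encode A ℓ).map code, k), l)) l ∧
      Accepts r X code (((encode A ℓ).map code, k), l) := by
  have hdl : ∀ {J : Fin r → ℕ} {t : ℕ} {g : Fin t → Fin 4 → ℕ}, Describes X code
      (((encode A ℓ).map code, k), (searchWord ℓ.bits.length m n J g).reverse) A ℓ := by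
    intro J t g
    have h := describes_take (k := k) (J := J) (g := g) hcode hX hm
      (s := (searchWord ℓ.bits.length m n J g).length) (by rw [length_searchWord]; omega)
    rw [List.take_length] at h
    exact h.1
  have hlevel : ∀ {J : Fin r → ℕ} {t : ℕ} {g : Fin t → Fin 4 → ℕ} (K : Finset (Fin n))
      (c : Fin n → ℕ), n - ℓ ≤ K.card → (∀ j, c j < vecCount F r) →
      ∑ j ∈ K, mismatches r X code (((encode A ℓ).map code, k),
        (searchWord ℓ.bits.length m n J g).reverse) (c j) j ≤ k →
      ∑ d ∈ Finset.range m, (n - ℓ - closeCount r X code (((encode A ℓ).map code, k),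
        (searchWord ℓ.bits.length m n J g).reverse) d) ≤ k := by
    intro J t g K c hK hc hs
    have h := (level_sum_le_iff (hdl (J := J) (g := g)) k).2 ⟨K, c, hK, hc, hs⟩
    rwa [hdl.rowCount, hdl.colCount, hdl.outlierCount] at h
  have hlen := length_encode A ℓ
  have hn : n ≤ (m + 1) * n := Nat.le_mul_of_pos_left n (by omega)
  obtain ⟨K, hK, hmod⟩ := h.exists_modification
  rcases K.eq_empty_or_nonempty with rfl | hne
  -- If `K` is empty there are no kept columns to choose from, but then `n ≤ ℓ` and any positions
  -- serve, without blocks.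
  · exact RobustLRA.exists_valid_accepts hcode hX hm (J := fun _ => 0) (t := 0)
      (g := fun i => i.elim0) (by omega) (fun _ => by omega) (fun i => i.elim0)
      (fun _ i => i.elim0) (hlevel ∅ (fun _ => 0) hK (fun _ => vecCount_pos) (by simp))
  obtain ⟨J, c, S, R, cls, slot, hS, hsum, hcls⟩ := hmod hne
  let E : S ≃ Fin S.card := S.equivFin
  let mask : Fin m → ℕ := fun x => Nat.ofBits fun l : Fin k =>
    decide ((fun i => A x (J i)) ⬝ᵥ cls x ≠ A x (slot (cls x) l))
  let g : Fin S.card → Fin 4 → ℕ := fun i =>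
    ![(E.symm i : Fin m), vecNum (R (E.symm i)), vecNum (cls (E.symm i)), mask (E.symm i)]
  have hmask : ∀ x, mask x < 2 ^ k := fun x => Nat.ofBits_lt_two_pow _
  have htest : ∀ x l, l < k → ((mask x).testBit l = true ↔
      (fun i => A x (J i)) ⬝ᵥ cls x ≠ A x (slot (cls x) l)) := by
    intro x l hl
    rw [Nat.testBit_ofBits_lt _ l hl, decide_eq_true_iff]
  have hblocks : ∀ {s : ℕ} {i : Fin S.card}, 3 + r + 4 * (i : ℕ) + 4 ≤ s →
      ∀ p : Inst × List ℕ, p = (((encode A ℓ).map code, k), ((searchWord ℓ.bits.length m n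
        (fun i => (J i : ℕ)) g).take s).reverse) →
      blockRow r p i = (E.symm i : Fin m) ∧ blockVec r p i = vecNum (R (E.symm i)) ∧
      blockCls r p i = vecNum (cls (E.symm i)) ∧ blockMask r p i = mask (E.symm i) := by
    rintro s i hs p rfl
    exact ⟨wordMem_block hs 0, wordMem_block hs 1, wordMem_block hs 2, wordMem_block hs 3⟩
  have hcol : ∀ {s : ℕ}, 3 + r ≤ s → ∀ i : Fin r, wordMem ((searchWord ℓ.bits.length m n
        (fun i => (J i : ℕ)) g).take s).reverse (3 + i) = J i := fun {s} hs i => by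
    rw [wordMem_take (by omega), searchWord_col]
  refine RobustLRA.exists_valid_accepts hcode hX hm (J := fun i => J i) (g := g) hS
    (fun i => by have := (J i).2; omega) (fun i c => ?_) (fun s i hs => ?_)
    (hlevel K (fun j => vecNum (c j)) hK (fun _ => vecNum_lt _)
      (le_trans (Finset.sum_le_sum fun j _ => ?_) hsum))
  · have h0 := hmask (E.symm i)
    have h1 := vecNum_lt (R (E.symm i))
    have h2 := vecNum_lt (cls (E.symm i))
    have h3 := (E.symm i : Fin m).2
    simp only [symBound, sizeConst, List.length_map]
    fin_cases c <;> simp [g] <;> omega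
  · obtain ⟨p, hp⟩ : ∃ p : Inst × List ℕ, p = (((encode A ℓ).map code, k), ((searchWord
        ℓ.bits.length m n (fun i => (J i : ℕ)) g).take s).reverse) := ⟨_, rfl⟩
    have hd := (describes_take (k := k) (J := fun i => (J i : ℕ)) (g := g) hcode hX hm
      (s := s) (by omega)).1
    have hJ : ∀ i : Fin r, wordMem p.2 (3 + i) = J i := by
      rw [hp]
      exact hcol (by omega)
    have hk : p.1.2 = k := by rw [hp]
    have hcomplete : ∀ i', Complete r p i' → ∃ i₁ : Fin S.card, (i₁ : ℕ) = i' ∧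
        3 + r + 4 * (i₁ : ℕ) + 4 ≤ s := by
      intro i' hc
      rw [Complete, hp, List.length_reverse, List.length_take, length_searchWord] at hc
      exact ⟨⟨i', by omega⟩, rfl, by dsimp only; omega⟩
    rw [← hp] at hd ⊢
    obtain ⟨b0, b1, b2, b3⟩ := hblocks hs p hp
    have huse : ∀ {i' : Fin S.card}, 3 + r + 4 * (i' : ℕ) + 4 ≤ s → ∀ l < k,
        (UsesSlot r p i' l ↔ (fun i => A (E.symm i') (J i)) ⬝ᵥ cls (E.symm i') ≠
          A (E.symm i') (slot (cls (E.symm i')) l)) := by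
      intro i' hs' l hl
      rw [UsesSlot, (hblocks hs' p hp).2.2.2, hk, htest _ _ hl]
      exact and_iff_right (hmask _)
    refine ⟨⟨?_, ?_, ?_⟩, ?_, fun l hl hu => ?_⟩
    · rw [b1]; exact vecNum_lt _
    · rw [b2]; exact vecNum_lt _
    · rw [b3, hk]; exact hmask _
    · rw [hk]
      refine (hcls _ (E.symm i).2).1.trans_eq ?_
      congr 2
      exact Finset.filter_congr fun l hl => (huse hs l (Finset.mem_range.1 hl)).symm
    · rw [hk] at hl
      -- The slots depend only on the class, so this one column suits all blocks of the class that
      -- use the slot `l`.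
      refine ⟨slot (cls (E.symm i)) l, by rw [hd.colCount]; exact (slot _ l).2, ?_, ?_⟩
      · rw [Light, b2, hd.rowCount, card_filter_range, hk, ← two_mul]
        refine (Finset.card_le_card fun x hx => ?_).trans ((hcls (E.symm i) (E.symm i).2).2 l)
        simp only [Finset.mem_filter, Finset.mem_univ, true_and] at hx ⊢
        exact (baseMismatch_iff hcode hd hJ _ _ x).1 hx
      · rintro i' - hc' heq hu'
        obtain ⟨i', rfl, hs'⟩ := hcomplete i' hc'
        obtain ⟨b0', -, b2', -⟩ := hblocks hs' p hp
        rw [b2', b2] at heq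
        have hcls' : cls (E.symm i') = cls (E.symm i) := by
          rw [← vec_vecNum (cls (E.symm i')), heq, vec_vecNum]
        rw [b0', b2, hd.rowCount, baseMismatch_iff hcode hd hJ, ← hcls']
        exact ⟨(E.symm i' : Fin m).2, (huse hs' l hl).1 hu'⟩
  · obtain ⟨s, hs⟩ : ∃ s, s = 3 + r + 4 * S.card := ⟨_, rfl⟩
    have htake : searchWord ℓ.bits.length m n (fun i => (J i : ℕ)) g =
        (searchWord ℓ.bits.length m n (fun i => (J i : ℕ)) g).take s :=
      (List.take_of_length_le (by rw [length_searchWord, hs])).symm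
    obtain ⟨p, hp⟩ : ∃ p : Inst × List ℕ, p = (((encode A ℓ).map code, k), (searchWord
        ℓ.bits.length m n (fun i => (J i : ℕ)) g).reverse) := ⟨_, rfl⟩
    have hd : Describes X code p A ℓ := hp ▸ hdl
    have hJ : ∀ i : Fin r, wordMem p.2 (3 + i) = J i := by
      rw [hp, htake]
      exact hcol (by omega)
    have hk : p.1.2 = k := by rw [hp]
    have hlen : p.2.length = s := by rw [hp, List.length_reverse, length_searchWord, hs]
    have hb : ∀ i : Fin S.card, blockRow r p i = (E.symm i : Fin m) ∧
        blockVec r p i = vecNum (R (E.symm i)) := fun i => by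
      have h := hblocks (s := s) (i := i) (by omega) p (by rw [← htake, hp])
      exact ⟨h.1, h.2.1⟩
    rw [← hp, mismatches, hd.rowCount, card_filter_range]
    refine Finset.card_le_card fun x hx => ?_
    simp only [Finset.mem_filter, Finset.mem_univ, true_and] at hx ⊢
    intro heq
    refine hx ⟨vecNum (if x ∈ S then R x else fun i => A x (J i)), vecNum_lt _, ?_, ?_⟩
    · by_cases hxS : x ∈ S
      · rw [if_pos hxS]
        have hbx := hb (E ⟨x, hxS⟩)
        rw [Equiv.symm_apply_apply] at hbx
        -- Blocks correspond bijectively to the rows of `S`, so no earlier block names `x`.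
        refine Or.inl ⟨E ⟨x, hxS⟩, by rw [hk]; omega, ?_, hbx.1, hbx.2, fun i' hi' h => ?_⟩
        · rw [Complete, hlen]
          omega
        · rw [(hb ⟨i', by omega⟩).1] at h
          have h1 : E.symm ⟨i', by omega⟩ = ⟨x, hxS⟩ := Subtype.ext (Fin.ext h)
          rw [Equiv.symm_apply_eq] at h1
          rw [← h1] at hi'
          exact lt_irrefl _ hi'
      · rw [if_neg hxS]
        refine Or.inr ⟨fun i hi hc h => hxS ?_, ?_⟩
        · rw [Complete, hlen] at hc
          rw [(hb ⟨i, by omega⟩).1] at h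
          rw [← Fin.ext h]
          exact (E.symm ⟨i, by omega⟩).2
        · rw [baseRow_iff hcode hd hJ (vecNum_lt _), vec_vecNum]
    · rw [dotTable_vecNum _ (vecNum_lt _), vec_vecNum, hd.entry, heq]

end Completeness

end RobustLRA

/-! ### The algorithm -/

namespace RobustLRA

open RAM

variable {F : Type*} [Field F] [Fintype F] {r : ℕ}

omit [Field F] [Fintype F] in
theorem comp_symBound : Comp (inputCtx (sizeConst F r)) (symBound F r) :=
  (((Comp.var 0 rfl).add (Comp.var 1 rfl)).add (.const _ _)).add
    (Comp.two_pow (f := fun x : Inst => x.2) (Comp.var 1 rfl) fun _ =>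
      (Nat.le_add_left _ _).trans (Nat.le_add_right _ _))

omit [Field F] [Fintype F] in
theorem fptBdd_symBound : FPTBdd (symBound F r) :=
  ((FPTBdd.length.add (.of_param fun k => k)).add (.of_param fun _ => sizeConst F r)).add
    (.of_param fun k => 2 ^ k)

theorem fptBdd_visited (code : Letter F → ℕ) :
    FPTBdd fun x => visited (symBound F r x) (fun l => Admissible r (symBound F r) code (x, l))
      (4 * x.2 + (3 + r)) [] := by
  have h1 : FPTBdd fun _ => 1 := .of_param fun _ => 1
  have h := fptBdd_symBound (F := F) (r := r)
  exact FPTBdd.mono (((h.add h1).pow _).mul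
    (((((((FPTBdd.of_param fun _ => 2).add h).add (h.pow 2)).add (h.pow 3)).mul
      (.of_param fun k => (vecCount F r * vecCount F r * 2 ^ k * (k + k) + 1) ^ k)).mul
      ((h.add h1).pow _)).add h1)) fun x => visited_admissible_le x

theorem mem_problem_iff {code : Letter F → ℕ} (hcode : Function.Injective code) {X : Inst → ℕ}
    (hX : ∀ x, symBound F r x ≤ X x) (w : List (Letter F)) (k : ℕ) :
    (w, k) ∈ problem F r ↔ ∃ l, Valid (X (w.map code, k))
      (fun l => Admissible r X code ((w.map code, k), l)) l ∧
        Accepts r X code ((w.map code, k), l) := by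
  constructor
  · rintro ⟨m, n, A, ℓ, rfl : w = _, h⟩
    rcases Nat.eq_zero_or_pos n with rfl | hn
    -- The encoding of a matrix without columns does not show its number of rows, which may exceed
    -- the length of the word and thus `X`. It is replaced by the empty matrix with the same
    -- encoding.
    · have hw : encode A ℓ = encode (0 : Matrix (Fin 0) (Fin 0) F) ℓ := by simp [encode]
      rw [hw]
      refine IsYes.exists_valid_accepts ⟨0, 0, ?_, ?_, ?_⟩ hcode hX (Nat.zero_le _) <;> simp
    · refine IsYes.exists_valid_accepts h hcode hX ?_
      rw [length_encode]
      have := Nat.le_mul_of_pos_right (m + 1) hn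
      omega
  · rintro ⟨l, -, -, hf, hs⟩
    obtain ⟨m, n, A, ℓ, rfl, hd⟩ := exists_describes hcode hf
    exact ⟨m, n, A, ℓ, rfl, isYes_of_describes hcode hd hs⟩

end RobustLRA

theorem theorem4 (F : Type*) [Field F] [Fintype F] (r : ℕ) (hr : 0 < r) :
    IsFPT (RobustLRA.problem F r) := by
  intro code
  let code' : RobustLRA.Letter F → ℕ := fun a => code a
  have hcode : Function.Injective code' := Fin.val_injective.comp code.injective
  have hX : ∀ x, RobustLRA.symBound F r x ≤ RobustLRA.symBound F r x := fun _ => le_rfl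
  obtain ⟨P, f, e, h⟩ := RAM.exists_decides_of_search
    (T := fun x => 4 * x.2 + (3 + r)) RobustLRA.comp_symBound
    (RobustLRA.compP_admissible (code := code') hX (RAM.extends_searchCtx _))
    (RobustLRA.compP_accepts (code := code') hX (RAM.extends_searchCtx _))
    -- The empty word is not accepted because an accepted word has at least `3 + r` symbols.
    (fun x h => by have := h.1; simp at this) (fun x l h => h.1)
    RobustLRA.fptBdd_symBound (RobustLRA.fptBdd_visited code')
  refine ⟨P, f, e, fun w k => ?_⟩
  obtain ⟨t, s, hexec, ht, hyes, hno⟩ := h (w.map code') k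
  rw [List.length_map] at ht
  have hiff := RobustLRA.mem_problem_iff hcode hX w k
  exact ⟨t, s, hexec, ht, fun h => hyes (hiff.1 h), fun h => hno fun h' => h (hiff.2 h')⟩
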